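/- **Theorem 3.5 (higher Morita–Tachikawa correspondence).** Let $R$ be a commutative Noetherian ring. A *projective Noetherian $R$-algebra* is an associative unital $R$-algebra that is finitely generated and projective as an $R$-module. Write $R\text{-proj}$ for the finitely generated projective $R$-modules, $A\text{-mod}$ (resp. $\operatorname{mod-}A$) for the finitely generated left (resp. right) $A$-modules, $D=\operatorname{Hom}_R(-,R)$, and $\operatorname{add}_A M$ for the class of direct summands of finite direct sums of copies of $M$. A sequence of $A$-modules is *$(A,R)$-exact* if it is exact and splits as a sequence of $R$-modules, i.e. every map $d$ of the sequence admits an $R$-linear map $s$ in the opposite direction with $dsd=d$. Let $B$ be a projective Noetherian $R$-algebra and $M\in\operatorname{mod-}B\cap R\text{-proj}$. - $M$ is an *$n$-quasi-generator* of $\operatorname{mod-}B$ if $M\otimes_B DM\in R\text{-proj}$ and $n$ is the minimal non-negative integer for which there is a $(B,R)$-exact sequence $0\to B\to M_0\to\cdots\to M_n\to 0$ with all $M_i\in\operatorname{add}_B M$ that remains exact under $\operatorname{Hom}_B(-,M)$. - $M$ is an *$m$-quasi-$(B,R)$-cogenerator* if $M\otimes_B DM\in R\text{-proj}$ and $m$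 is the minimal non-negative integer for which there is a $(B,R)$-exact sequence $0\to M_m\to\cdots\to M_0\to DB\to 0$ with all $M_i\in\operatorname{add}_B M$ that remains exact under $\operatorname{Hom}_B(M,-)$. Let $A$ be a projective Noetherian $R$-algebra and $M\in A\text{-mod}\cap R\text{-proj}$. - $M\text{-}\operatorname{domdim}(A,R)\ge 2$ means that there is an $(A,R)$-exact sequence $0\to A\to M_1\to M_2$ with $M_1,M_2\in\operatorname{add}_A M$ such that $\operatorname{Hom}_A(M_2,M)\to\operatorname{Hom}_A(M_1,M)\to\operatorname{Hom}_A(A,M)\to 0$ is exact. - $\operatorname{pdim}_A M$ is the projective dimension of $M$, and $\operatorname{idim}_{(A,R)}M$ is the least $m\ge 0$ such that $\operatorname{Ext}_A^{m+1}(N,M)=0$ for all $N\in A\text{-mod}\cap R\text{-proj}$; for the zero module both are taken to be $0$. For all integers $n,m\ge 0$, let $\Gamma_{n,m}$ be the class of pairs $(B,M)$ where $B$ is a projective Noetherian $R$-algebra and $M\in\operatorname{mod-}B\cap R\text{-proj}$ is both an $n$-quasi-generator of $\operatorname{mod-}B$ and an $m$-quasi-$(B,R)$-cogenerator. Let $\Lambda_{n,m}$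 be the class of pairs $(A,M)$ where $A$ is a projective Noetherian $R$-algebra and $M\in A\text{-mod}\cap R\text{-proj}$ satisfies $M\text{-}\operatorname{domdim}(A,R)\ge 2$, $\operatorname{pdim}_A M=n$, $\operatorname{idim}_{(A,R)}M=m$, $DM\otimes_A M\in R\text{-proj}$ and $\operatorname{Tor}_i^A(DM,M)=0$ for all $i>0$. Pairs are considered up to isomorphism, an isomorphism $(A,M)\to(A',M')$ being an isomorphism of $R$-algebras $\varphi\colon A\to A'$ together with an additive isomorphism $\psi\colon M\to M'$ compatible with the actions through $\varphi$. Then $$(B,M)\longmapsto(\operatorname{End}_B(M),M)\qquad\text{and}\qquad (A,M)\longmapsto(\operatorname{End}_A(M)^{op},M)$$ send $\Gamma_{n,m}$ to $\Lambda_{n,m}$ and $\Lambda_{n,m}$ to $\Gamma_{n,m}$ respectively, and they induce mutually inverse bijections between the isomorphism classes of pairs in $\Gamma_{n,m}$ and the isomorphism classes of pairs in $\Lambda_{n,m}$. -/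

import Mathlib

open CategoryTheory
open scoped TensorProduct

universe u

section Basic

/-- Finitely generated projective `R`-modules (the class `R-proj`). -/
def IsFGProj (R : Type u) [CommRing R] (N : Type u) [AddCommGroup N] [Module R N] : Prop :=
  Module.Finite R N ∧ Module.Projective R N

/-- `add Q`: the module `N` is a direct summand of a finite direct sum of copies of `Q`. -/
def InAdd (S : Type u) [Ring S] (Q N : Type u) [AddCommGroup Q] [Module S Q]
    [AddCommGroup N] [Module S N] : Prop :=
  ∃ (k : ℕ) (i : N →ₗ[S] (Fin k → Q)) (p : (Fin k → Q) →ₗ[S] N), p ∘ₗ i = LinearMap.id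

end Basic

section Dual

/-- The standard duality `D M = Hom_R(M, R)`. -/
def StdDual (R : Type u) [CommRing R] (M : Type u) [AddCommGroup M] [Module R M] : Type u :=
  M →ₗ[R] R

variable (R : Type u) [CommRing R] (M : Type u) [AddCommGroup M] [Module R M]

instance StdDual.instAddCommGroup : AddCommGroup (StdDual R M) :=
  inferInstanceAs (AddCommGroup (M →ₗ[R] R))

instance StdDual.instModule : Module R (StdDual R M) :=
  inferInstanceAs (Module R (M →ₗ[R] R))

instance StdDual.instFunLike : FunLike (StdDual R M) M R :=
  inferInstanceAs (FunLike (M →ₗ[R] R) M R)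

/-- The dual of a left `A`-module is a right `A`-module: `(f a)(x) = f (a x)`. -/
instance StdDual.instRight (A : Type u) [Ring A] [Algebra R A] [Module A M]
    [IsScalarTower R A M] : Module Aᵐᵒᵖ (StdDual R M) where
  smul a f := LinearMap.comp (show M →ₗ[R] R from f) (Algebra.lsmul R R M a.unop)
  one_smul f := LinearMap.ext fun x => congrArg (show M →ₗ[R] R from f) (one_smul A x)
  mul_smul a b f := LinearMap.ext fun x =>
    congrArg (show M →ₗ[R] R from f) (mul_smul b.unop a.unop x)
  smul_zero _ := LinearMap.ext fun _ => rfl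
  smul_add _ _ _ := LinearMap.ext fun _ => rfl
  add_smul a b f := LinearMap.ext fun x =>
    (congrArg (show M →ₗ[R] R from f) (add_smul a.unop b.unop x)).trans
      (map_add (show M →ₗ[R] R from f) _ _)
  zero_smul f := LinearMap.ext fun x =>
    (congrArg (show M →ₗ[R] R from f) (zero_smul A x)).trans
      (map_zero (show M →ₗ[R] R from f))

/-- The dual of a right `B`-module is a left `B`-module: `(b f)(x) = f (x b)`. -/
instance StdDual.instLeft (B : Type u) [Ring B] [Algebra R B] [Module Bᵐᵒᵖ M]
    [IsScalarTower R Bᵐᵒᵖ M] : Module B (StdDual R M) where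
  smul b f := LinearMap.comp (show M →ₗ[R] R from f) (Algebra.lsmul R R M (MulOpposite.op b))
  one_smul f := LinearMap.ext fun x =>
    congrArg (show M →ₗ[R] R from f) (one_smul Bᵐᵒᵖ x)
  mul_smul a b f := LinearMap.ext fun x =>
    congrArg (show M →ₗ[R] R from f) (mul_smul (MulOpposite.op b) (MulOpposite.op a) x)
  smul_zero _ := LinearMap.ext fun _ => rfl
  smul_add _ _ _ := LinearMap.ext fun _ => rfl
  add_smul a b f := LinearMap.ext fun x =>
    (congrArg (show M →ₗ[R] R from f) (add_smul (MulOpposite.op a) (MulOpposite.op b) x)).trans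
      (map_add (show M →ₗ[R] R from f) _ _)
  zero_smul f := LinearMap.ext fun x =>
    (congrArg (show M →ₗ[R] R from f) (zero_smul Bᵐᵒᵖ x)).trans
      (map_zero (show M →ₗ[R] R from f))

theorem StdDual.op_smul_apply (A : Type u) [Ring A] [Algebra R A] [Module A M]
    [IsScalarTower R A M] (a : A) (f : StdDual R M) (x : M) :
    (MulOpposite.op a • f) x = f (a • x) := rfl

theorem StdDual.smul_apply (B : Type u) [Ring B] [Algebra R B] [Module Bᵐᵒᵖ M]
    [IsScalarTower R Bᵐᵒᵖ M] (b : B) (f : StdDual R M) (x : M) :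
    (b • f) x = f (MulOpposite.op b • x) := rfl

theorem StdDual.algebraSmul_apply (r : R) (f : StdDual R M) (x : M) :
    (r • f) x = r * f x := rfl

instance StdDual.instTowerRight (A : Type u) [Ring A] [Algebra R A] [Module A M]
    [IsScalarTower R A M] : IsScalarTower R Aᵐᵒᵖ (StdDual R M) where
  smul_assoc r a f := LinearMap.ext fun x =>
    (congrArg (show M →ₗ[R] R from f) (smul_assoc r a.unop x)).trans
      (map_smul (show M →ₗ[R] R from f) r _)

instance StdDual.instTowerLeft (B : Type u) [Ring B] [Algebra R B] [Module Bᵐᵒᵖ M]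
    [IsScalarTower R Bᵐᵒᵖ M] : IsScalarTower R B (StdDual R M) where
  smul_assoc r b f := LinearMap.ext fun x =>
    (congrArg (show M →ₗ[R] R from f) (smul_assoc r (MulOpposite.op b) x)).trans
      (map_smul (show M →ₗ[R] R from f) r _)

end Dual

section Tensor

variable (R : Type u) [CommRing R] (A : Type u) [Ring A]
variable (X : Type u) [AddCommGroup X] [Module R X] [Module Aᵐᵒᵖ X]

/-- The `R`-submodule of `X ⊗_ℤ Y` generated by the relations `(x a) ⊗ y = x ⊗ (a y)`. -/
def balancedRel (Y : Type u) [AddCommGroup Y] [Module A Y] : Submodule R (X ⊗[ℤ] Y) :=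
  Submodule.span R
    {t | ∃ (x : X) (a : A) (y : Y), t = (MulOpposite.op a • x) ⊗ₜ[ℤ] y - x ⊗ₜ[ℤ] (a • y)}

/-- The tensor product `X ⊗_A Y` of a right `A`-module and a left `A`-module over the
(noncommutative) `R`-algebra `A`, as an `R`-module; `R` acts through `X`. -/
abbrev BalTensor (Y : Type u) [AddCommGroup Y] [Module A Y] : Type u :=
  (X ⊗[ℤ] Y) ⧸ balancedRel R A X Y

/-- The map `X ⊗_A f`. -/
noncomputable def BalTensor.map {Y Z : Type u} [AddCommGroup Y] [Module A Y]
    [AddCommGroup Z] [Module A Z] (f : Y →ₗ[A] Z) :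
    BalTensor R A X Y →ₗ[R] BalTensor R A X Z :=
  Submodule.mapQ (balancedRel R A X Y) (balancedRel R A X Z)
    (TensorProduct.AlgebraTensorModule.lTensor R X f.toAddMonoidHom.toIntLinearMap) (by
      refine Submodule.span_le.2 ?_
      rintro t ⟨x, a, y, rfl⟩
      refine Submodule.subset_span ⟨x, a, f y, ?_⟩
      simp)

theorem BalTensor.map_mk {Y Z : Type u} [AddCommGroup Y] [Module A Y]
    [AddCommGroup Z] [Module A Z] (f : Y →ₗ[A] Z) (x : X) (y : Y) :
    BalTensor.map R A X f ((balancedRel R A X Y).mkQ (x ⊗ₜ[ℤ] y)) =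
      (balancedRel R A X Z).mkQ (x ⊗ₜ[ℤ] f y) := rfl

theorem BalTensor.hom_ext {Y : Type u} [AddCommGroup Y] [Module A Y]
    {N : Type u} [AddCommGroup N] [Module R N] {f g : BalTensor R A X Y →ₗ[R] N}
    (h : ∀ x y, f ((balancedRel R A X Y).mkQ (x ⊗ₜ[ℤ] y)) =
      g ((balancedRel R A X Y).mkQ (x ⊗ₜ[ℤ] y))) : f = g :=
  Submodule.linearMap_qext _ (TensorProduct.AlgebraTensorModule.ext h)

/-- The functor `X ⊗_A - : A-Mod ⥤ R-Mod`. -/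
noncomputable def tensorFunctor : ModuleCat.{u} A ⥤ ModuleCat.{u} R where
  obj Y := ModuleCat.of R (BalTensor R A X Y)
  map f := ModuleCat.ofHom (BalTensor.map R A X f.hom)
  map_id _ := ModuleCat.hom_ext (BalTensor.hom_ext R A X fun _ _ => rfl)
  map_comp _ _ := ModuleCat.hom_ext (BalTensor.hom_ext R A X fun _ _ => rfl)

instance tensorFunctor_additive : (tensorFunctor R A X).Additive where
  map_add {_ Z f g} := ModuleCat.hom_ext (BalTensor.hom_ext R A X fun x y =>
    (congrArg (balancedRel R A X Z).mkQ (TensorProduct.tmul_add x (f.hom y) (g.hom y))).trans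
      (map_add _ _ _))

/-- `Tor_i^A(X, Y)`, the `i`-th left derived functor of `X ⊗_A -` evaluated at `Y`. -/
noncomputable def TorMod (i : ℕ) (Y : Type u) [AddCommGroup Y] [Module A Y] : ModuleCat.{u} R :=
  ((tensorFunctor R A X).leftDerived i).obj (ModuleCat.of A Y)

end Tensor

section Sequences

variable (R : Type u) [CommRing R] (S : Type u) [Ring S]
variable (C : ℕ → Type u) [∀ i, AddCommGroup (C i)] [∀ i, Module R (C i)] [∀ i, Module S (C i)]

/-- `0 → C 0 → C 1 → ⋯ → C k` is `(S, R)`-exact: exact, and split as a sequence of `R`-modules. -/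
def IsRelExact (d : ∀ i, C i →ₗ[S] C (i + 1)) (k : ℕ) : Prop :=
  (1 ≤ k → Function.Injective (d 0)) ∧
  (∀ i, i + 2 ≤ k → Function.Exact (d i) (d (i + 1))) ∧
  (∀ i, i + 1 ≤ k → ∃ s : C (i + 1) →ₗ[R] C i, ∀ x, d i (s (d i x)) = d i x)

/-- `Hom_S(C k, Q) → ⋯ → Hom_S(C 1, Q) → Hom_S(C 0, Q) → 0` is exact. -/
def IsHomExactInto (Q : Type u) [AddCommGroup Q] [Module S Q]
    (d : ∀ i, C i →ₗ[S] C (i + 1)) (k : ℕ) : Prop :=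
  (1 ≤ k → Function.Surjective (fun g : C 1 →ₗ[S] Q => g ∘ₗ d 0)) ∧
  (∀ i, i + 2 ≤ k → Function.Exact (fun g : C (i + 2) →ₗ[S] Q => g ∘ₗ d (i + 1))
    (fun g : C (i + 1) →ₗ[S] Q => g ∘ₗ d i))

/-- `C k → ⋯ → C 1 → C 0 → 0` is `(S, R)`-exact. -/
def IsRelCoexact (d : ∀ i, C (i + 1) →ₗ[S] C i) (k : ℕ) : Prop :=
  (1 ≤ k → Function.Surjective (d 0)) ∧
  (∀ i, i + 2 ≤ k → Function.Exact (d (i + 1)) (d i)) ∧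
  (∀ i, i + 1 ≤ k → ∃ s : C i →ₗ[R] C (i + 1), ∀ x, d i (s (d i x)) = d i x)

/-- `Hom_S(Q, C k) → ⋯ → Hom_S(Q, C 1) → Hom_S(Q, C 0) → 0` is exact. -/
def IsHomExactFrom (Q : Type u) [AddCommGroup Q] [Module S Q]
    (d : ∀ i, C (i + 1) →ₗ[S] C i) (k : ℕ) : Prop :=
  (1 ≤ k → Function.Surjective (fun g : Q →ₗ[S] C 1 => d 0 ∘ₗ g)) ∧
  (∀ i, i + 2 ≤ k → Function.Exact (fun g : Q →ₗ[S] C (i + 2) => d (i + 1) ∘ₗ g)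
    (fun g : Q →ₗ[S] C (i + 1) => d i ∘ₗ g))

end Sequences

section Dimensions

/-- `Q-domdim_{(A,R)} X ≥ k`: there is an `(A, R)`-exact sequence `0 → X → Q_1 → ⋯ → Q_k` with all
`Q_i` in `add Q` that remains exact under `Hom_A(-, Q)`. -/
def RelDomDimGE (R : Type u) [CommRing R] (A : Type u) [Ring A] [Algebra R A]
    (Q X : Type u) [AddCommGroup Q] [Module A Q] [AddCommGroup X] [Module A X] (k : ℕ) : Prop :=
  ∃ (C : ℕ → Type u) (_ : ∀ i, AddCommGroup (C i)) (_ : ∀ i, Module R (C i))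
    (_ : ∀ i, Module A (C i)) (_ : ∀ i, IsScalarTower R A (C i))
    (d : ∀ i, C i →ₗ[A] C (i + 1)),
    Nonempty (X ≃ₗ[A] C 0) ∧
    (∀ i, 1 ≤ i → i ≤ k → InAdd A Q (C i)) ∧
    IsRelExact R A C d k ∧ IsHomExactInto A C Q d k

/-- `pdim_A M = n` (the zero module has projective dimension `0`). -/
def PDimEq (A : Type u) [Ring A] (M : Type u) [AddCommGroup M] [Module A M] (n : ℕ) : Prop :=
  IsLeast {k : ℕ | HasProjectiveDimensionLE (ModuleCat.of A M) k} n

/-- `idim_{(A,R)} M ≤ k`: `Ext_A^{k+1}(N, M) = 0` for all finitely generated `A`-modules `N` that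
are projective over `R`. -/
def RelIDimLE (R : Type u) [CommRing R] (A : Type u) [Ring A] [Algebra R A]
    (M : Type u) [AddCommGroup M] [Module A M] (k : ℕ) : Prop :=
  ∀ (N : Type u) [AddCommGroup N] [Module R N] [Module A N] [IsScalarTower R A N],
    Module.Finite A N → Module.Projective R N →
      Subsingleton (Abelian.Ext.{u} (ModuleCat.of A N) (ModuleCat.of A M) (k + 1))

/-- `idim_{(A,R)} M = n`. -/
def RelIDimEq (R : Type u) [CommRing R] (A : Type u) [Ring A] [Algebra R A]
    (M : Type u) [AddCommGroup M] [Module A M] (n : ℕ) : Prop :=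
  IsLeast {k : ℕ | RelIDimLE R A M k} n

end Dimensions

section QuasiGenerators

variable (R : Type u) [CommRing R] (B : Type u) [Ring B] [Algebra R B]
variable (M : Type u) [AddCommGroup M] [Module R M] [Module Bᵐᵒᵖ M]

/-- There is a `(B, R)`-exact sequence of right `B`-modules `0 → B → M_0 → ⋯ → M_k → 0` with all
`M_i` in `add M` that remains exact under `Hom_B(-, M)`. The term `M_i` is `C (i + 1)`, and the
final zero is `C (k + 2)`. -/
def HasAddCoresolution (k : ℕ) : Prop :=
  ∃ (C : ℕ → Type u) (_ : ∀ i, AddCommGroup (C i)) (_ : ∀ i, Module R (C i))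
    (_ : ∀ i, Module Bᵐᵒᵖ (C i)) (_ : ∀ i, IsScalarTower R Bᵐᵒᵖ (C i))
    (d : ∀ i, C i →ₗ[Bᵐᵒᵖ] C (i + 1)),
    Nonempty (B ≃ₗ[Bᵐᵒᵖ] C 0) ∧
    (∀ i ≤ k, InAdd Bᵐᵒᵖ M (C (i + 1))) ∧
    Subsingleton (C (k + 2)) ∧
    IsRelExact R Bᵐᵒᵖ C d (k + 2) ∧ IsHomExactInto Bᵐᵒᵖ C M d (k + 2)

/-- There is a `(B, R)`-exact sequence of right `B`-modules `0 → M_k → ⋯ → M_0 → DB → 0` with all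
`M_i` in `add M` that remains exact under `Hom_B(M, -)`. -/
def HasAddResolution (k : ℕ) : Prop :=
  ∃ (C : ℕ → Type u) (_ : ∀ i, AddCommGroup (C i)) (_ : ∀ i, Module R (C i))
    (_ : ∀ i, Module Bᵐᵒᵖ (C i)) (_ : ∀ i, IsScalarTower R Bᵐᵒᵖ (C i))
    (d : ∀ i, C (i + 1) →ₗ[Bᵐᵒᵖ] C i),
    Nonempty (StdDual R B ≃ₗ[Bᵐᵒᵖ] C 0) ∧
    (∀ i ≤ k, InAdd Bᵐᵒᵖ M (C (i + 1))) ∧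
    Subsingleton (C (k + 2)) ∧
    IsRelCoexact R Bᵐᵒᵖ C d (k + 2) ∧ IsHomExactFrom Bᵐᵒᵖ C M d (k + 2)

variable [IsScalarTower R Bᵐᵒᵖ M]

/-- The right `B`-module `M` is an `n`-quasi-generator of `mod-B`. -/
def IsQuasiGenerator (n : ℕ) : Prop :=
  Module.Finite Bᵐᵒᵖ M ∧ Module.Projective R M ∧
  IsFGProj R (BalTensor R B M (StdDual R M)) ∧
  IsLeast {k : ℕ | HasAddCoresolution R B M k} n

/-- The right `B`-module `M` is an `n`-quasi-`(B, R)`-cogenerator. -/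
def IsQuasiCogenerator (n : ℕ) : Prop :=
  Module.Finite Bᵐᵒᵖ M ∧ Module.Projective R M ∧
  IsFGProj R (BalTensor R B M (StdDual R M)) ∧
  IsLeast {k : ℕ | HasAddResolution R B M k} n

end QuasiGenerators

section Pairs

/-- A pair `(B, M)` of an `R`-algebra `B` and a right `B`-module `M`. -/
structure RightPair (R : Type u) [CommRing R] where
  B : Type u
  M : Type u
  [ringB : Ring B]
  [algB : Algebra R B]
  [grpM : AddCommGroup M]
  [modR : Module R M]
  [modB : Module Bᵐᵒᵖ M]
  [tower : IsScalarTower R Bᵐᵒᵖ M]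

attribute [instance] RightPair.ringB RightPair.algB RightPair.grpM RightPair.modR RightPair.modB
  RightPair.tower

/-- A pair `(A, M)` of an `R`-algebra `A` and a left `A`-module `M`. -/
structure LeftPair (R : Type u) [CommRing R] where
  A : Type u
  M : Type u
  [ringA : Ring A]
  [algA : Algebra R A]
  [grpM : AddCommGroup M]
  [modR : Module R M]
  [modA : Module A M]
  [tower : IsScalarTower R A M]

attribute [instance] LeftPair.ringA LeftPair.algA LeftPair.grpM LeftPair.modR LeftPair.modA
  LeftPair.tower

variable {R : Type u} [CommRing R]

/-- `B` is a projective Noetherian `R`-algebra, `M` is an `n`-quasi-generator of `mod-B` and an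
`m`-quasi-`(B, R)`-cogenerator. -/
def RightPair.InGamma (P : RightPair R) (n m : ℕ) : Prop :=
  IsFGProj R P.B ∧ IsQuasiGenerator R P.B P.M n ∧ IsQuasiCogenerator R P.B P.M m

/-- `A` is a projective Noetherian `R`-algebra, `M` is in `A-mod ∩ R-proj`,
`M-domdim (A, R) ≥ 2`, `pdim_A M = n`, `idim_{(A,R)} M = m`, `DM ⊗_A M` is in `R-proj`, and
`Tor_i^A(DM, M) = 0` for all `i > 0`. -/
def LeftPair.InLambda (P : LeftPair R) (n m : ℕ) : Prop :=
  IsFGProj R P.A ∧ Module.Finite P.A P.M ∧ Module.Projective R P.M ∧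
  RelDomDimGE R P.A P.M P.A 2 ∧
  PDimEq P.A P.M n ∧
  RelIDimEq R P.A P.M m ∧
  IsFGProj R (BalTensor R P.A (StdDual R P.M) P.M) ∧
  ∀ i : ℕ, 0 < i → Limits.IsZero (TorMod R P.A (StdDual R P.M) i P.M)

/-- The pair `(End_B(M), M)`; the product of `End_B(M)` is composition. -/
def RightPair.toEnd (P : RightPair R) : LeftPair R where
  A := Module.End P.Bᵐᵒᵖ P.M
  M := P.M
  tower := ⟨fun _ _ _ => rfl⟩

/-- The pair `(End_A(M)^op, M)`; the right action of `End_A(M)^op` is `x · f = f x`. -/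
def LeftPair.toEndOp (P : LeftPair R) : RightPair R :=
  letI : Module (Module.End P.A P.M)ᵐᵒᵖᵐᵒᵖ P.M :=
    Module.compHom P.M (RingEquiv.opOp (Module.End P.A P.M)).symm.toRingHom
  { B := (Module.End P.A P.M)ᵐᵒᵖ
    M := P.M
    tower := ⟨fun _ _ _ => rfl⟩ }

/-- Isomorphism of pairs: an isomorphism of `R`-algebras with a compatible isomorphism of
modules. -/
def RightPair.Iso (P Q : RightPair R) : Prop :=
  ∃ (φ : P.B ≃ₐ[R] Q.B) (ψ : P.M ≃+ Q.M),
    ∀ (b : P.B) (x : P.M), ψ (MulOpposite.op b • x) = MulOpposite.op (φ b) • ψ x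

/-- Isomorphism of pairs: an isomorphism of `R`-algebras with a compatible isomorphism of
modules. -/
def LeftPair.Iso (P Q : LeftPair R) : Prop :=
  ∃ (φ : P.A ≃ₐ[R] Q.A) (ψ : P.M ≃+ Q.M),
    ∀ (a : P.A) (x : P.M), ψ (a • x) = φ a • ψ x

theorem RightPair.iso_equivalence : Equivalence (RightPair.Iso (R := R)) where
  refl P := ⟨AlgEquiv.refl, AddEquiv.refl _, fun _ _ => rfl⟩
  symm := by
    rintro P Q ⟨φ, ψ, h⟩
    refine ⟨φ.symm, ψ.symm, fun b x => ?_⟩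
    rw [AddEquiv.symm_apply_eq, h]
    simp
  trans := by
    rintro P Q T ⟨φ, ψ, h⟩ ⟨φ', ψ', h'⟩
    exact ⟨φ.trans φ', ψ.trans ψ', fun b x => by simp [h, h']⟩

theorem LeftPair.iso_equivalence : Equivalence (LeftPair.Iso (R := R)) where
  refl P := ⟨AlgEquiv.refl, AddEquiv.refl _, fun _ _ => rfl⟩
  symm := by
    rintro P Q ⟨φ, ψ, h⟩
    refine ⟨φ.symm, ψ.symm, fun b x => ?_⟩
    rw [AddEquiv.symm_apply_eq, h]
    simp
  trans := by
    rintro P Q T ⟨φ, ψ, h⟩ ⟨φ', ψ', h'⟩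
    exact ⟨φ.trans φ', ψ.trans ψ', fun b x => by simp [h, h']⟩

variable (R)

/-- Isomorphism as an equivalence relation on the pairs `(B, M)` with `InGamma n m`. -/
def gammaSetoid (n m : ℕ) : Setoid {P : RightPair R // P.InGamma n m} where
  r P Q := P.1.Iso Q.1
  iseqv := ⟨fun P => RightPair.iso_equivalence.refl P.1, RightPair.iso_equivalence.symm,
    RightPair.iso_equivalence.trans⟩

/-- Isomorphism as an equivalence relation on the pairs `(A, M)` with `InLambda n m`. -/
def lambdaSetoid (n m : ℕ) : Setoid {P : LeftPair R // P.InLambda n m} where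
  r P Q := P.1.Iso Q.1
  iseqv := ⟨fun P => LeftPair.iso_equivalence.refl P.1, LeftPair.iso_equivalence.symm,
    LeftPair.iso_equivalence.trans⟩

end Pairs

/-! Regard `M` as a left module over two algebras `A` and `B` with commuting actions, `B` standing
for the opposite of the algebra that acts on the right. In both classes `A` and `B` turn out to be
each other's full commutant on `M` (`EndBijective`). Each remaining condition on one side is then
transported to the other side by a functor Hom(-, M) or D Hom(M, -).

Generators and projective dimension. Hom_B(-, M) sends `M` to `A`, hence add M to projective
`A`-modules, and it sends `B` to `M`. An add M-coresolution of `B` that stays exact becomes a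
projective resolution of `M` of the same length (`AddCores.hasProjectiveDimensionLE`). Tensoring
that resolution with DM returns the dual of the coresolution, because DM ⊗_A Hom_B(X, M) ≅ DX for
these X. Hence DM ⊗_A M ≅ DB and the higher Tor groups vanish
(`AddCores.tensorHomToDual_bijective`). Conversely, Hom_A(N, M) ≅ D(DM ⊗_A N) (`homEquivDual`).
Vanishing Tor and projectivity of DM ⊗_A M make a free resolution of `M` split over `R` after
tensoring with DM, so Hom_A(-, M) keeps it exact and yields a coresolution of `B`
(`addCores_of_hasProjectiveDimensionLE`).

Cogenerators and relative injective dimension. D Hom_B(M, -) sends `M` to DA, which is injective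
relative to `R`-split monomorphisms, and DB to `M`. So an add M-resolution of DB becomes a
relatively injective coresolution of `M` (`AddRes.relIDimLE`). For the converse, the adjunction
above also gives Ext_A^i(M, M) = 0 for i > 0, so Hom_A(M, -) is exact on a coresolution of `M` by
copies of DA (`addRes_of_relIDimLE`).

Dominant dimension. Hom_B(-, M) turns a free presentation of `M` over `B` into 0 → A → M^n → M^n',
which is `R`-split because the tensor product of `M` and DM over `B` is projective
(`relDomDimGE_two`). Conversely, such a sequence forces the double centralizer property and DM ⊗_B M
≅ DA (`endBijective_of_relDomDimGE`, `isFGProj_tensor_of_relDomDimGE`).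

The comparisons hold for each length separately, so the minimal lengths agree. The endomorphism
algebras are finitely generated projective because End(M) ≅ D(DM ⊗ M). -/

namespace BalTensor

/-! ### Balanced tensor products: elementary tensors and right exactness -/

section Basic

variable {R : Type u} [CommRing R] {A : Type u} [Ring A]
variable {X : Type u} [AddCommGroup X] [Module R X] [Module Aᵐᵒᵖ X]
variable {Y : Type u} [AddCommGroup Y] [Module A Y]
variable {N : Type u} [AddCommGroup N] [Module R N]

variable (R A) in
/-- The elementary tensor `x ⊗ y` in `X ⊗_A Y`. -/
def tmul (x : X) (y : Y) : BalTensor R A X Y := (balancedRel R A X Y).mkQ (x ⊗ₜ[ℤ] y)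

theorem tmul_add (x : X) (y y' : Y) : tmul R A x (y + y') = tmul R A x y + tmul R A x y' := by
  simp only [tmul, TensorProduct.tmul_add, map_add]

theorem add_tmul (x x' : X) (y : Y) : tmul R A (x + x') y = tmul R A x y + tmul R A x' y := by
  simp only [tmul, TensorProduct.add_tmul, map_add]

theorem smul_tmul (r : R) (x : X) (y : Y) : tmul R A (r • x) y = r • tmul R A x y := by
  simp only [tmul, ← map_smul, TensorProduct.smul_tmul']

theorem op_smul_tmul (a : A) (x : X) (y : Y) :
    tmul R A (MulOpposite.op a • x) y = tmul R A x (a • y) := by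
  rw [tmul, tmul, ← sub_eq_zero, ← map_sub]
  exact (Submodule.Quotient.mk_eq_zero _).2 (Submodule.subset_span ⟨x, a, y, rfl⟩)

theorem tmul_zero (x : X) : tmul R A x (0 : Y) = 0 := by
  simp only [tmul, TensorProduct.tmul_zero, map_zero]

theorem tmul_neg (x : X) (y : Y) : tmul R A x (-y) = -tmul R A x y := by
  simp only [tmul, TensorProduct.tmul_neg, map_neg]

theorem tmul_sub (x : X) (y y' : Y) : tmul R A x (y - y') = tmul R A x y - tmul R A x y' := by
  rw [sub_eq_add_neg, tmul_add, tmul_neg, sub_eq_add_neg]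

theorem tmul_sum {ι : Type*} (s : Finset ι) (x : X) (y : ι → Y) :
    tmul R A x (∑ i ∈ s, y i) = ∑ i ∈ s, tmul R A x (y i) := by
  simp only [tmul, TensorProduct.tmul_sum, map_sum]

theorem map_tmul {Z : Type u} [AddCommGroup Z] [Module A Z] (f : Y →ₗ[A] Z) (x : X) (y : Y) :
    map R A X f (tmul R A x y) = tmul R A x (f y) := rfl

/-- The linear map on `X ⊗_A Y` induced by a balanced biadditive function. -/
noncomputable def lift (f : X → Y → N) (h₁ : ∀ x x' y, f (x + x') y = f x y + f x' y)
    (h₂ : ∀ (r : R) x y, f (r • x) y = r • f x y) (h₃ : ∀ x y y', f x (y + y') = f x y + f x y')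
    (h₄ : ∀ x (a : A) y, f (MulOpposite.op a • x) y = f x (a • y)) :
    BalTensor R A X Y →ₗ[R] N :=
  (balancedRel R A X Y).liftQ
    (TensorProduct.AlgebraTensorModule.lift
      { toFun := fun x => (AddMonoidHom.mk' (f x) (h₃ x)).toIntLinearMap
        map_add' := fun x x' => LinearMap.ext fun y => h₁ x x' y
        map_smul' := fun r x => LinearMap.ext fun y => h₂ r x y } :
      X ⊗[ℤ] Y →ₗ[R] N) (by
    refine Submodule.span_le.2 ?_
    rintro t ⟨x, a, y, rfl⟩
    change _ = _
    rw [map_sub, sub_eq_zero]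
    exact h₄ x a y)

@[elab_as_elim]
theorem induction_on {p : BalTensor R A X Y → Prop} (t : BalTensor R A X Y)
    (zero : p 0) (tmul : ∀ x y, p (tmul R A x y)) (add : ∀ s t, p s → p t → p (s + t)) : p t := by
  obtain ⟨t, rfl⟩ := Submodule.mkQ_surjective _ t
  induction t using TensorProduct.induction_on with
  | zero => exact zero
  | tmul x y => exact tmul x y
  | add s t hs ht => rw [map_add]; exact add _ _ hs ht

theorem map_surjective {Z : Type u} [AddCommGroup Z] [Module A Z] {f : Y →ₗ[A] Z}
    (hf : Function.Surjective f) : Function.Surjective (map R A X f) := by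
  intro t
  induction t using induction_on with
  | zero => exact ⟨0, map_zero _⟩
  | tmul x z =>
    obtain ⟨y, rfl⟩ := hf z
    exact ⟨tmul R A x y, map_tmul f x y⟩
  | add s t hs ht =>
    obtain ⟨s, rfl⟩ := hs
    obtain ⟨t, rfl⟩ := ht
    exact ⟨s + t, map_add _ _ _⟩

/-- Lifting elements of `W` to `Z` gives a map from X ⊗ W to the cokernel of X ⊗ f: two lifts differ
by an element of the range of `f`, so the choice does not matter. Its composite with X ⊗ g is the
quotient map, so the kernel of X ⊗ g lies in the range of X ⊗ f. -/
theorem map_exact {Z W : Type u} [AddCommGroup Z] [Module A Z] [AddCommGroup W] [Module A W]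
    {f : Y →ₗ[A] Z} {g : Z →ₗ[A] W} (hfg : Function.Exact f g) (hg : Function.Surjective g) :
    Function.Exact (map R A X f) (map R A X g) := by
  have key : ∀ x z z', g z = g z' →
      (LinearMap.range (map R A X f)).mkQ (tmul R A x z) =
        (LinearMap.range (map R A X f)).mkQ (tmul R A x z') := by
    intro x z z' h
    obtain ⟨y, hy⟩ := (hfg (z - z')).1 (by rw [map_sub, h, sub_self])
    rw [← sub_eq_zero, ← map_sub, ← tmul_sub, ← hy, ← map_tmul]
    exact (Submodule.Quotient.mk_eq_zero _).2 ⟨_, rfl⟩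
  let s := Function.surjInv hg
  have hs : ∀ w, g (s w) = w := Function.surjInv_eq hg
  let q : BalTensor R A X W →ₗ[R] BalTensor R A X Z ⧸ LinearMap.range (map R A X f) :=
    lift (fun x w => (LinearMap.range (map R A X f)).mkQ (tmul R A x (s w)))
      (fun x x' w => by rw [add_tmul, map_add]) (fun r x w => by rw [smul_tmul, map_smul])
      (fun x w w' => by
        rw [← map_add, ← tmul_add]
        exact key _ _ _ (by rw [map_add, hs, hs, hs]))
      (fun x a w => by
        rw [op_smul_tmul]
        exact key _ _ _ (by rw [map_smul, hs, hs]))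
  have hq : q ∘ₗ map R A X g = (LinearMap.range (map R A X f)).mkQ :=
    hom_ext R A X fun x z => key x _ _ (hs _)
  intro t
  constructor
  · intro ht
    have := LinearMap.congr_fun hq t
    rw [LinearMap.comp_apply, ht, map_zero] at this
    exact (Submodule.Quotient.mk_eq_zero _).1 this.symm
  · rintro ⟨t, rfl⟩
    induction t using induction_on with
    | zero => simp
    | tmul x y => rw [map_tmul, map_tmul, hfg.apply_apply_eq_zero, tmul_zero]
    | add s t hs ht => rw [map_add, map_add, hs, ht, add_zero]

theorem map_id : map R A X (LinearMap.id : Y →ₗ[A] Y) = LinearMap.id :=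
  hom_ext R A X fun _ _ => rfl

theorem map_comp {Z W : Type u} [AddCommGroup Z] [Module A Z] [AddCommGroup W] [Module A W]
    (f : Y →ₗ[A] Z) (g : Z →ₗ[A] W) : map R A X (g ∘ₗ f) = map R A X g ∘ₗ map R A X f :=
  hom_ext R A X fun _ _ => rfl

end Basic

end BalTensor

/-! ### Dimension shifting for left derived functors -/

section Splice

open Limits

universe v w v' w'

variable {C : Type w} [Category.{v} C] [Abelian C]

theorem ShortComplex.exact_comp_mono {X₁ X₂ X₃ X₄ : C} {f : X₁ ⟶ X₂} {g : X₂ ⟶ X₃} (ι : X₃ ⟶ X₄)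
    [Mono ι] {w : f ≫ g = 0} (h : (ShortComplex.mk f g w).Exact) (w' : f ≫ g ≫ ι = 0) :
    (ShortComplex.mk f (g ≫ ι) w').Exact := by
  let φ : ShortComplex.mk f g w ⟶ ShortComplex.mk f (g ≫ ι) w' :=
    { τ₁ := 𝟙 _, τ₂ := 𝟙 _, τ₃ := ι }
  have : Epi φ.τ₁ := inferInstanceAs (Epi (𝟙 _))
  have : IsIso φ.τ₂ := inferInstanceAs (IsIso (𝟙 _))
  have : Mono φ.τ₃ := inferInstanceAs (Mono ι)
  exact (ShortComplex.exact_iff_of_epi_of_isIso_of_mono φ).1 h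

theorem ShortComplex.exact_epi_comp {X₁ X₂ X₃ X₄ : C} (p : X₁ ⟶ X₂) {f : X₂ ⟶ X₃} {g : X₃ ⟶ X₄}
    [Epi p] {w : f ≫ g = 0} (h : (ShortComplex.mk f g w).Exact) (w' : (p ≫ f) ≫ g = 0) :
    (ShortComplex.mk (p ≫ f) g w').Exact := by
  let φ : ShortComplex.mk (p ≫ f) g w' ⟶ ShortComplex.mk f g w :=
    { τ₁ := p, τ₂ := 𝟙 _, τ₃ := 𝟙 _ }
  have : Epi φ.τ₁ := inferInstanceAs (Epi p)
  have : IsIso φ.τ₂ := inferInstanceAs (IsIso (𝟙 _))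
  have : Mono φ.τ₃ := inferInstanceAs (Mono (𝟙 _))
  exact (ShortComplex.exact_iff_of_epi_of_isIso_of_mono φ).2 h

/-- A diagram chase: a generalized element killed by `ι` lifts along the epimorphism `g` after
pullback, exactness writes the lift as coming from `f` after a further cover, and `f ≫ g = 0` kills
it. -/
theorem ShortComplex.mono_of_exact_comp {X₁ X₂ X₃ X₄ : C} {f : X₁ ⟶ X₂} {g : X₂ ⟶ X₃}
    (ι : X₃ ⟶ X₄) [Epi g] (w : f ≫ g = 0) {w' : f ≫ g ≫ ι = 0}
    (h : (ShortComplex.mk f (g ≫ ι) w').Exact) : Mono ι := by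
  refine Preadditive.mono_of_cancel_zero _ fun {G} t ht => ?_
  have hpq : pullback.fst t g ≫ t = pullback.snd t g ≫ g := pullback.condition
  have hq : pullback.snd t g ≫ g ≫ ι = 0 := by
    rw [← Category.assoc, ← hpq, Category.assoc, ht, comp_zero]
  obtain ⟨A, π, _, x, hx⟩ := h.exact_up_to_refinements (pullback.snd t g) hq
  have key : π ≫ pullback.fst t g ≫ t = 0 := by
    rw [hpq, ← Category.assoc, hx, Category.assoc]
    change x ≫ f ≫ g = 0
    rw [w, comp_zero]
  rw [← cancel_epi (pullback.fst t g), ← cancel_epi π, key, comp_zero, comp_zero]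

/-- The augmentation of a projective resolution. -/
noncomputable def CategoryTheory.ProjectiveResolution.augmentation {Z : C}
    (Q : ProjectiveResolution Z) : Q.complex.X 0 ⟶ Z := Q.π.f 0

instance {Z : C} (Q : ProjectiveResolution Z) : Epi Q.augmentation :=
  inferInstanceAs (Epi (Q.π.f 0))

theorem CategoryTheory.ProjectiveResolution.d_comp_augmentation {Z : C}
    (Q : ProjectiveResolution Z) : Q.complex.d 1 0 ≫ Q.augmentation = 0 :=
  Q.complex_d_comp_π_f_zero

theorem CategoryTheory.ProjectiveResolution.exact_augmentation {Z : C}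
    (Q : ProjectiveResolution Z) :
    (ShortComplex.mk (Q.complex.d 1 0) Q.augmentation Q.d_comp_augmentation).Exact :=
  ShortComplex.exact_of_g_is_cokernel _ Q.isColimitCokernelCofork

/-- The complex obtained from a projective resolution of `X₁` by splicing it with a short exact
sequence `0 ⟶ X₁ ⟶ X₂ ⟶ X₃ ⟶ 0`. -/
noncomputable def spliceComplex (S : ShortComplex C) (Q : ProjectiveResolution S.X₁) :
    ChainComplex C ℕ :=
  Q.complex.augment (Q.augmentation ≫ S.f) (by
    rw [← Category.assoc, ProjectiveResolution.d_comp_augmentation, zero_comp])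

theorem spliceComplex_d_comp (S : ShortComplex C) (Q : ProjectiveResolution S.X₁) :
    (spliceComplex S Q).d 1 0 ≫ S.g = 0 := by
  change (Q.augmentation ≫ S.f) ≫ S.g = 0
  rw [Category.assoc, S.zero, comp_zero]

/-- Degree 1 is the splice point, where composing the augmentation with the monomorphism `S.f` does
not change kernels. In higher degrees the complex is `Q` shifted. -/
theorem spliceComplex_exactAt (S : ShortComplex C) (hS : S.ShortExact)
    (Q : ProjectiveResolution S.X₁) (n : ℕ) : (spliceComplex S Q).ExactAt (n + 1) := by
  have := hS.mono_f
  rw [HomologicalComplex.exactAt_iff' _ (n + 1 + 1) (n + 1) n (by simp) (by simp)]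
  cases n with
  | zero =>
    exact ShortComplex.exact_comp_mono S.f Q.exact_augmentation (by
      rw [← Category.assoc, ProjectiveResolution.d_comp_augmentation, zero_comp])
  | succ n => exact Q.exact_succ n

/-- A projective resolution of `X₁` and a short exact sequence `0 ⟶ X₁ ⟶ X₂ ⟶ X₃ ⟶ 0` with `X₂`
projective give a projective resolution of `X₃`. -/
noncomputable def spliceResolution (S : ShortComplex C) (hS : S.ShortExact) [Projective S.X₂]
    (Q : ProjectiveResolution S.X₁) : ProjectiveResolution S.X₃ where
  complex := spliceComplex S Q
  projective n := by
    cases n with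
    | zero => exact inferInstanceAs (Projective S.X₂)
    | succ n => exact Q.projective n
  π := (ChainComplex.toSingle₀Equiv _ _).symm ⟨S.g, spliceComplex_d_comp S Q⟩
  quasiIso := ⟨fun n => by
    cases n
    · have := hS.epi_g
      rw [ChainComplex.quasiIsoAt₀_iff, ShortComplex.quasiIso_iff_of_zeros']
      · refine (ShortComplex.exact_and_epi_g_iff_of_iso ?_).2
          ⟨ShortComplex.exact_epi_comp Q.augmentation hS.exact
            (by rw [Category.assoc, S.zero, comp_zero]), hS.epi_g⟩
        refine ShortComplex.isoMk (Iso.refl _) (Iso.refl _) (Iso.refl _) ?_ ?_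
        · exact (Category.id_comp _).trans (Category.comp_id _).symm
        · exact (Category.id_comp _).trans ((ChainComplex.toSingle₀Equiv_symm_apply_f_zero
            (C := spliceComplex S Q) (X := S.X₃) S.g (spliceComplex_d_comp S Q)).symm.trans (Category.comp_id _).symm)
      all_goals rfl
    · rw [quasiIsoAt_iff_exactAt']
      · exact spliceComplex_exactAt S hS Q _
      · apply ChainComplex.exactAt_succ_single_obj⟩

variable {D : Type w'} [Category.{v'} D] [Abelian D] [HasProjectiveResolutions C]
variable (F : C ⥤ D) [F.Additive]

theorem isZero_leftDerived_iff_exact {X : C} (P : ProjectiveResolution X) (n : ℕ) :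
    IsZero ((F.leftDerived (n + 1)).obj X) ↔
      (ShortComplex.mk (F.map (P.complex.d (n + 2) (n + 1))) (F.map (P.complex.d (n + 1) n))
        (by rw [← F.map_comp, P.complex.d_comp_d, F.map_zero])).Exact := by
  rw [(P.isoLeftDerivedObj F (n + 1)).isZero_iff]
  refine (HomologicalComplex.exactAt_iff_isZero_homology _ _).symm.trans ?_
  rw [HomologicalComplex.exactAt_iff' _ (n + 1 + 1) (n + 1) n (by simp) (by simp)]
  rfl

/-- Above the splice point the resolution of `S.X₃` is that of `S.X₁` shifted by one, so both sides
are the exactness of the same three-term complex. -/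
theorem isZero_leftDerived_succ_succ_iff {S : ShortComplex C} (hS : S.ShortExact)
    [Projective S.X₂] (n : ℕ) :
    IsZero ((F.leftDerived (n + 2)).obj S.X₃) ↔ IsZero ((F.leftDerived (n + 1)).obj S.X₁) := by
  let Q := projectiveResolution S.X₁
  rw [isZero_leftDerived_iff_exact F (spliceResolution S hS Q),
    isZero_leftDerived_iff_exact F Q]
  rfl

/-- Right exactness makes F X₁ the cokernel of the first differential of `F Q`. Exactness of the
spliced complex in degree 1 then says exactly that F X₁ → F X₂ has no kernel. -/
theorem isZero_leftDerived_one_iff {S : ShortComplex C} (hS : S.ShortExact)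
    [Projective S.X₂] (hF : ∀ {T : ShortComplex C}, T.Exact → Epi T.g →
      (T.map F).Exact ∧ Epi (F.map T.g)) :
    IsZero ((F.leftDerived 1).obj S.X₃) ↔ Mono (F.map S.f) := by
  let Q := projectiveResolution S.X₁
  obtain ⟨h₁, h₂⟩ := hF Q.exact_augmentation inferInstance
  have : Epi (F.map Q.augmentation) := h₂
  rw [isZero_leftDerived_iff_exact F (spliceResolution S hS Q)]
  have w : F.map (Q.complex.d 1 0) ≫ F.map Q.augmentation = 0 := by
    rw [← F.map_comp, Q.d_comp_augmentation, F.map_zero]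
  have w' : F.map (Q.complex.d 1 0) ≫ F.map Q.augmentation ≫ F.map S.f = 0 := by
    rw [← Category.assoc, w, zero_comp]
  have e : (ShortComplex.mk _ _ w').Exact ↔ Mono (F.map S.f) :=
    ⟨ShortComplex.mono_of_exact_comp _ w, fun _ => ShortComplex.exact_comp_mono _ h₁ w'⟩
  rw [← e]
  refine ShortComplex.exact_iff_of_iso
    (ShortComplex.isoMk (Iso.refl _) (Iso.refl _) (Iso.refl _) ?_ ?_)
  · exact (Category.id_comp _).trans (Category.comp_id _).symm
  · exact (Category.id_comp _).trans ((F.map_comp _ _).symm.trans (Category.comp_id _).symm)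

end Splice

/-! ### Vanishing of Tor -/

section Tor

variable (R : Type u) [CommRing R] (A : Type u) [Ring A]
variable (X : Type u) [AddCommGroup X] [Module R X] [Module Aᵐᵒᵖ X]

/-- `Tor_i^A(X, Y) = 0` for all `i > 0`. -/
def TorVanishes (Y : Type u) [AddCommGroup Y] [Module A Y] : Prop :=
  ∀ i : ℕ, 0 < i → Limits.IsZero (TorMod R A X i Y)

variable {R A X} {K P N : Type u} [AddCommGroup K] [Module A K] [AddCommGroup P] [Module A P]
  [AddCommGroup N] [Module A N]

theorem torVanishes_of_projective [Module.Projective A P] : TorVanishes R A X P := by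
  intro i hi
  obtain ⟨i, rfl⟩ := Nat.exists_eq_succ_of_ne_zero hi.ne'
  have : Projective (ModuleCat.of A P) := (IsProjective.iff_projective P).1 inferInstance
  exact (tensorFunctor R A X).isZero_leftDerived_obj_projective_succ i _

theorem TorVanishes.congr (e : K ≃ₗ[A] N) (h : TorVanishes R A X K) : TorVanishes R A X N :=
  fun i hi => (h i hi).of_iso (((tensorFunctor R A X).leftDerived i).mapIso e.toModuleIso).symm

theorem tensorFunctor_exact {T : ShortComplex (ModuleCat.{u} A)} (hT : T.Exact) (hg : Epi T.g) :
    (T.map (tensorFunctor R A X)).Exact ∧ Epi ((tensorFunctor R A X).map T.g) := by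
  have hg' := (ModuleCat.epi_iff_surjective _).1 hg
  refine ⟨?_, (ModuleCat.epi_iff_surjective _).2 (BalTensor.map_surjective hg')⟩
  rw [ShortComplex.ShortExact.moduleCat_exact_iff_function_exact] at hT ⊢
  exact BalTensor.map_exact hT hg'

theorem shortExact_of_exact {f : K →ₗ[A] P} {g : P →ₗ[A] N} (hf : Function.Injective f)
    (hg : Function.Surjective g) (hfg : Function.Exact f g) :
    (ShortComplex.mk (ModuleCat.ofHom f) (ModuleCat.ofHom g)
      (by rw [← ModuleCat.ofHom_comp, hfg.linearMap_comp_eq_zero]; rfl)).ShortExact :=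
  ModuleCat.shortComplex_shortExact _ hfg hf hg

/-- Tor_1 of `N` measures the failure of injectivity after tensoring, and Tor_{i+2} of `N` is
governed by Tor_{i+1} of `K`. Both directions are needed: forwards to pass to syzygies, backwards to
build vanishing up from a coresolution. -/
theorem torVanishes_iff [Module.Projective A P] {f : K →ₗ[A] P} {g : P →ₗ[A] N}
    (hf : Function.Injective f) (hg : Function.Surjective g) (hfg : Function.Exact f g) :
    TorVanishes R A X N ↔
      Function.Injective (BalTensor.map R A X f) ∧ TorVanishes R A X K := by
  have hS := shortExact_of_exact hf hg hfg
  have : Projective (ModuleCat.of A P) := (IsProjective.iff_projective P).1 inferInstance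
  have h₁ := isZero_leftDerived_one_iff (tensorFunctor R A X) hS tensorFunctor_exact
  rw [ModuleCat.mono_iff_injective] at h₁
  have h₂ := fun n => isZero_leftDerived_succ_succ_iff (tensorFunctor R A X) hS n
  constructor
  · intro h
    refine ⟨h₁.1 (h 1 one_pos), fun i hi => ?_⟩
    obtain ⟨i, rfl⟩ := Nat.exists_eq_succ_of_ne_zero hi.ne'
    exact (h₂ i).1 (h (i + 2) (by omega))
  · rintro ⟨h, h'⟩ i hi
    match i, hi with
    | 1, _ => exact h₁.2 h
    | i + 2, _ => exact (h₂ i).2 (h' (i + 1) (by omega))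

end Tor

/-! ### Vanishing of Ext along a short exact sequence -/

section Ext

variable {A : Type u} [Ring A] {K P N M : Type u} [AddCommGroup K] [Module A K] [AddCommGroup P]
  [Module A P] [AddCommGroup N] [Module A N] [AddCommGroup M] [Module A M]

variable (A) in
/-- `Ext_A^i(N, M) = 0`. -/
abbrev ExtVanishes (N M : Type u) [AddCommGroup N] [Module A N] [AddCommGroup M] [Module A M]
    (i : ℕ) : Prop :=
  Subsingleton (Abelian.Ext.{u} (ModuleCat.of A N) (ModuleCat.of A M) i)

theorem extVanishes_of_projective [Module.Projective A P] (i : ℕ) : ExtVanishes A P M (i + 1) := by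
  have : Projective (ModuleCat.of A P) := (IsProjective.iff_projective P).1 inferInstance
  exact subsingleton_of_forall_eq 0 fun x => x.eq_zero_of_projective

section

variable {f : K →ₗ[A] P} {g : P →ₗ[A] N} (hf : Function.Injective f)
    (hg : Function.Surjective g) (hfg : Function.Exact f g)

include hf hg hfg

/-- As Ext¹(P, M) = 0, every class in Ext¹(N, M) is the connecting image of some K → M. A map that
extends to `P` factors through `f`, and the extension class composed with `f` is zero. -/
theorem extVanishes_one_of_extends (hP : ExtVanishes A P M 1)
    (h : ∀ a : K →ₗ[A] M, ∃ b : P →ₗ[A] M, b ∘ₗ f = a) : ExtVanishes A N M 1 := by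
  have hS := shortExact_of_exact hf hg hfg
  refine subsingleton_of_forall_eq 0 fun x => ?_
  obtain ⟨y, rfl⟩ := Abelian.Ext.contravariant_sequence_exact₃ hS (ModuleCat.of A M) x
    (hP.elim _ _) (n₀ := 0) rfl
  obtain ⟨a, rfl⟩ := Abelian.Ext.homEquiv₀.symm.surjective y
  obtain ⟨b, hb⟩ := h a.hom
  have : a = ModuleCat.ofHom f ≫ ModuleCat.ofHom b := ModuleCat.hom_ext hb.symm
  rw [this, Abelian.Ext.homEquiv₀_symm_apply, ← Abelian.Ext.mk₀_comp_mk₀,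
    hS.extClass_comp_assoc]

theorem extVanishes_succ_of_left (i : ℕ) (hK : ExtVanishes A K M i)
    (hP : ExtVanishes A P M (i + 1)) : ExtVanishes A N M (i + 1) := by
  have hS := shortExact_of_exact hf hg hfg
  refine subsingleton_of_forall_eq 0 fun x => ?_
  obtain ⟨y, rfl⟩ := Abelian.Ext.contravariant_sequence_exact₃ hS (ModuleCat.of A M) x
    (hP.elim _ _) (n₀ := i) (add_comm _ _)
  rw [hK.elim y 0, Abelian.Ext.comp_zero]

theorem extends_of_extVanishes_one (hN : ExtVanishes A N M 1) (a : K →ₗ[A] M) :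
    ∃ b : P →ₗ[A] M, b ∘ₗ f = a := by
  have hS := shortExact_of_exact hf hg hfg
  obtain ⟨y, hy⟩ := Abelian.Ext.contravariant_sequence_exact₁ hS (ModuleCat.of A M)
    (Abelian.Ext.mk₀ (ModuleCat.ofHom a)) (n₁ := 1) rfl (hN.elim _ _)
  obtain ⟨b, rfl⟩ := Abelian.Ext.homEquiv₀.symm.surjective y
  rw [Abelian.Ext.homEquiv₀_symm_apply, Abelian.Ext.mk₀_comp_mk₀] at hy
  have := (Abelian.Ext.homEquiv₀ (C := ModuleCat A)).symm.injective hy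
  exact ⟨b.hom, congrArg ModuleCat.Hom.hom this⟩

theorem extVanishes_succ_of_right (i : ℕ) (hN : ExtVanishes A M N i)
    (hP : ExtVanishes A M P (i + 1)) : ExtVanishes A M K (i + 1) := by
  have hS := shortExact_of_exact hf hg hfg
  refine subsingleton_of_forall_eq 0 fun x => ?_
  obtain ⟨y, rfl⟩ := Abelian.Ext.covariant_sequence_exact₁ (ModuleCat.of A M) hS x
    (hP.elim _ _) rfl
  rw [hN.elim y 0, Abelian.Ext.zero_comp]

theorem extVanishes_right_of_succ (i : ℕ) (hK : ExtVanishes A M K (i + 1))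
    (hP : ExtVanishes A M P i) : ExtVanishes A M N i := by
  have hS := shortExact_of_exact hf hg hfg
  refine subsingleton_of_forall_eq 0 fun x => ?_
  obtain ⟨y, rfl⟩ := Abelian.Ext.covariant_sequence_exact₃ (ModuleCat.of A M) hS x
    rfl (hK.elim _ _)
  rw [hP.elim y 0, Abelian.Ext.zero_comp]

theorem lifts_of_extVanishes_one (hK : ExtVanishes A M K 1) (a : M →ₗ[A] N) :
    ∃ b : M →ₗ[A] P, g ∘ₗ b = a := by
  have hS := shortExact_of_exact hf hg hfg
  obtain ⟨y, hy⟩ := Abelian.Ext.covariant_sequence_exact₃ (ModuleCat.of A M) hS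
    (Abelian.Ext.mk₀ (ModuleCat.ofHom a)) (n₁ := 1) rfl (hK.elim _ _)
  obtain ⟨b, rfl⟩ := Abelian.Ext.homEquiv₀.symm.surjective y
  rw [Abelian.Ext.homEquiv₀_symm_apply, Abelian.Ext.mk₀_comp_mk₀] at hy
  have := (Abelian.Ext.homEquiv₀ (C := ModuleCat A)).symm.injective hy
  exact ⟨b.hom, congrArg ModuleCat.Hom.hom this⟩

end

end Ext

/-! ### Exact sequences split over the base ring -/

section Split

variable {R : Type u} [CommRing R] {A : Type u} [Ring A] [Algebra R A]
variable {K P N : Type u} [AddCommGroup K] [Module A K] [AddCommGroup P]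
  [Module A P] [AddCommGroup N] [Module A N]
  [Module R K] [Module R P] [Module R N]

theorem exists_retraction {f : K →ₗ[R] P} {g : P →ₗ[R] N} (hf : Function.Injective f)
    (hfg : Function.Exact f g) {s : N →ₗ[R] P} (hs : g ∘ₗ s = LinearMap.id) :
    ∃ r : P →ₗ[R] K, r ∘ₗ f = LinearMap.id := by
  have h : ∀ y, ∃ x, f x = y - s (g y) := fun y =>
    (hfg _).1 (by rw [map_sub, ← LinearMap.comp_apply g s, hs, LinearMap.id_apply, sub_self])
  choose r hr using h
  refine ⟨⟨⟨r, fun y z => hf ?_⟩, fun a y => hf ?_⟩, LinearMap.ext fun x => hf ?_⟩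
  · rw [map_add, hr, hr, hr, map_add, map_add]; abel
  · rw [map_smul, hr, hr]; simp [smul_sub]
  · change f (r (f x)) = f x
    rw [hr, hfg.apply_apply_eq_zero, map_zero, sub_zero]

theorem exists_section [Module.Projective R N] {g : P →ₗ[R] N} (hg : Function.Surjective g) :
    ∃ s : N →ₗ[R] P, g ∘ₗ s = LinearMap.id :=
  Module.projective_lifting_property g LinearMap.id hg

variable [IsScalarTower R A K] [IsScalarTower R A P] [IsScalarTower R A N]

theorem exists_section_of_projective [Module.Projective R N] {g : P →ₗ[A] N}
    (hg : Function.Surjective g) : ∃ s : N →ₗ[R] P, ∀ x, g (s x) = x := by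
  obtain ⟨s, hs⟩ := exists_section (R := R) (g := g.restrictScalars R) hg
  exact ⟨s, LinearMap.congr_fun hs⟩

theorem exists_retraction_of_projective [Module.Projective R N] {f : K →ₗ[A] P} {g : P →ₗ[A] N}
    (hf : Function.Injective f) (hg : Function.Surjective g) (hfg : Function.Exact f g) :
    ∃ r : P →ₗ[R] K, ∀ x, r (f x) = x := by
  obtain ⟨s, hs⟩ := exists_section (R := R) (g := g.restrictScalars R) hg
  obtain ⟨r, hr⟩ := exists_retraction (f := f.restrictScalars R) (g := g.restrictScalars R)
    hf hfg hs
  exact ⟨r, LinearMap.congr_fun hr⟩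

theorem projective_left_of_exact [Module.Projective R P] [Module.Projective R N]
    {f : K →ₗ[A] P} {g : P →ₗ[A] N}
    (hf : Function.Injective f) (hg : Function.Surjective g) (hfg : Function.Exact f g) :
    Module.Projective R K := by
  obtain ⟨r, hr⟩ := exists_retraction_of_projective (R := R) hf hg hfg
  exact Module.Projective.of_split (f.restrictScalars R) r (LinearMap.ext hr)

/-- The element y - f (r y) depends only on g y, so it defines an `R`-linear section of `g`. -/
theorem projective_right_of_retraction [Module.Projective R P] {f : K →ₗ[A] P} {g : P →ₗ[A] N}
    (hg : Function.Surjective g) (hfg : Function.Exact f g) {r : P →ₗ[R] K}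
    (hr : ∀ x, r (f x) = x) : Module.Projective R N := by
  have hs := Function.surjInv_eq hg
  set s := Function.surjInv hg
  have key : ∀ y z, g y = g z → y - f (r y) = z - f (r z) := by
    intro y z h
    obtain ⟨x, hx⟩ := (hfg (y - z)).1 (by rw [map_sub, h, sub_self])
    obtain rfl : y = z + f x := by rw [hx]; abel
    rw [map_add r, hr, map_add f]; abel
  let t : N →ₗ[R] P :=
    { toFun := fun n => s n - f (r (s n))
      map_add' := fun n n' => by
        rw [key (s (n + n')) (s n + s n') (by rw [map_add, hs, hs, hs]), map_add r, map_add f]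
        abel
      map_smul' := fun a n => by
        rw [key (s (a • n)) (a • s n) (by rw [LinearMap.map_smul_of_tower, hs, hs]), map_smul,
          LinearMap.map_smul_of_tower, RingHom.id_apply, smul_sub] }
  refine Module.Projective.of_split t (g.restrictScalars R) (LinearMap.ext fun n => ?_)
  change g (s n - f (r (s n))) = n
  rw [map_sub, hs, hfg.apply_apply_eq_zero, sub_zero]

theorem projective_fin_fun (n : ℕ) [Module.Projective R P] : Module.Projective R (Fin n → P) :=
  Module.Projective.of_equiv (DFinsupp.linearEquivFunOnFintype (R := R) (M := fun _ : Fin n => P))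

end Split

/-! ### Relative injectives and relative injective dimension -/

section RelInjective

variable (R : Type u) [CommRing R] (A : Type u) [Ring A] [Algebra R A]

/-- `E` is injective relative to the `R`-split monomorphisms of `A`-modules. -/
def RelInjective (E : Type u) [AddCommGroup E] [Module A E] : Prop :=
  ∀ (K P : Type u) [AddCommGroup K] [AddCommGroup P] [Module R K] [Module R P] [Module A K]
    [Module A P] [IsScalarTower R A K] [IsScalarTower R A P] (f : K →ₗ[A] P) (r : P →ₗ[R] K),
    (∀ x, r (f x) = x) → ∀ a : K →ₗ[A] E, ∃ b : P →ₗ[A] E, b ∘ₗ f = a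

variable {R A}

theorem RelInjective.of_retract {E E' : Type u} [AddCommGroup E] [Module A E] [AddCommGroup E']
    [Module A E'] (h : RelInjective R A E) (i : E' →ₗ[A] E) (p : E →ₗ[A] E')
    (hpi : p ∘ₗ i = LinearMap.id) : RelInjective R A E' := by
  intro K P _ _ _ _ _ _ _ _ f r hr a
  obtain ⟨b, hb⟩ := h K P f r hr (i ∘ₗ a)
  exact ⟨p ∘ₗ b, by rw [LinearMap.comp_assoc, hb, ← LinearMap.comp_assoc, hpi, LinearMap.id_comp]⟩

theorem RelInjective.pi {E : Type u} [AddCommGroup E] [Module A E] (h : RelInjective R A E)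
    (k : ℕ) : RelInjective R A (Fin k → E) := by
  intro K P _ _ _ _ _ _ _ _ f r hr a
  choose b hb using fun l => h K P f r hr (LinearMap.proj l ∘ₗ a)
  exact ⟨LinearMap.pi b, LinearMap.ext fun x => funext fun l => LinearMap.congr_fun (hb l) x⟩

/-- DA is coinduced from `R`: an `A`-map into it is determined by its value at 1, as a functional.
Composing that functional with the `R`-retraction `r` therefore extends the `A`-map. -/
theorem relInjective_stdDual : RelInjective R A (StdDual R A) := by
  intro K P _ _ _ _ _ _ _ _ f r hr a
  have ha : ∀ (c : A) (x : K) (y : A), a (c • x) y = a x (y * c) := fun c x y => by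
    rw [map_smul]; rfl
  let b : P → StdDual R A := fun y =>
    show A →ₗ[R] R from
    { toFun := fun c => a (r (c • y)) 1
      map_add' := fun c d => by rw [add_smul, map_add, map_add]; rfl
      map_smul' := fun t c => by
        rw [smul_assoc, map_smul, LinearMap.map_smul_of_tower]; rfl }
  have hb : ∀ y c, b y c = a (r (c • y)) 1 := fun _ _ => rfl
  refine ⟨⟨⟨b, fun y z => LinearMap.ext fun c => ?_⟩, fun d y => LinearMap.ext fun c => ?_⟩,
    LinearMap.ext fun x => LinearMap.ext fun c => ?_⟩
  · change b _ c = b y c + b z c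
    rw [hb, smul_add, map_add, map_add]; rfl
  · change b _ c = b y (c * d)
    rw [hb, hb, mul_smul]
  · change b (f x) c = a x c
    rw [hb, ← map_smul, hr, ha, one_mul]

variable [IsNoetherianRing R]

/-- A free cover of an `R`-projective `N` is `R`-split, so relative injectivity extends maps from
the syzygy and kills Ext¹. The syzygy is again finitely generated and `R`-projective, which allows
dimension shifting. -/
theorem extVanishes_of_relInjective (hA : IsFGProj R A) {E : Type u} [AddCommGroup E] [Module A E]
    (hE : RelInjective R A E) (i : ℕ) :
    ∀ (N : Type u) [AddCommGroup N] [Module R N] [Module A N] [IsScalarTower R A N],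
      Module.Finite A N → Module.Projective R N → ExtVanishes A N E (i + 1) := by
  have := hA.1
  have := hA.2
  have : IsNoetherianRing A := IsNoetherianRing.of_finite R A
  induction i with
  | zero =>
    intro N _ _ _ _ _ _
    obtain ⟨n, g, hg⟩ := Module.Finite.exists_fin' A N
    have hfg := LinearMap.exact_subtype_ker_map g
    have hf := Submodule.injective_subtype (LinearMap.ker g)
    obtain ⟨r, hr⟩ := exists_retraction_of_projective (R := R) hf hg hfg
    exact extVanishes_one_of_extends hf hg hfg (extVanishes_of_projective 0) (hE _ _ _ r hr)
  | succ i ih =>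
    intro N _ _ _ _ _ _
    obtain ⟨n, g, hg⟩ := Module.Finite.exists_fin' A N
    have hfg := LinearMap.exact_subtype_ker_map g
    have hf := Submodule.injective_subtype (LinearMap.ker g)
    have := projective_fin_fun (R := R) (P := A) n
    have := projective_left_of_exact (R := R) hf hg hfg
    exact extVanishes_succ_of_left hf hg hfg _ (ih _ inferInstance this)
      (extVanishes_of_projective _)

variable {I E J : Type u} [AddCommGroup I] [AddCommGroup E] [AddCommGroup J] [Module A I]
  [Module A E] [Module A J] {f : I →ₗ[A] E} {g : E →ₗ[A] J}

theorem RelIDimLE.succ (hA : IsFGProj R A) (hE : RelInjective R A E) (hf : Function.Injective f)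
    (hg : Function.Surjective g) (hfg : Function.Exact f g) {k : ℕ} (h : RelIDimLE R A J k) :
    RelIDimLE R A I (k + 1) := by
  intro N _ _ _ _ h₁ h₂
  exact extVanishes_succ_of_right hf hg hfg _ (h N h₁ h₂)
    (extVanishes_of_relInjective hA hE _ N h₁ h₂)

theorem RelIDimLE.of_succ (hA : IsFGProj R A) (hE : RelInjective R A E) (hf : Function.Injective f)
    (hg : Function.Surjective g) (hfg : Function.Exact f g) {k : ℕ}
    (h : RelIDimLE R A I (k + 1)) : RelIDimLE R A J k := by
  intro N _ _ _ _ h₁ h₂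
  exact extVanishes_right_of_succ hf hg hfg _ (h N h₁ h₂)
    (extVanishes_of_relInjective hA hE _ N h₁ h₂)

theorem RelInjective.relIDimLE (hA : IsFGProj R A) (hE : RelInjective R A E) (k : ℕ) :
    RelIDimLE R A E k :=
  fun N _ _ _ _ h₁ h₂ => extVanishes_of_relInjective hA hE k N h₁ h₂

end RelInjective

/-! ### Resolutions in add M as iterated short exact sequences -/

section AddResolutions

variable (S : Type u) [Ring S] (M : Type u) [AddCommGroup M] [Module S M]

/-- There is an exact sequence `0 → X → M_0 → ⋯ → M_k → 0` with all `M_i` in `add M` that remains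
exact under `Hom_S(-, M)`. -/
def AddCores : ℕ → ModuleCat.{u} S → Prop
  | 0, X => InAdd S M X
  | k + 1, X => ∃ (M₀ Y : ModuleCat.{u} S) (f : X →ₗ[S] M₀) (g : M₀ →ₗ[S] Y),
      InAdd S M M₀ ∧ Function.Injective f ∧ Function.Surjective g ∧ Function.Exact f g ∧
      (∀ a : X →ₗ[S] M, ∃ b : M₀ →ₗ[S] M, b ∘ₗ f = a) ∧ AddCores k Y

/-- There is an exact sequence `0 → M_k → ⋯ → M_0 → X → 0` with all `M_i` in `add M` that remains
exact under `Hom_S(M, -)`. -/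
def AddRes : ℕ → ModuleCat.{u} S → Prop
  | 0, X => InAdd S M X
  | k + 1, X => ∃ (Y M₀ : ModuleCat.{u} S) (f : Y →ₗ[S] M₀) (g : M₀ →ₗ[S] X),
      InAdd S M M₀ ∧ Function.Injective f ∧ Function.Surjective g ∧ Function.Exact f g ∧
      (∀ a : M →ₗ[S] X, ∃ b : M →ₗ[S] M₀, g ∘ₗ b = a) ∧ AddRes k Y

variable {S M}

theorem InAdd.congr {X X' : Type u} [AddCommGroup X] [Module S X] [AddCommGroup X'] [Module S X']
    (e : X ≃ₗ[S] X') (h : InAdd S M X) : InAdd S M X' := by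
  obtain ⟨k, i, p, hpi⟩ := h
  refine ⟨k, i ∘ₗ e.symm, e ∘ₗ p, LinearMap.ext fun x => ?_⟩
  have := LinearMap.congr_fun hpi (e.symm x)
  simp only [LinearMap.comp_apply, LinearMap.id_apply, LinearEquiv.coe_coe] at this ⊢
  rw [this, e.apply_symm_apply]

theorem InAdd.self : InAdd S M M :=
  ⟨1, LinearMap.pi fun _ => LinearMap.id, LinearMap.proj 0, rfl⟩

theorem InAdd.pi (k : ℕ) : InAdd S M (Fin k → M) :=
  ⟨k, LinearMap.id, LinearMap.id, rfl⟩

/-- Componentwise form of membership in `add M`. -/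
theorem InAdd.exists_components {X : Type u} [AddCommGroup X] [Module S X] (h : InAdd S M X) :
    ∃ (k : ℕ) (i : Fin k → X →ₗ[S] M) (p : Fin k → M →ₗ[S] X), ∀ x, ∑ l, p l (i l x) = x := by
  classical
  obtain ⟨k, i, p, hpi⟩ := h
  refine ⟨k, fun l => LinearMap.proj l ∘ₗ i, fun l => p ∘ₗ LinearMap.single S (fun _ => M) l,
    fun x => ?_⟩
  have := LinearMap.congr_fun hpi x
  rw [LinearMap.comp_apply, LinearMap.id_apply] at this
  conv_rhs => rw [← this, ← LinearMap.sum_single_apply (fun _ => M) (i x), map_sum]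
  rfl

theorem InAdd.of_components {X : Type u} [AddCommGroup X] [Module S X] {k : ℕ}
    (i : Fin k → X →ₗ[S] M) (p : Fin k → M →ₗ[S] X) (h : ∀ x, ∑ l, p l (i l x) = x) :
    InAdd S M X :=
  ⟨k, LinearMap.pi i, ∑ l, p l ∘ₗ LinearMap.proj l, LinearMap.ext fun x => by
    simpa [LinearMap.sum_apply] using h x⟩

theorem AddCores.congr {k : ℕ} {X X' : ModuleCat.{u} S} (e : X ≃ₗ[S] X') (h : AddCores S M k X) :
    AddCores S M k X' := by
  cases k with
  | zero => exact InAdd.congr e h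
  | succ k =>
    obtain ⟨M₀, Y, f, g, hM, hf, hg, hfg, hh, hY⟩ := h
    refine ⟨M₀, Y, f ∘ₗ e.symm, g, hM, hf.comp e.symm.injective, hg, fun y => ?_, fun a => ?_, hY⟩
    · rw [hfg y]
      exact e.symm.surjective.range_comp f ▸ Iff.rfl
    · obtain ⟨b, hb⟩ := hh (a ∘ₗ e)
      refine ⟨b, LinearMap.ext fun x => ?_⟩
      have := LinearMap.congr_fun hb (e.symm x)
      simpa using this

theorem AddRes.congr {k : ℕ} {X X' : ModuleCat.{u} S} (e : X ≃ₗ[S] X') (h : AddRes S M k X) :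
    AddRes S M k X' := by
  cases k with
  | zero => exact InAdd.congr e h
  | succ k =>
    obtain ⟨Y, M₀, f, g, hM, hf, hg, hfg, hh, hY⟩ := h
    refine ⟨Y, M₀, f, e ∘ₗ g, hM, hf, e.surjective.comp hg, fun y => ?_, fun a => ?_, hY⟩
    · rw [← hfg y]
      exact e.map_eq_zero_iff
    · obtain ⟨b, hb⟩ := hh (e.symm ∘ₗ a)
      refine ⟨b, LinearMap.ext fun x => ?_⟩
      have := LinearMap.congr_fun hb x
      simp only [LinearMap.comp_apply, LinearEquiv.coe_coe] at this ⊢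
      rw [this, e.apply_symm_apply]

theorem exists_factor_of_exact {K P N Q : Type u} [AddCommGroup K] [Module S K] [AddCommGroup P]
    [Module S P] [AddCommGroup N] [Module S N] [AddCommGroup Q] [Module S Q] {f : K →ₗ[S] P}
    {g : P →ₗ[S] N} (hg : Function.Surjective g) (hfg : Function.Exact f g) (a : P →ₗ[S] Q)
    (ha : ∀ x, a (f x) = 0) : ∃ b : N →ₗ[S] Q, b ∘ₗ g = a := by
  have hker : LinearMap.ker g ≤ LinearMap.ker a := fun y hy => by
    obtain ⟨x, rfl⟩ := (hfg y).1 hy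
    exact ha x
  refine ⟨(LinearMap.ker g).liftQ a hker ∘ₗ
    (g.quotKerEquivOfSurjective hg).symm.toLinearMap, LinearMap.ext fun x => ?_⟩
  have : (g.quotKerEquivOfSurjective hg).symm (g x) = (LinearMap.ker g).mkQ x := by
    rw [LinearEquiv.symm_apply_eq]; rfl
  change (LinearMap.ker g).liftQ a hker ((g.quotKerEquivOfSurjective hg).symm (g x)) = _
  rw [this]; rfl

theorem exists_corestrict_of_exact {K P N Q : Type u} [AddCommGroup K] [Module S K]
    [AddCommGroup P] [Module S P] [AddCommGroup N] [Module S N] [AddCommGroup Q] [Module S Q]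
    {f : K →ₗ[S] P} {g : P →ₗ[S] N} (hf : Function.Injective f) (hfg : Function.Exact f g)
    (a : Q →ₗ[S] P) (ha : ∀ x, g (a x) = 0) : ∃ b : Q →ₗ[S] K, f ∘ₗ b = a :=
  ⟨(LinearEquiv.ofInjective f hf).symm.toLinearMap ∘ₗ
      a.codRestrict (LinearMap.range f) fun x => (hfg _).1 (ha x),
    LinearMap.ext fun x => congrArg Subtype.val ((LinearEquiv.ofInjective f hf).apply_symm_apply
      (a.codRestrict (LinearMap.range f) (fun x => (hfg _).1 (ha x)) x))⟩

theorem exact_subtype_rangeRestrict {C₀ C₁ C₂ : Type u} [AddCommGroup C₀] [Module S C₀]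
    [AddCommGroup C₁] [Module S C₁] [AddCommGroup C₂] [Module S C₂] {d : C₀ →ₗ[S] C₁}
    {d' : C₁ →ₗ[S] C₂} (h : Function.Exact d d') :
    Function.Exact (LinearMap.range d).subtype d'.rangeRestrict := fun y => by
  rw [Subtype.ext_iff]
  exact (h y).trans ⟨fun hy => ⟨⟨y, hy⟩, rfl⟩, by rintro ⟨y, rfl⟩; exact y.2⟩

section OfSequence

variable {C : ℕ → Type u} [∀ i, AddCommGroup (C i)] [∀ i, Module S (C i)]

/-- The long sequence is cut at the images of its differentials. The extension hypothesis is phrased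
for maps vanishing on the kernel of `d i`, which covers the injective `d 0` and the inner
differentials uniformly. The zero term C (k + 2) makes the last differential onto. -/
theorem addCores_range {d : ∀ i, C i →ₗ[S] C (i + 1)} {k : ℕ}
    (hadd : ∀ i ≤ k, InAdd S M (C (i + 1))) (hzero : Subsingleton (C (k + 2)))
    (hex : ∀ i ≤ k, Function.Exact (d i) (d (i + 1)))
    (hhom : ∀ i ≤ k, ∀ a : C i →ₗ[S] M, (∀ x, d i x = 0 → a x = 0) →
      ∃ b : C (i + 1) →ₗ[S] M, b ∘ₗ d i = a) :
    ∀ j i, i + j = k → AddCores S M j (ModuleCat.of S (LinearMap.range (d i))) := by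
  intro j
  induction j with
  | zero =>
    rintro i rfl
    have : LinearMap.range (d i) = ⊤ :=
      eq_top_iff.2 fun y _ => (hex i le_rfl y).1 (Subsingleton.elim _ _)
    exact InAdd.congr (LinearEquiv.ofTop _ this).symm (hadd i le_rfl)
  | succ j ih =>
    intro i hi
    refine ⟨ModuleCat.of S (C (i + 1)), ModuleCat.of S (LinearMap.range (d (i + 1))),
      (LinearMap.range (d i)).subtype, (d (i + 1)).rangeRestrict, hadd i (by omega),
      Submodule.injective_subtype _, LinearMap.surjective_rangeRestrict _,
      exact_subtype_rangeRestrict (hex i (by omega)), fun a => ?_, ih (i + 1) (by omega)⟩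
    obtain ⟨b, hb⟩ := hhom i (by omega) (a ∘ₗ (d i).rangeRestrict) fun x hx => by
      have : (d i).rangeRestrict x = 0 := Subtype.ext hx
      rw [LinearMap.comp_apply, this, map_zero]
    refine ⟨b, LinearMap.ext ?_⟩
    rintro ⟨_, x, rfl⟩
    exact LinearMap.congr_fun hb x

/-- The same cutting in homological numbering; here the zero term makes the last differential
injective. -/
theorem addRes_range {d : ∀ i, C (i + 1) →ₗ[S] C i} {k : ℕ}
    (hadd : ∀ i ≤ k, InAdd S M (C (i + 1))) (hzero : Subsingleton (C (k + 2)))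
    (hex : ∀ i ≤ k, Function.Exact (d (i + 1)) (d i))
    (hhom : ∀ i ≤ k, ∀ a : M →ₗ[S] C i, (∀ x, ∃ y, d i y = a x) →
      ∃ b : M →ₗ[S] C (i + 1), d i ∘ₗ b = a) :
    ∀ j i, i + j = k → AddRes S M j (ModuleCat.of S (LinearMap.range (d i))) := by
  intro j
  induction j with
  | zero =>
    rintro i rfl
    have hinj : Function.Injective (d i) := (injective_iff_map_eq_zero _).2 fun x hx => by
      obtain ⟨y, rfl⟩ := (hex i le_rfl x).1 hx
      rw [hzero.elim y 0, map_zero]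
    exact InAdd.congr (LinearEquiv.ofInjective _ hinj) (hadd i le_rfl)
  | succ j ih =>
    intro i hi
    refine ⟨ModuleCat.of S (LinearMap.range (d (i + 1))), ModuleCat.of S (C (i + 1)),
      (LinearMap.range (d (i + 1))).subtype, (d i).rangeRestrict, hadd i (by omega),
      Submodule.injective_subtype _, LinearMap.surjective_rangeRestrict _,
      exact_subtype_rangeRestrict (hex i (by omega)), fun a => ?_, ih (i + 1) (by omega)⟩
    obtain ⟨b, hb⟩ := hhom i (by omega) ((LinearMap.range (d i)).subtype ∘ₗ a) fun x => (a x).2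
    exact ⟨b, LinearMap.ext fun x => Subtype.ext (LinearMap.congr_fun hb x)⟩

end OfSequence

end AddResolutions

/-! ### From iterated short exact sequences to long ones -/

section ToSequence

variable (R : Type u) [CommRing R] {S : Type u} [Ring S] [Algebra R S]

/-- The `R`-module structure on a module over an `R`-algebra. -/
abbrev restrictModule (S : Type u) [Ring S] [Algebra R S] (X : Type u) [AddCommGroup X]
    [Module S X] : Module R X :=
  Module.compHom X (algebraMap R S)

theorem restrictModule_tower (X : Type u) [AddCommGroup X] [Module S X] :
    let _ := restrictModule R S X
    IsScalarTower R S X :=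
  letI := restrictModule R S X
  ⟨fun r s x => by rw [Algebra.smul_def, mul_smul]; rfl⟩

/-- The linear map `f` of modules over an `R`-algebra is split by an `R`-linear map. -/
def IsSplitOver {X Y : Type u} [AddCommGroup X] [Module S X] [AddCommGroup Y] [Module S Y]
    (f : X →ₗ[S] Y) : Prop :=
  ∃ s : Y →+ X, (∀ (r : R) (y : Y), s (algebraMap R S r • y) = algebraMap R S r • s y) ∧
    ∀ x, f (s (f x)) = f x

variable {R} {X Y : Type u} [AddCommGroup X] [Module S X] [AddCommGroup Y] [Module S Y]
  {f : X →ₗ[S] Y}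

theorem isSplitOver_zero : IsSplitOver R (0 : X →ₗ[S] Y) :=
  ⟨0, fun _ _ => (smul_zero _).symm, fun _ => rfl⟩

theorem isSplitOver_of_linear [Module R X] [Module R Y] [IsScalarTower R S X]
    [IsScalarTower R S Y] (s : Y →ₗ[R] X) (hs : ∀ x, f (s (f x)) = f x) : IsSplitOver R f :=
  ⟨s.toAddMonoidHom, fun r y => by
    rw [algebraMap_smul, algebraMap_smul]; exact map_smul s r y, hs⟩

theorem IsSplitOver.exists_linear [Module R X] [Module R Y] [IsScalarTower R S X]
    [IsScalarTower R S Y] (h : IsSplitOver R f) : ∃ s : Y →ₗ[R] X, ∀ x, f (s (f x)) = f x := by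
  obtain ⟨s, hs, hf⟩ := h
  refine ⟨{ s with map_smul' := fun r y => ?_ }, hf⟩
  have := hs r y
  rw [algebraMap_smul, algebraMap_smul] at this
  exact this

/-- Prepend two terms to a sequence of modules without its first term. -/
def consObj (X M₀ : ModuleCat.{u} S) (C : ℕ → ModuleCat.{u} S) : ℕ → ModuleCat.{u} S
  | 0 => X
  | 1 => M₀
  | i + 2 => C (i + 1)

/-- The differentials of `consObj`, in cohomological numbering. -/
def consMap {X M₀ : ModuleCat.{u} S} {C : ℕ → ModuleCat.{u} S} (f : X →ₗ[S] M₀)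
    (g : M₀ →ₗ[S] C 1) (d : ∀ i, C i →ₗ[S] C (i + 1)) :
    ∀ i, consObj X M₀ C i →ₗ[S] consObj X M₀ C (i + 1)
  | 0 => f
  | 1 => g
  | i + 2 => d (i + 1)

/-- The differentials of `consObj`, in homological numbering. -/
def consMap' {X M₀ : ModuleCat.{u} S} {C : ℕ → ModuleCat.{u} S} (f : M₀ →ₗ[S] X)
    (g : C 1 →ₗ[S] M₀) (d : ∀ i, C (i + 1) →ₗ[S] C i) :
    ∀ i, consObj X M₀ C (i + 1) →ₗ[S] consObj X M₀ C i
  | 0 => f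
  | 1 => g
  | i + 2 => d (i + 1)

variable {M : Type u} [AddCommGroup M] [Module S M] [Module R M] [IsScalarTower R S M]

theorem InAdd.projective {X : Type u} [AddCommGroup X] [Module S X] [Module R X]
    [IsScalarTower R S X] [Module.Projective R M] (h : InAdd S M X) : Module.Projective R X := by
  obtain ⟨k, i, p, hpi⟩ := h
  have := projective_fin_fun (R := R) (P := M) k
  exact Module.Projective.of_split (i.restrictScalars R) (p.restrictScalars R)
    (LinearMap.ext fun x => LinearMap.congr_fun hpi x)

/-- Projectivity propagates from the right end: once `Y` is `R`-projective the short sequence splits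
over `R`, and `X` is a summand of `M₀`. -/
theorem AddCores.projective [Module.Projective R M] {k : ℕ} : ∀ {X : ModuleCat.{u} S} [Module R X]
    [IsScalarTower R S X], AddCores S M k X → Module.Projective R X := by
  induction k with
  | zero => intro X _ _ h; exact InAdd.projective h
  | succ k ih =>
    rintro X _ _ ⟨M₀, Y, f, g, hM, hf, hg, hfg, -, hY⟩
    let _ := restrictModule R S M₀
    have := restrictModule_tower R (S := S) M₀
    let _ := restrictModule R S Y
    have := restrictModule_tower R (S := S) Y
    have := ih hY
    have := InAdd.projective (R := R) hM
    exact projective_left_of_exact (R := R) hf hg hfg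

/-- `AddCores` does not record any `R`-splitting; it is automatic, since every cosyzygy is
`R`-projective by `AddCores.projective`. -/
theorem AddCores.exists_sequence [Module.Projective R M] {k : ℕ} :
    ∀ {X : ModuleCat.{u} S}, AddCores S M k X →
    ∃ (C : ℕ → ModuleCat.{u} S) (d : ∀ i, C i →ₗ[S] C (i + 1)),
      Nonempty (X ≃ₗ[S] C 0) ∧ (∀ i ≤ k, InAdd S M (C (i + 1))) ∧ Subsingleton (C (k + 2)) ∧
      Function.Injective (d 0) ∧ (∀ i ≤ k, Function.Exact (d i) (d (i + 1))) ∧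
      (∀ i, IsSplitOver R (d i)) ∧ (∀ a : C 0 →ₗ[S] M, ∃ b, b ∘ₗ d 0 = a) ∧
      ∀ i ≤ k, ∀ a : C (i + 1) →ₗ[S] M, a ∘ₗ d i = 0 → ∃ b, b ∘ₗ d (i + 1) = a := by
  induction k with
  | zero =>
    intro X h
    -- Length zero: the identity of `X`, followed by zero modules.
    refine ⟨consObj X X fun _ => ModuleCat.of S PUnit.{u + 1},
      consMap LinearMap.id 0 fun _ => 0, ⟨LinearEquiv.refl S X⟩, fun i hi => ?_,
      inferInstanceAs (Subsingleton PUnit), fun _ _ h => h, fun i hi => ?_, fun i => ?_,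
      fun a => ⟨a, rfl⟩, fun i hi a ha => ?_⟩
    · obtain rfl : i = 0 := by omega
      exact h
    · obtain rfl : i = 0 := by omega
      exact fun y => ⟨fun _ => ⟨y, rfl⟩, fun _ => rfl⟩
    · match i with
      | 0 => exact ⟨AddMonoidHom.id _, fun _ _ => rfl, fun _ => rfl⟩
      | 1 => exact isSplitOver_zero
      | i + 2 => exact isSplitOver_zero
    · obtain rfl : i = 0 := by omega
      exact ⟨0, ha.symm⟩
  | succ k ih =>
    rintro X ⟨M₀, Y, f, g, hM, hf, hg, hfg, hh, hY⟩
    obtain ⟨C, d, ⟨e⟩, h₁, h₂, h₃, h₄, h₅, h₆, h₇⟩ := ih hY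
    let _ := restrictModule R S X
    have := restrictModule_tower R (S := S) X
    let _ := restrictModule R S M₀
    have := restrictModule_tower R (S := S) M₀
    let _ := restrictModule R S Y
    have := restrictModule_tower R (S := S) Y
    have := hY.projective (R := R)
    -- The term C 0 ≅ Y is dropped and `M₀` is joined to C 1 by d 0 ∘ e ∘ g. This map has the kernel
    -- of `g` and the range of `d 0`.
    have hinj : Function.Injective (d 0 ∘ₗ e.toLinearMap) := h₃.comp e.injective
    have hsurj : Function.Surjective (e.toLinearMap ∘ₗ g) := e.surjective.comp hg
    have hex₀ : Function.Exact f (d 0 ∘ₗ e.toLinearMap ∘ₗ g) := fun y =>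
      (map_eq_zero_iff (d 0 ∘ₗ e.toLinearMap) hinj).trans (hfg y)
    have hex₁ : Function.Exact (d 0 ∘ₗ e.toLinearMap ∘ₗ g) (d 1) := fun y => by
      refine (h₄ 0 (by omega) y).trans ⟨?_, ?_⟩
      · rintro ⟨x, rfl⟩
        obtain ⟨z, rfl⟩ := hsurj x
        exact ⟨z, rfl⟩
      · rintro ⟨x, rfl⟩
        exact ⟨e (g x), rfl⟩
    have hsplit₀ : IsSplitOver R f := by
      obtain ⟨r, hr⟩ := exists_retraction_of_projective (R := R) hf hg hfg
      exact isSplitOver_of_linear r fun x => congrArg f (hr x)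
    have hsplit₁ : IsSplitOver R (d 0 ∘ₗ e.toLinearMap ∘ₗ g) := by
      obtain ⟨s, hs⟩ := exists_section_of_projective (R := R) hg
      obtain ⟨t, ht, ht'⟩ := h₅ 0
      refine ⟨s.toAddMonoidHom.comp (e.symm.toLinearMap.toAddMonoidHom.comp t),
        fun r y => ?_, fun x => ?_⟩
      · change s (e.symm (t (algebraMap R S r • y))) = algebraMap R S r • s (e.symm (t y))
        rw [ht, map_smul, algebraMap_smul, algebraMap_smul, map_smul]
      · change d 0 (e (g (s (e.symm (t (d 0 (e (g x)))))))) = d 0 (e (g x))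
        rw [hs, e.apply_symm_apply, ht']
    have hhom₀ : ∀ a : M₀ →ₗ[S] M, a ∘ₗ f = 0 →
        ∃ b, b ∘ₗ d 0 ∘ₗ e.toLinearMap ∘ₗ g = a := by
      intro a ha
      replace ha : ∀ x, a (f x) = 0 := LinearMap.congr_fun ha
      obtain ⟨q, hq⟩ := exists_factor_of_exact hg hfg a ha
      obtain ⟨b, hb⟩ := h₆ (q ∘ₗ e.symm.toLinearMap)
      refine ⟨b, LinearMap.ext fun x => ?_⟩
      have := LinearMap.congr_fun hb (e (g x))
      simp only [LinearMap.comp_apply, LinearEquiv.coe_coe, e.symm_apply_apply] at this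
      exact this.trans (LinearMap.congr_fun hq x)
    have hhom₁ : ∀ a : C 1 →ₗ[S] M, a ∘ₗ d 0 ∘ₗ e.toLinearMap ∘ₗ g = 0 →
        ∃ b, b ∘ₗ d 1 = a := by
      refine fun a ha => h₇ 0 (by omega) a (LinearMap.ext fun x => ?_)
      obtain ⟨z, rfl⟩ := hsurj x
      exact LinearMap.congr_fun ha z
    refine ⟨consObj X M₀ C, consMap f (d 0 ∘ₗ e.toLinearMap ∘ₗ g) d, ⟨LinearEquiv.refl S X⟩,
      fun i hi => ?_, h₂, hf, fun i hi => ?_, fun i => ?_, hh, fun i hi => ?_⟩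
    · match i with
      | 0 => exact hM
      | i + 1 => exact h₁ i (by omega)
    · match i with
      | 0 => exact hex₀
      | 1 => exact hex₁
      | i + 2 => exact h₄ (i + 1) (by omega)
    · match i with
      | 0 => exact hsplit₀
      | 1 => exact hsplit₁
      | i + 2 => exact h₅ (i + 1)
    · match i with
      | 0 => exact hhom₀
      | 1 => exact hhom₁
      | i + 2 => exact h₇ (i + 1) (by omega)

/-- Here `R`-projectivity of `X` has to be assumed: syzygies inherit it from the term on their
right, so it travels from `X` into the resolution. -/
theorem AddRes.exists_sequence [Module.Projective R M] {k : ℕ} :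
    ∀ {X : ModuleCat.{u} S} [Module R X] [IsScalarTower R S X] [Module.Projective R X],
    AddRes S M k X →
    ∃ (C : ℕ → ModuleCat.{u} S) (d : ∀ i, C (i + 1) →ₗ[S] C i),
      Nonempty (X ≃ₗ[S] C 0) ∧ (∀ i ≤ k, InAdd S M (C (i + 1))) ∧ Subsingleton (C (k + 2)) ∧
      Function.Surjective (d 0) ∧ (∀ i ≤ k, Function.Exact (d (i + 1)) (d i)) ∧
      (∀ i, IsSplitOver R (d i)) ∧ (∀ a : M →ₗ[S] C 0, ∃ b, d 0 ∘ₗ b = a) ∧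
      ∀ i ≤ k, ∀ a : M →ₗ[S] C (i + 1), d i ∘ₗ a = 0 → ∃ b, d (i + 1) ∘ₗ b = a := by
  induction k with
  | zero =>
    intro X _ _ _ h
    refine ⟨consObj X X fun _ => ModuleCat.of S PUnit.{u + 1},
      consMap' LinearMap.id 0 fun _ => 0, ⟨LinearEquiv.refl S X⟩, fun i hi => ?_,
      inferInstanceAs (Subsingleton PUnit), fun y => ⟨y, rfl⟩, fun i hi => ?_, fun i => ?_,
      fun a => ⟨a, rfl⟩, fun i hi a ha => ?_⟩
    · obtain rfl : i = 0 := by omega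
      exact h
    · obtain rfl : i = 0 := by omega
      exact fun y => ⟨fun h => ⟨0, h.symm⟩, by rintro ⟨_, rfl⟩; rfl⟩
    · match i with
      | 0 => exact ⟨AddMonoidHom.id _, fun _ _ => rfl, fun _ => rfl⟩
      | 1 => exact isSplitOver_zero
      | i + 2 => exact isSplitOver_zero
    · obtain rfl : i = 0 := by omega
      exact ⟨0, ha.symm⟩
  | succ k ih =>
    rintro X _ _ _ ⟨Y, M₀, f, g, hM, hf, hg, hfg, hh, hY⟩
    let _ := restrictModule R S M₀
    have := restrictModule_tower R (S := S) M₀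
    let _ := restrictModule R S Y
    have := restrictModule_tower R (S := S) Y
    have := hM.projective (R := R)
    have := projective_left_of_exact (R := R) hf hg hfg
    obtain ⟨C, d, ⟨e⟩, h₁, h₂, h₃, h₄, h₅, h₆, h₇⟩ := ih hY
    have hsurj : Function.Surjective (e.symm.toLinearMap ∘ₗ d 0) := e.symm.surjective.comp h₃
    have hex₀ : Function.Exact (f ∘ₗ e.symm.toLinearMap ∘ₗ d 0) g := fun y => by
      refine (hfg y).trans ⟨?_, ?_⟩
      · rintro ⟨x, rfl⟩
        obtain ⟨z, rfl⟩ := hsurj x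
        exact ⟨z, rfl⟩
      · rintro ⟨x, rfl⟩
        exact ⟨e.symm (d 0 x), rfl⟩
    have hex₁ : Function.Exact (d 1) (f ∘ₗ e.symm.toLinearMap ∘ₗ d 0) := fun y =>
      Iff.trans ((map_eq_zero_iff f hf).trans e.symm.map_eq_zero_iff) (h₄ 0 (by omega) y)
    have hsplit₀ : IsSplitOver R g := by
      obtain ⟨s, hs⟩ := exists_section_of_projective (R := R) hg
      exact isSplitOver_of_linear s fun x => hs (g x)
    have hsplit₁ : IsSplitOver R (f ∘ₗ e.symm.toLinearMap ∘ₗ d 0) := by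
      obtain ⟨r, hr⟩ := exists_retraction_of_projective (R := R) hf hg hfg
      obtain ⟨t, ht, ht'⟩ := h₅ 0
      refine ⟨t.comp (e.toLinearMap.toAddMonoidHom.comp r.toAddMonoidHom),
        fun c y => ?_, fun x => ?_⟩
      · change t (e (r (algebraMap R S c • y))) = algebraMap R S c • t (e (r y))
        rw [algebraMap_smul, map_smul, ← algebraMap_smul S c (r y), map_smul, ht]
      · change f (e.symm (d 0 (t (e (r (f (e.symm (d 0 x)))))))) = f (e.symm (d 0 x))
        rw [hr, e.apply_symm_apply, ht']
    have hhom₀ : ∀ a : M →ₗ[S] M₀, g ∘ₗ a = 0 →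
        ∃ b, (f ∘ₗ e.symm.toLinearMap ∘ₗ d 0) ∘ₗ b = a := by
      intro a ha
      replace ha : ∀ x, g (a x) = 0 := LinearMap.congr_fun ha
      obtain ⟨q, hq⟩ := exists_corestrict_of_exact hf hfg a ha
      obtain ⟨b, hb⟩ := h₆ (e.toLinearMap ∘ₗ q)
      refine ⟨b, LinearMap.ext fun x => ?_⟩
      have := LinearMap.congr_fun hb x
      simp only [LinearMap.comp_apply, LinearEquiv.coe_coe] at this
      change f (e.symm (d 0 (b x))) = a x
      rw [this, e.symm_apply_apply]
      exact LinearMap.congr_fun hq x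
    have hhom₁ : ∀ a : M →ₗ[S] C 1, (f ∘ₗ e.symm.toLinearMap ∘ₗ d 0) ∘ₗ a = 0 →
        ∃ b, d 1 ∘ₗ b = a := fun a ha =>
      h₇ 0 (by omega) a (LinearMap.ext fun x => e.symm.map_eq_zero_iff.1
        ((map_eq_zero_iff f hf).1 (LinearMap.congr_fun ha x)))
    refine ⟨consObj X M₀ C, consMap' g (f ∘ₗ e.symm.toLinearMap ∘ₗ d 0) d, ⟨LinearEquiv.refl S X⟩,
      fun i hi => ?_, h₂, hg, fun i hi => ?_, fun i => ?_, hh, fun i hi => ?_⟩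
    · match i with
      | 0 => exact hM
      | i + 1 => exact h₁ i (by omega)
    · match i with
      | 0 => exact hex₀
      | 1 => exact hex₁
      | i + 2 => exact h₄ (i + 1) (by omega)
    · match i with
      | 0 => exact hsplit₀
      | 1 => exact hsplit₁
      | i + 2 => exact h₅ (i + 1)
    · match i with
      | 0 => exact hhom₀
      | 1 => exact hhom₁
      | i + 2 => exact h₇ (i + 1) (by omega)

end ToSequence

/-! ### Comparison with the sequences defining quasi-generators and quasi-cogenerators -/

section Comparison

variable (R : Type u) [CommRing R] (B : Type u) [Ring B] [Algebra R B]
variable (M : Type u) [AddCommGroup M] [Module R M] [Module Bᵐᵒᵖ M] [IsScalarTower R Bᵐᵒᵖ M]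

theorem hasAddCoresolution_iff [Module.Projective R M] (k : ℕ) :
    HasAddCoresolution R B M k ↔ AddCores Bᵐᵒᵖ M k (ModuleCat.of Bᵐᵒᵖ B) := by
  constructor
  · rintro ⟨C, _, _, _, _, d, ⟨e⟩, hadd, hzero, ⟨hinj, hex, -⟩, hsurj, hhom⟩
    refine AddCores.congr ?_ (addCores_range hadd hzero (fun i hi => hex i (by omega)) ?_ k 0
      (zero_add k))
    · exact (e.trans (LinearEquiv.ofInjective (d 0) (hinj (by omega)))).symm
    · intro i hi a ha
      match i with
      | 0 => exact hsurj (by omega) a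
      | i + 1 =>
        refine (hhom i (by omega) a).1 (LinearMap.ext fun x => ha _ ?_)
        exact (hex i (by omega)).apply_apply_eq_zero x
  · intro h
    obtain ⟨C, d, e, h₁, h₂, h₃, h₄, h₅, h₆, h₇⟩ := h.exists_sequence (R := R)
    let _ := fun i => restrictModule R Bᵐᵒᵖ (C i)
    have := fun i => restrictModule_tower R (S := Bᵐᵒᵖ) (C i)
    refine ⟨fun i => C i, inferInstance, inferInstance, inferInstance, inferInstance, d, e, h₁, h₂,
      ⟨fun _ => h₃, fun i hi => h₄ i (by omega), fun i hi => (h₅ i).exists_linear⟩,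
      fun _ => h₆, fun i hi a => ⟨h₇ i (by omega) a, ?_⟩⟩
    rintro ⟨b, rfl⟩
    exact LinearMap.ext fun x =>
      (congrArg b ((h₄ i (by omega)).apply_apply_eq_zero x)).trans (map_zero b)

theorem hasAddResolution_iff [Module.Projective R M] [Module.Projective R (StdDual R B)] (k : ℕ) :
    HasAddResolution R B M k ↔ AddRes Bᵐᵒᵖ M k (ModuleCat.of Bᵐᵒᵖ (StdDual R B)) := by
  constructor
  · rintro ⟨C, _, _, _, _, d, ⟨e⟩, hadd, hzero, ⟨hinj, hex, -⟩, hsurj, hhom⟩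
    refine AddRes.congr ?_ (addRes_range hadd hzero (fun i hi => hex i (by omega)) ?_ k 0
      (zero_add k))
    · exact ((LinearEquiv.ofTop _ (LinearMap.range_eq_top.2 (hinj (by omega)))).trans e.symm)
    · intro i hi a ha
      match i with
      | 0 => exact hsurj (by omega) a
      | i + 1 =>
        refine (hhom i (by omega) a).1 (LinearMap.ext fun x => ?_)
        obtain ⟨y, hy⟩ := ha x
        exact (congrArg (d i) hy.symm).trans ((hex i (by omega)).apply_apply_eq_zero y)
  · intro h
    let _ : Module R (ModuleCat.of Bᵐᵒᵖ (StdDual R B)) :=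
      inferInstanceAs (Module R (StdDual R B))
    have : IsScalarTower R Bᵐᵒᵖ (ModuleCat.of Bᵐᵒᵖ (StdDual R B)) :=
      inferInstanceAs (IsScalarTower R Bᵐᵒᵖ (StdDual R B))
    have : Module.Projective R (ModuleCat.of Bᵐᵒᵖ (StdDual R B)) :=
      inferInstanceAs (Module.Projective R (StdDual R B))
    obtain ⟨C, d, e, h₁, h₂, h₃, h₄, h₅, h₆, h₇⟩ := h.exists_sequence (R := R)
    let _ := fun i => restrictModule R Bᵐᵒᵖ (C i)
    have := fun i => restrictModule_tower R (S := Bᵐᵒᵖ) (C i)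
    refine ⟨fun i => C i, inferInstance, inferInstance, inferInstance, inferInstance, d, e, h₁, h₂,
      ⟨fun _ => h₃, fun i hi => h₄ i (by omega), fun i hi => (h₅ i).exists_linear⟩,
      fun _ => h₆, fun i hi a => ⟨h₇ i (by omega) a, ?_⟩⟩
    rintro ⟨b, rfl⟩
    exact LinearMap.ext fun x => (h₄ i (by omega)).apply_apply_eq_zero (b x)

end Comparison

/-! ### Duality for finitely generated projective modules -/

section Duality

variable {R : Type u} [CommRing R] {M : Type u} [AddCommGroup M] [Module R M]

theorem exists_dualBasis [Module.Finite R M] [Module.Projective R M] :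
    ∃ (n : ℕ) (x : Fin n → M) (φ : Fin n → StdDual R M), ∀ y, ∑ j, φ j y • x j = y := by
  classical
  obtain ⟨n, p, i, -, -, h⟩ := Module.Finite.exists_comp_eq_id_of_projective R M
  refine ⟨n, fun j => p (Pi.single j 1), fun j => LinearMap.proj j ∘ₗ i, fun y => ?_⟩
  have := LinearMap.congr_fun h y
  rw [LinearMap.comp_apply, LinearMap.id_apply] at this
  conv_rhs => rw [← this, ← LinearMap.sum_single_apply (fun _ => R) (i y), map_sum]
  refine Finset.sum_congr rfl fun j _ => ?_
  rw [← map_smul]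
  congr 1
  ext l
  by_cases hl : l = j
  · subst hl; simp; rfl
  · simp [Pi.single_eq_of_ne hl]

theorem StdDual.ext {φ ψ : StdDual R M} (h : ∀ x, φ x = ψ x) : φ = ψ :=
  LinearMap.ext h

theorem StdDual.add_apply (φ ψ : StdDual R M) (x : M) : (φ + ψ) x = φ x + ψ x := rfl

theorem StdDual.map_add (φ : StdDual R M) (x y : M) : φ (x + y) = φ x + φ y :=
  LinearMap.map_add (show M →ₗ[R] R from φ) x y

theorem StdDual.map_sub (φ : StdDual R M) (x y : M) : φ (x - y) = φ x - φ y :=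
  LinearMap.map_sub (show M →ₗ[R] R from φ) x y

theorem StdDual.map_zero (φ : StdDual R M) : φ 0 = 0 :=
  LinearMap.map_zero (show M →ₗ[R] R from φ)

theorem StdDual.map_smul (φ : StdDual R M) (r : R) (x : M) : φ (r • x) = r * φ x :=
  LinearMap.map_smul (show M →ₗ[R] R from φ) r x

theorem StdDual.map_sum {ι : Type*} (φ : StdDual R M) (s : Finset ι) (x : ι → M) :
    φ (∑ i ∈ s, x i) = ∑ i ∈ s, φ (x i) :=
  _root_.map_sum (show M →ₗ[R] R from φ) x s

theorem StdDual.sum_apply {ι : Type*} (s : Finset ι) (φ : ι → StdDual R M) (x : M) :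
    (∑ i ∈ s, φ i) x = ∑ i ∈ s, φ i x :=
  LinearMap.sum_apply s (fun i => (show M →ₗ[R] R from φ i)) x

variable [Module.Finite R M] [Module.Projective R M]

theorem eq_zero_of_forall_dual {x : M} (h : ∀ φ : StdDual R M, φ x = 0) : x = 0 := by
  obtain ⟨n, y, φ, hy⟩ := exists_dualBasis (R := R) (M := M)
  rw [← hy x]
  exact Finset.sum_eq_zero fun j _ => by rw [h, zero_smul]

theorem eq_of_forall_dual {x y : M} (h : ∀ φ : StdDual R M, φ x = φ y) : x = y :=
  sub_eq_zero.1 (eq_zero_of_forall_dual (R := R) fun φ => by rw [StdDual.map_sub, h, sub_self])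

theorem exists_eval_eq (ψ : StdDual R M →ₗ[R] R) : ∃ x : M, ∀ φ : StdDual R M, φ x = ψ φ := by
  obtain ⟨n, y, φ, hy⟩ := exists_dualBasis (R := R) (M := M)
  -- Every functional `χ` is the combination of the `φ j` with coefficients `χ (y j)`; applying `ψ`
  -- to this expansion dictates the witness.
  refine ⟨∑ j, ψ (φ j) • y j, fun χ => ?_⟩
  have : χ = ∑ j, χ (y j) • φ j := StdDual.ext fun z => by
    conv_lhs => rw [← hy z]
    rw [StdDual.map_sum, StdDual.sum_apply]
    refine Finset.sum_congr rfl fun j _ => ?_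
    rw [StdDual.map_smul, StdDual.algebraSmul_apply, mul_comm]
  conv_rhs => rw [this]
  rw [StdDual.map_sum, _root_.map_sum]
  refine Finset.sum_congr rfl fun j _ => ?_
  rw [StdDual.map_smul, _root_.map_smul, smul_eq_mul, mul_comm]

omit [Module.Finite R M] [Module.Projective R M] in
theorem IsFGProj.of_retract {N : Type u} [AddCommGroup N] [Module R N] (h : IsFGProj R M)
    (i : N →ₗ[R] M) (p : M →ₗ[R] N) (hpi : ∀ x, p (i x) = x) : IsFGProj R N := by
  have := h.1
  have := h.2
  exact ⟨Module.Finite.of_surjective p fun x => ⟨i x, hpi x⟩,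
    Module.Projective.of_split i p (LinearMap.ext hpi)⟩

omit [Module.Finite R M] [Module.Projective R M] in
theorem IsFGProj.congr {N : Type u} [AddCommGroup N] [Module R N] (h : IsFGProj R M)
    (e : M ≃ₗ[R] N) : IsFGProj R N :=
  h.of_retract e.symm.toLinearMap e.toLinearMap e.apply_symm_apply

omit [Module.Finite R M] [Module.Projective R M] in
theorem IsFGProj.stdDual (h : IsFGProj R M) : IsFGProj R (StdDual R M) := by
  have := h.1
  have := h.2
  obtain ⟨n, y, φ, hy⟩ := exists_dualBasis (R := R) (M := M)
  have hR : IsFGProj R (Fin n → R) := ⟨inferInstance, inferInstance⟩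
  refine hR.of_retract
    { toFun := fun χ j => χ (y j), map_add' := fun _ _ => rfl, map_smul' := fun _ _ => rfl }
    { toFun := fun c => ∑ j, c j • φ j
      map_add' := fun c d => by simp [add_smul, Finset.sum_add_distrib]
      map_smul' := fun r c => by simp [mul_smul, Finset.smul_sum] } fun χ =>
    StdDual.ext fun z => ?_
  change (∑ j, χ (y j) • φ j : StdDual R M) z = χ z
  conv_rhs => rw [← hy z]
  rw [StdDual.map_sum, StdDual.sum_apply]
  refine Finset.sum_congr rfl fun j _ => ?_
  rw [StdDual.map_smul, StdDual.algebraSmul_apply, mul_comm]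

end Duality

/-! ### The adjunction between Hom_A(-, M) and DM ⊗_A - -/

section HomDual

variable {R : Type u} [CommRing R] {A : Type u} [Ring A] [Algebra R A]
variable {M : Type u} [AddCommGroup M] [Module R M] [Module A M] [IsScalarTower R A M]
variable {N : Type u} [AddCommGroup N] [Module A N]

/-- The pairing `Hom_A(N, M) → D(DM ⊗_A N)`. -/
noncomputable def homToDual (f : N →ₗ[A] M) : BalTensor R A (StdDual R M) N →ₗ[R] R :=
  BalTensor.lift (fun φ y => φ (f y)) (fun _ _ _ => rfl) (fun _ _ _ => rfl)
    (fun φ y y' => by rw [map_add, StdDual.map_add])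
    (fun φ a y => by rw [map_smul]; rfl)

theorem homToDual_tmul (f : N →ₗ[A] M) (φ : StdDual R M) (y : N) :
    homToDual f (BalTensor.tmul R A φ y) = φ (f y) := rfl

theorem homToDual_smul_apply (r : R) (f : N →ₗ[A] M) (t : BalTensor R A (StdDual R M) N) :
    homToDual (r • f) t = r * homToDual f t := by
  induction t using BalTensor.induction_on with
  | zero => rw [map_zero, map_zero, mul_zero]
  | tmul φ y => exact StdDual.map_smul φ r (f y)
  | add s t hs ht => rw [map_add, map_add, hs, ht, mul_add]

variable [Module.Finite R M] [Module.Projective R M]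

/-- For fixed `y`, the functional φ ↦ ψ(φ ⊗ y) on DM is evaluation at a unique point of `M`, by
reflexivity. Linearity in `y` is tested against all functionals, and `A`-linearity is the balancing
relation. -/
theorem exists_homToDual_eq (ψ : BalTensor R A (StdDual R M) N →ₗ[R] R) :
    ∃ f : N →ₗ[A] M, ∀ (φ : StdDual R M) y, φ (f y) = ψ (BalTensor.tmul R A φ y) := by
  have h : ∀ y, ∃ x : M, ∀ φ : StdDual R M, φ x = ψ (BalTensor.tmul R A φ y) := fun y =>
    exists_eval_eq (R := R) (M := M)
      { toFun := fun φ => ψ (BalTensor.tmul R A φ y)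
        map_add' := fun φ φ' => by rw [BalTensor.add_tmul, map_add]
        map_smul' := fun r φ => by rw [BalTensor.smul_tmul, map_smul]; rfl }
  choose f hf using h
  refine ⟨⟨⟨f, fun y y' => eq_of_forall_dual (R := R) fun φ => ?_⟩,
    fun a y => eq_of_forall_dual (R := R) fun φ => ?_⟩, fun φ y => hf y φ⟩
  · rw [StdDual.map_add, hf, hf, hf, BalTensor.tmul_add, map_add]
  · rw [hf, ← BalTensor.op_smul_tmul, ← hf]; rfl

omit [Module.Finite R M] [Module.Projective R M] in
variable (R A M N) in
/-- The pairing `Hom_A(N, M) → D(DM ⊗_A N)` as a linear map. -/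
noncomputable def homToDualLinear :
    (N →ₗ[A] M) →ₗ[R] StdDual R (BalTensor R A (StdDual R M) N) where
  toFun f := (homToDual f : BalTensor R A (StdDual R M) N →ₗ[R] R)
  map_add' f g := BalTensor.hom_ext R A (StdDual R M) fun φ y => StdDual.map_add φ (f y) (g y)
  map_smul' r f := StdDual.ext fun t => homToDual_smul_apply r f t

/-- `Hom_A(N, M) ≅ D(DM ⊗_A N)`. -/
noncomputable def homEquivDual :
    (N →ₗ[A] M) ≃ₗ[R] StdDual R (BalTensor R A (StdDual R M) N) :=
  LinearEquiv.ofBijective (homToDualLinear R A M N)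
    ⟨fun f g h => LinearMap.ext fun y => eq_of_forall_dual (R := R) fun φ =>
        LinearMap.congr_fun h (BalTensor.tmul R A φ y),
      fun ψ => by
        obtain ⟨f, hf⟩ := exists_homToDual_eq (A := A) (M := M) (N := N) ψ
        exact ⟨f, BalTensor.hom_ext R A (StdDual R M) hf⟩⟩

theorem isFGProj_hom (h : IsFGProj R (BalTensor R A (StdDual R M) N)) :
    IsFGProj R (N →ₗ[A] M) :=
  h.stdDual.congr homEquivDual.symm

/-- Under the adjunction, `a` is a functional on DM ⊗ K. Composed with the retraction it becomes a
functional on DM ⊗ N, and that is the extension sought. -/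
theorem exists_extension_of_tensor {K : Type u} [AddCommGroup K] [Module A K] (i : K →ₗ[A] N)
    (r : BalTensor R A (StdDual R M) N →ₗ[R] BalTensor R A (StdDual R M) K)
    (hr : ∀ t, r (BalTensor.map R A (StdDual R M) i t) = t) (a : K →ₗ[A] M) :
    ∃ b : N →ₗ[A] M, b ∘ₗ i = a := by
  obtain ⟨b, hb⟩ := exists_homToDual_eq (A := A) (M := M) (N := N) (homToDual (R := R) a ∘ₗ r)
  refine ⟨b, LinearMap.ext fun y => eq_of_forall_dual (R := R) fun φ => ?_⟩
  rw [LinearMap.comp_apply, hb, LinearMap.comp_apply, ← BalTensor.map_tmul, hr, homToDual_tmul]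

end HomDual

/-! ### The functor Hom_B(-, M) and reflexive modules -/

section Bimodule

variable {A B : Type u} [Ring A] [Ring B] {M : Type u} [AddCommGroup M] [Module A M] [Module B M]
  [SMulCommClass A B M] [SMulCommClass B A M]
variable {X Y Z : Type u} [AddCommGroup X] [Module B X] [AddCommGroup Y] [Module B Y]
  [AddCommGroup Z] [Module B Z]

variable (A B M) in
/-- Every `B`-endomorphism of `M` is the action of an element of `A`. -/
def EndSurjective : Prop := ∀ f : M →ₗ[B] M, ∃ a : A, ∀ x, f x = a • x

variable (A M) in
/-- Precomposition `Hom_B(Y, M) → Hom_B(X, M)` as a map of `A`-modules. -/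
def precomp (f : X →ₗ[B] Y) : (Y →ₗ[B] M) →ₗ[A] (X →ₗ[B] M) where
  toFun b := b ∘ₗ f
  map_add' _ _ := rfl
  map_smul' _ _ := rfl

theorem precomp_injective {g : Y →ₗ[B] Z} (hg : Function.Surjective g) :
    Function.Injective (precomp A M g) := fun a b h => LinearMap.ext fun z => by
  obtain ⟨y, rfl⟩ := hg z
  exact LinearMap.congr_fun h y

theorem precomp_surjective {f : X →ₗ[B] Y} (h : ∀ a : X →ₗ[B] M, ∃ b : Y →ₗ[B] M, b ∘ₗ f = a) :
    Function.Surjective (precomp A M f) := h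

theorem precomp_exact {f : X →ₗ[B] Y} {g : Y →ₗ[B] Z} (hg : Function.Surjective g)
    (hfg : Function.Exact f g) : Function.Exact (precomp A M g) (precomp A M f) := fun a =>
  ⟨fun h => exists_factor_of_exact hg hfg a (LinearMap.congr_fun h), by
    rintro ⟨b, rfl⟩
    exact LinearMap.ext fun x =>
      (congrArg b (hfg.apply_apply_eq_zero x)).trans (map_zero b)⟩

/-- Since Hom_B(M, M) = A, the functor Hom_B(-, M) carries summands of M^k to summands of A^k. The
coordinates of `f` are the elements of `A` that act as f ∘ p l. -/
theorem inAdd_hom (hA : EndSurjective A B M) (hA' : ∀ a : A, (∀ x : M, a • x = 0) → a = 0)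
    (h : InAdd B M X) : InAdd A A (X →ₗ[B] M) := by
  obtain ⟨k, i, p, hpi⟩ := h.exists_components
  choose e he using hA
  have he' : ∀ f (a : A), (∀ x, f x = a • x) → e f = a := fun f a h =>
    sub_eq_zero.1 (hA' _ fun x => by rw [sub_smul, ← he, ← h, sub_self])
  refine InAdd.of_components (k := k)
    (fun l => { toFun := fun f => e (f ∘ₗ p l)
                map_add' := fun f g => he' _ _ fun x => by
                  rw [add_smul, ← he, ← he]; rfl
                map_smul' := fun a f => he' _ _ fun x => by
                  rw [RingHom.id_apply, smul_eq_mul, mul_smul, ← he]; rfl })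
    (fun l => LinearMap.toSpanSingleton A _ (i l)) fun f => LinearMap.ext fun x => ?_
  simp only [LinearMap.sum_apply]
  conv_rhs => rw [← hpi x, map_sum]
  exact Finset.sum_congr rfl fun l _ => (he _ _).symm

theorem InAdd.projective_self {N : Type u} [AddCommGroup N] [Module A N] (h : InAdd A A N) :
    Module.Projective A N := by
  obtain ⟨k, i, p, hpi⟩ := h
  exact Module.Projective.of_split i p hpi

/-- Hom_B(-, M) turns each short exact piece into one with projective middle term, so each step
raises the projective dimension by at most one. -/
theorem AddCores.hasProjectiveDimensionLE (hA : EndSurjective A B M)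
    (hA' : ∀ a : A, (∀ x : M, a • x = 0) → a = 0) {k : ℕ} : ∀ {X : ModuleCat.{u} B},
    AddCores B M k X → HasProjectiveDimensionLE (ModuleCat.of A (X →ₗ[B] M)) k := by
  induction k with
  | zero =>
    intro X h
    have := (inAdd_hom hA hA' h).projective_self
    exact projective_iff_hasProjectiveDimensionLT_one.1
      ((IsProjective.iff_projective (X →ₗ[B] M)).1 inferInstance)
  | succ k ih =>
    rintro X ⟨M₀, Y, f, g, hM, hf, hg, hfg, hh, hY⟩
    have := (inAdd_hom hA hA' hM).projective_self
    have : Projective (ModuleCat.of A (M₀ →ₗ[B] M)) :=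
      (IsProjective.iff_projective (M₀ →ₗ[B] M)).1 inferInstance
    have hS := shortExact_of_exact (precomp_injective (A := A) (M := M) hg)
      (precomp_surjective hh)
      (precomp_exact hg hfg)
    have h₂ : HasProjectiveDimensionLE (ModuleCat.of A (M₀ →ₗ[B] M)) (k + 1) := by
      have := projective_iff_hasProjectiveDimensionLT_one.1 this
      exact hasProjectiveDimensionLT_of_ge _ 1 _ (by omega)
    exact hS.hasProjectiveDimensionLT_X₃ (k + 1) (ih hY) h₂

variable (A B M) in
/-- `X` is reflexive with respect to the duality `Hom(-, M)` between `B`-modules and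
`A`-modules. -/
def HomReflexive (X : Type u) [AddCommGroup X] [Module B X] : Prop :=
  (∀ x : X, (∀ a : X →ₗ[B] M, a x = 0) → x = 0) ∧
    ∀ Ψ : (X →ₗ[B] M) →ₗ[A] M, ∃ x : X, ∀ a, Ψ a = a x

theorem InAdd.homReflexive (hA : EndSurjective A B M) (h : InAdd B M X) : HomReflexive A B M X := by
  obtain ⟨k, i, p, hpi⟩ := h.exists_components
  refine ⟨fun x hx => ?_, fun Ψ => ⟨∑ l, p l (Ψ (i l)), fun a => ?_⟩⟩
  · rw [← hpi x]
    exact Finset.sum_eq_zero fun l _ => by rw [hx, map_zero]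
  · choose c hc using fun l => hA (a ∘ₗ p l)
    have : a = ∑ l, c l • i l := LinearMap.ext fun x => by
      conv_lhs => rw [← hpi x, map_sum]
      rw [LinearMap.sum_apply]
      exact Finset.sum_congr rfl fun l _ => hc l (i l x)
    conv_lhs => rw [this, map_sum]
    rw [map_sum]
    exact Finset.sum_congr rfl fun l _ => by rw [map_smul, ← hc]; rfl

/-- Pulled back to `Y`, the functional `Ψ` is evaluation at some y. For c : Z → M, the value c (g y)
is `Ψ` of the zero map c ∘ g ∘ f, so g y = 0 and y comes from `X`. As every map on `X` extends to
`Y`, this determines `Ψ`. -/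
theorem HomReflexive.left {f : X →ₗ[B] Y} {g : Y →ₗ[B] Z} (hf : Function.Injective f)
    (hfg : Function.Exact f g) (hh : ∀ a : X →ₗ[B] M, ∃ b : Y →ₗ[B] M, b ∘ₗ f = a)
    (hY : HomReflexive A B M Y) (hZ : ∀ z : Z, (∀ a : Z →ₗ[B] M, a z = 0) → z = 0) :
    HomReflexive A B M X := by
  refine ⟨fun x hx => hf ?_, fun Ψ => ?_⟩
  · rw [map_zero]
    exact hY.1 _ fun b => hx (b ∘ₗ f)
  · obtain ⟨y, hy⟩ := hY.2 (Ψ ∘ₗ precomp A M f)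
    obtain ⟨x, rfl⟩ := (hfg y).1 (hZ _ fun c => by
      have h₁ : Ψ ((c ∘ₗ g) ∘ₗ f) = c (g y) := hy (c ∘ₗ g)
      rw [← h₁, LinearMap.comp_assoc, hfg.linearMap_comp_eq_zero, LinearMap.comp_zero, map_zero])
    refine ⟨x, fun a => ?_⟩
    obtain ⟨b, rfl⟩ := hh a
    exact hy b

theorem AddCores.homReflexive (hA : EndSurjective A B M) {k : ℕ} : ∀ {X : ModuleCat.{u} B},
    AddCores B M k X → HomReflexive A B M X := by
  induction k with
  | zero => exact fun h => InAdd.homReflexive hA h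
  | succ k ih =>
    rintro X ⟨M₀, Y, f, g, hM, hf, hg, hfg, hh, hY⟩
    exact HomReflexive.left hf hfg hh (InAdd.homReflexive hA hM) (ih hY).1

end Bimodule

/-! ### The evaluation map from DM ⊗_A Hom_B(X, M) to DX -/

section TensorHom

variable {R : Type u} [CommRing R]
variable {A B : Type u} [Ring A] [Ring B] [Algebra R B] {M : Type u} [AddCommGroup M]
  [Module R M] [Algebra R A] [Module A M] [Module B M] [IsScalarTower R A M]
  [IsScalarTower R B M]
  [SMulCommClass A B M] [SMulCommClass B A M]
variable {X Y : Type u} [AddCommGroup X] [Module R X] [Module B X] [IsScalarTower R B X]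
  [AddCommGroup Y] [Module R Y] [Module B Y] [IsScalarTower R B Y]

/-- Composition of a functional on `M` with a `B`-linear map. -/
def StdDual.comp (φ : StdDual R M) (f : X →ₗ[B] M) : StdDual R X :=
  LinearMap.comp (show M →ₗ[R] R from φ) (f.restrictScalars R)

theorem StdDual.comp_add (φ ψ : StdDual R M) (f : X →ₗ[B] M) :
    (φ + ψ).comp f = φ.comp f + ψ.comp f := rfl

theorem StdDual.comp_smul (r : R) (φ : StdDual R M) (f : X →ₗ[B] M) :
    (r • φ).comp f = r • φ.comp f := rfl

variable (R A B M X) in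
/-- The map `DM ⊗_A Hom_B(X, M) → DX`. -/
noncomputable def tensorHomToDual :
    BalTensor R A (StdDual R M) (X →ₗ[B] M) →ₗ[R] StdDual R X :=
  BalTensor.lift (fun φ f => φ.comp f) (fun _ _ _ => rfl) (fun _ _ _ => rfl)
    (fun φ f g => StdDual.ext fun x => φ.map_add (f x) (g x)) (fun _ _ _ => rfl)

theorem tensorHomToDual_map (f : X →ₗ[B] Y) (t : BalTensor R A (StdDual R M) (Y →ₗ[B] M)) (x : X) :
    tensorHomToDual R A B M X (BalTensor.map R A (StdDual R M) (precomp A M f) t) x =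
      tensorHomToDual R A B M Y t (f x) := by
  induction t using BalTensor.induction_on with
  | zero => rw [map_zero, map_zero, map_zero]; rfl
  | tmul φ a => rfl
  | add s t hs ht =>
    rw [map_add, map_add, map_add, StdDual.add_apply, StdDual.add_apply, hs, ht]

/-- If `X` embeds into an object `Y` of `add M` so that all maps to `M` extend and the functionals
on `Y` vanishing on `X` come from maps to `M` vanishing on `X`, then `DM ⊗_A Hom_B(X, M) ≅ DX`. -/
theorem tensorHomToDual_bijective (hA : EndSurjective A B M) (hY : InAdd B M Y) (f : X →ₗ[B] Y)
    (r : Y →ₗ[R] X) (hr : ∀ x, r (f x) = x)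
    (hh : ∀ a : X →ₗ[B] M, ∃ b : Y →ₗ[B] M, b ∘ₗ f = a)
    (hd : ∀ ψ : StdDual R Y, (∀ x, ψ (f x) = 0) → ψ ∈ Submodule.span R
      {χ | ∃ (φ : StdDual R M) (b : Y →ₗ[B] M), b ∘ₗ f = 0 ∧ χ = φ.comp b}) :
    Function.Bijective (tensorHomToDual R A B M X) := by
  obtain ⟨k, i, p, hpi⟩ := hY.exists_components
  -- For `Y` in add M the evaluation map has the explicit inverse ψ ↦ ∑ (ψ ∘ p l) ⊗ i l; `σ` is this
  -- inverse followed by restriction along `f`.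
  let σ : StdDual R Y →ₗ[R] BalTensor R A (StdDual R M) (X →ₗ[B] M) :=
    { toFun := fun ψ => ∑ l, BalTensor.tmul R A (ψ.comp (p l)) (i l ∘ₗ f)
      map_add' := fun ψ ψ' => by
        rw [← Finset.sum_add_distrib]
        exact Finset.sum_congr rfl fun l _ => by rw [StdDual.comp_add, BalTensor.add_tmul]
      map_smul' := fun c ψ => by
        rw [RingHom.id_apply, Finset.smul_sum]
        exact Finset.sum_congr rfl fun l _ => by rw [StdDual.comp_smul, BalTensor.smul_tmul] }
  have hσ : ∀ ψ, σ ψ = ∑ l, BalTensor.tmul R A (ψ.comp (p l)) (i l ∘ₗ f) := fun _ => rfl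
  -- Each b ∘ p l is an endomorphism of `M`, so it is the action of an element of `A`, which moves
  -- across the tensor sign.
  have h₁ : ∀ (φ : StdDual R M) (b : Y →ₗ[B] M), σ (φ.comp b) = BalTensor.tmul R A φ (b ∘ₗ f) := by
    intro φ b
    choose c hc using fun l => hA (b ∘ₗ p l)
    have e₁ : ∀ l, (φ.comp b).comp (p l) = MulOpposite.op (c l) • φ := fun l =>
      StdDual.ext fun x => congrArg φ (hc l x)
    have e₂ : b ∘ₗ f = ∑ l, c l • (i l ∘ₗ f) := LinearMap.ext fun x => by
      rw [LinearMap.sum_apply]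
      conv_lhs => rw [LinearMap.comp_apply, ← hpi (f x), map_sum]
      exact Finset.sum_congr rfl fun l _ => hc l _
    rw [hσ, e₂, BalTensor.tmul_sum]
    exact Finset.sum_congr rfl fun l _ => by rw [e₁, BalTensor.op_smul_tmul]
  have h₂ : ∀ ψ x, tensorHomToDual R A B M X (σ ψ) x = ψ (f x) := by
    intro ψ x
    rw [hσ, map_sum, StdDual.sum_apply]
    conv_rhs => rw [← hpi (f x), StdDual.map_sum]
    rfl
  have h₃ : Function.Surjective σ := by
    intro t
    induction t using BalTensor.induction_on with
    | zero => exact ⟨0, map_zero _⟩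
    | tmul φ a =>
      obtain ⟨b, rfl⟩ := hh a
      exact ⟨_, h₁ φ b⟩
    | add s t hs ht =>
      obtain ⟨s, rfl⟩ := hs
      obtain ⟨t, rfl⟩ := ht
      exact ⟨s + t, map_add _ _ _⟩
  refine ⟨(injective_iff_map_eq_zero _).2 fun t ht => ?_, fun ψ => ?_⟩
  -- If σ ψ evaluates to zero, then `ψ` vanishes on `X`, and `hd` writes it through functionals that
  -- `σ` kills.
  · obtain ⟨ψ, rfl⟩ := h₃ t
    have hψ := hd ψ fun x => by rw [← h₂, ht]; rfl
    refine (Submodule.span_le (p := LinearMap.ker σ)).2 ?_ hψ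
    rintro _ ⟨φ, b, hb, rfl⟩
    change σ _ = 0
    rw [h₁, hb, BalTensor.tmul_zero]
  · let ψ' : StdDual R Y := LinearMap.comp (show X →ₗ[R] R from ψ) r
    refine ⟨σ ψ', StdDual.ext fun x => ?_⟩
    rw [h₂]
    exact congrArg ψ (hr x)

/-- A functional on `M₀` vanishing on `X` factors through `Y`, and surjectivity for `Y` expresses it
through maps Y → M; this supplies the span condition for `X`. Injectivity for `Y` and naturality
make DM ⊗ Hom_B(g, M) injective, which is the Tor_1 condition. -/
theorem AddCores.tensorHomToDual_bijective [Module.Projective R M]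
    (hA : EndSurjective A B M) (hA' : ∀ a : A, (∀ x : M, a • x = 0) → a = 0) {k : ℕ} :
    ∀ {X : ModuleCat.{u} B} [Module R X] [IsScalarTower R B X], AddCores B M k X →
      Function.Bijective (tensorHomToDual R A B M X) ∧
        TorVanishes R A (StdDual R M) (X →ₗ[B] M) := by
  have h₀ : ∀ {X : ModuleCat.{u} B} [Module R X] [IsScalarTower R B X], InAdd B M X →
      Function.Bijective (tensorHomToDual R A B M X) := fun {X} _ _ h =>
    _root_.tensorHomToDual_bijective hA h LinearMap.id LinearMap.id (fun _ => rfl)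
      (fun a => ⟨a, rfl⟩)
      fun ψ hψ => by rw [show ψ = 0 from StdDual.ext hψ]; exact Submodule.zero_mem _
  induction k with
  | zero =>
    intro X _ _ h
    have := (inAdd_hom hA hA' h).projective_self
    exact ⟨h₀ h, torVanishes_of_projective⟩
  | succ k ih =>
    rintro X _ _ ⟨M₀, Y, f, g, hM, hf, hg, hfg, hh, hY⟩
    let _ := restrictModule R B M₀
    have := restrictModule_tower R (S := B) M₀
    let _ := restrictModule R B Y
    have := restrictModule_tower R (S := B) Y
    obtain ⟨hY₁, hY₂⟩ := ih hY
    have := hY.projective (R := R)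
    obtain ⟨r, hr⟩ := exists_retraction_of_projective (R := R) hf hg hfg
    have := (inAdd_hom hA hA' hM).projective_self
    constructor
    · refine _root_.tensorHomToDual_bijective hA hM f r hr hh fun ψ hψ => ?_
      obtain ⟨ψ', hψ'⟩ := exists_factor_of_exact (f := f.restrictScalars R)
        (g := g.restrictScalars R) hg hfg (show M₀ →ₗ[R] R from ψ) hψ
      obtain ⟨t, ht⟩ := hY₁.2 ψ'
      have : ψ = tensorHomToDual R A B M M₀
          (BalTensor.map R A (StdDual R M) (precomp A M g) t) := StdDual.ext fun y => by
        rw [tensorHomToDual_map, ht]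
        exact (LinearMap.congr_fun hψ' y).symm
      rw [this]
      clear this ht
      induction t using BalTensor.induction_on with
      | zero => rw [map_zero, map_zero]; exact Submodule.zero_mem _
      | tmul φ a =>
        refine Submodule.subset_span ⟨φ, a ∘ₗ g, ?_, rfl⟩
        rw [LinearMap.comp_assoc, hfg.linearMap_comp_eq_zero, LinearMap.comp_zero]
      | add s t hs ht => rw [map_add, map_add]; exact Submodule.add_mem _ hs ht
    · refine (torVanishes_iff (precomp_injective hg) (precomp_surjective hh) (precomp_exact hg hfg)).2
        ⟨(injective_iff_map_eq_zero _).2 fun t ht => hY₁.1 (StdDual.ext fun y => ?_), hY₂⟩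
      obtain ⟨y, rfl⟩ := hg y
      rw [← tensorHomToDual_map, ht, map_zero, map_zero]; rfl

end TensorHom

/-! ### The functor Hom_A(-, M) on projective modules -/

section AddSelf

variable {A B : Type u} [Ring A] [Ring B] {M : Type u} [AddCommGroup M] [Module A M] [Module B M]
  [SMulCommClass A B M] [SMulCommClass B A M]
variable {N : Type u} [AddCommGroup N] [Module A N]

theorem InAdd.fin_fun (n : ℕ) : InAdd A A (Fin n → A) := InAdd.pi n

theorem inAdd_of_projective [Module.Finite A N] [Module.Projective A N] : InAdd A A N := by
  obtain ⟨n, g, hg⟩ := Module.Finite.exists_fin' A N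
  obtain ⟨s, hs⟩ := Module.projective_lifting_property g LinearMap.id hg
  exact ⟨n, s, g, hs⟩

variable (M) in
/-- For a projective module `N`, the module `Hom_A(N, M)` lies in `add M`. -/
theorem inAdd_hom_of_inAdd_self (h : InAdd A A N) : InAdd B M (N →ₗ[A] M) := by
  obtain ⟨k, i, p, hpi⟩ := h.exists_components
  refine InAdd.of_components (k := k)
    (fun l => { toFun := fun f => f (p l 1), map_add' := fun _ _ => rfl,
                map_smul' := fun _ _ => rfl })
    (fun l =>
      { toFun := fun m => (LinearMap.toSpanSingleton A M m) ∘ₗ i l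
        map_add' := fun m m' => LinearMap.ext fun y => smul_add (i l y) m m'
        map_smul' := fun b m => LinearMap.ext fun y => smul_comm (i l y) b m })
    fun f => LinearMap.ext fun y => ?_
  rw [LinearMap.sum_apply]
  conv_rhs => rw [← hpi y, map_sum]
  refine Finset.sum_congr rfl fun l _ => ?_
  change i l y • f (p l 1) = _
  rw [← map_smul, ← map_smul, smul_eq_mul, mul_one]

/-- Hom_A(A, M) is `M` as a `B`-module, so a `B`-map from it to `M` is an endomorphism of `M`, that
is, the action of an element of `A`. -/
theorem homReflexive_self (hA : EndSurjective A B M)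
    (hA' : ∀ a : A, (∀ x : M, a • x = 0) → a = 0) : HomReflexive B A M A := by
  refine ⟨fun a ha => hA' a fun x => ha (LinearMap.toSpanSingleton A M x), fun Ψ => ?_⟩
  obtain ⟨a, ha⟩ := hA
    { toFun := fun x => Ψ (LinearMap.toSpanSingleton A M x)
      map_add' := fun x y => by rw [← map_add, LinearMap.toSpanSingleton_add]
      map_smul' := fun b x => by
        rw [RingHom.id_apply, ← map_smul]
        congr 1
        exact LinearMap.ext fun a => smul_comm a b x }
  refine ⟨a, fun f => ?_⟩
  have : f = LinearMap.toSpanSingleton A M (f 1) := LinearMap.ext fun c => by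
    rw [LinearMap.toSpanSingleton_apply, ← map_smul, smul_eq_mul, mul_one]
  rw [this, LinearMap.toSpanSingleton_apply]
  exact ha (f 1)

theorem HomReflexive.of_inAdd {Q : Type u} [AddCommGroup Q] [Module A Q]
    (hQ : HomReflexive B A M Q) (h : InAdd A Q N) : HomReflexive B A M N := by
  obtain ⟨k, i, p, hpi⟩ := h.exists_components
  refine ⟨fun x hx => ?_, fun Ψ => ?_⟩
  · rw [← hpi x]
    exact Finset.sum_eq_zero fun l _ => by rw [hQ.1 _ fun c => hx (c ∘ₗ i l), map_zero]
  · choose y hy using fun l => hQ.2 (Ψ ∘ₗ precomp B M (i l))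
    refine ⟨∑ l, p l (y l), fun a => ?_⟩
    have : a = ∑ l, (a ∘ₗ p l) ∘ₗ i l := LinearMap.ext fun x => by
      conv_lhs => rw [← hpi x, map_sum]
      rw [LinearMap.sum_apply]
      rfl
    conv_lhs => rw [this, map_sum]
    rw [map_sum]
    exact Finset.sum_congr rfl fun l _ => hy l (a ∘ₗ p l)

end AddSelf

/-! ### Tor vanishing, syzygies and Ext vanishing -/

section TensorFree

variable {R : Type u} [CommRing R] {A : Type u} [Ring A] [Algebra R A]
variable {X : Type u} [AddCommGroup X] [Module R X] [Module Aᵐᵒᵖ X] [IsScalarTower R Aᵐᵒᵖ X]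
variable {N : Type u} [AddCommGroup N] [Module A N]

theorem balTensor_isFGProj_of_inAdd (hX : IsFGProj R X) (h : InAdd A A N) :
    IsFGProj R (BalTensor R A X N) := by
  obtain ⟨k, i, p, hpi⟩ := h.exists_components
  have := hX.1
  have := hX.2
  have hk : IsFGProj R (Fin k → X) := ⟨inferInstance, projective_fin_fun k⟩
  let I : Fin k → BalTensor R A X N →ₗ[R] X := fun l =>
    BalTensor.lift (fun x y => MulOpposite.op (i l y) • x)
      (fun x x' y => smul_add _ _ _) (fun r x y => smul_comm _ _ _)
      (fun x y y' => by rw [map_add, MulOpposite.op_add, add_smul])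
      (fun x a y => by rw [map_smul, smul_eq_mul, MulOpposite.op_mul, mul_smul])
  let P : (Fin k → X) →ₗ[R] BalTensor R A X N :=
    { toFun := fun x => ∑ l, BalTensor.tmul R A (x l) (p l 1)
      map_add' := fun x x' => by
        rw [← Finset.sum_add_distrib]
        exact Finset.sum_congr rfl fun l _ => by rw [Pi.add_apply, BalTensor.add_tmul]
      map_smul' := fun r x => by
        rw [RingHom.id_apply, Finset.smul_sum]
        exact Finset.sum_congr rfl fun l _ => by rw [Pi.smul_apply, BalTensor.smul_tmul] }
  have key : P ∘ₗ LinearMap.pi I = LinearMap.id := BalTensor.hom_ext R A X fun x y => by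
    change ∑ l, BalTensor.tmul R A (MulOpposite.op (i l y) • x) (p l 1) = BalTensor.tmul R A x y
    conv_rhs => rw [← hpi y, BalTensor.tmul_sum]
    refine Finset.sum_congr rfl fun l _ => ?_
    rw [BalTensor.op_smul_tmul, ← map_smul, smul_eq_mul, mul_one]
  exact hk.of_retract (LinearMap.pi I) P (LinearMap.congr_fun key)

end TensorFree

section Presentation

variable {R : Type u} [CommRing R] [IsNoetherianRing R] {A : Type u} [Ring A] [Algebra R A]
variable {M : Type u} [AddCommGroup M] [Module R M] [Module A M] [IsScalarTower R A M]

/-- One syzygy step that preserves the hypotheses. Since Tor_1 vanishes, the free cover stays short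
exact after tensoring with DM; its right end is `R`-projective, so it splits. The splitting makes DM
⊗ K projective and, by adjunction, extends every map K → M. -/
theorem exists_presentation (hA : IsFGProj R A) (hM : IsFGProj R M) (N : Type u) [AddCommGroup N]
    [Module A N] (hN : Module.Finite A N) (hT : TorVanishes R A (StdDual R M) N)
    (hP : Module.Projective R (BalTensor R A (StdDual R M) N)) :
    ∃ (n : ℕ) (K : Type u) (_ : AddCommGroup K) (_ : Module A K) (f : K →ₗ[A] (Fin n → A))
      (g : (Fin n → A) →ₗ[A] N), Function.Injective f ∧ Function.Surjective g ∧
      Function.Exact f g ∧ Module.Finite A K ∧ TorVanishes R A (StdDual R M) K ∧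
      Module.Projective R (BalTensor R A (StdDual R M) K) ∧
      ∀ a : K →ₗ[A] M, ∃ b : (Fin n → A) →ₗ[A] M, b ∘ₗ f = a := by
  have := hA.1
  have := hM.1
  have := hM.2
  have : IsNoetherianRing A := IsNoetherianRing.of_finite R A
  obtain ⟨n, g, hg⟩ := Module.Finite.exists_fin' A N
  have hfg := LinearMap.exact_subtype_ker_map g
  have hf := Submodule.injective_subtype (LinearMap.ker g)
  obtain ⟨hT₁, hT₂⟩ := (torVanishes_iff hf hg hfg).1 hT
  have := (balTensor_isFGProj_of_inAdd hM.stdDual (InAdd.fin_fun (A := A) n)).2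
  have hg' := BalTensor.map_surjective (R := R) (X := StdDual R M) hg
  have hfg' := BalTensor.map_exact (R := R) (X := StdDual R M) hfg hg
  obtain ⟨r, hr⟩ := exists_retraction_of_projective (R := R) (A := R) hT₁ hg' hfg'
  exact ⟨n, LinearMap.ker g, inferInstance, inferInstance, (LinearMap.ker g).subtype, g, hf, hg,
    hfg, inferInstance, hT₂, projective_left_of_exact (R := R) (A := R) hT₁ hg' hfg',
    exists_extension_of_tensor _ r hr⟩

theorem extVanishes_of_torVanishes (hA : IsFGProj R A) (hM : IsFGProj R M) (i : ℕ) :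
    ∀ (N : Type u) [AddCommGroup N] [Module A N], Module.Finite A N →
      TorVanishes R A (StdDual R M) N →
      Module.Projective R (BalTensor R A (StdDual R M) N) → ExtVanishes A N M (i + 1) := by
  induction i with
  | zero =>
    intro N _ _ hN hT hP
    obtain ⟨n, K, _, _, f, g, hf, hg, hfg, -, -, -, hext⟩ := exists_presentation hA hM N hN hT hP
    exact extVanishes_one_of_extends hf hg hfg (extVanishes_of_projective 0) hext
  | succ i ih =>
    intro N _ _ hN hT hP
    obtain ⟨n, K, _, _, f, g, hf, hg, hfg, hK₁, hK₂, hK₃, -⟩ :=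
      exists_presentation hA hM N hN hT hP
    exact extVanishes_succ_of_left hf hg hfg _ (ih K hK₁ hK₂ hK₃) (extVanishes_of_projective _)

variable {B : Type u} [Ring B] [Module B M] [SMulCommClass A B M] [SMulCommClass B A M]

/-- Hom_A(-, M) is applied to a free resolution one syzygy at a time. The syzygy inherits
reflexivity from `HomReflexive.left`, and its projective dimension bound drops by one. -/
theorem addCores_of_hasProjectiveDimensionLE (hA : IsFGProj R A) (hM : IsFGProj R M)
    (hAM : EndSurjective A B M) (hAM' : ∀ a : A, (∀ x : M, a • x = 0) → a = 0) (k : ℕ) :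
    ∀ (N : Type u) [AddCommGroup N] [Module A N], Module.Finite A N →
      TorVanishes R A (StdDual R M) N →
      Module.Projective R (BalTensor R A (StdDual R M) N) → HomReflexive B A M N →
      HasProjectiveDimensionLE (ModuleCat.of A N) k →
      AddCores B M k (ModuleCat.of B (N →ₗ[A] M)) := by
  induction k with
  | zero =>
    intro N _ _ hN hT hP hR hk
    have : Projective (ModuleCat.of A N) := projective_iff_hasProjectiveDimensionLT_one.2 hk
    have : Module.Projective A N := (IsProjective.iff_projective N).2 this
    exact inAdd_hom_of_inAdd_self M inAdd_of_projective
  | succ k ih =>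
    intro N _ _ hN hT hP hR hk
    obtain ⟨n, K, _, _, f, g, hf, hg, hfg, hK₁, hK₂, hK₃, hext⟩ :=
      exists_presentation hA hM N hN hT hP
    have hF := (homReflexive_self hAM hAM').of_inAdd (InAdd.fin_fun (A := A) n)
    have hKR := HomReflexive.left hf hfg hext hF hR.1
    have hKk : HasProjectiveDimensionLE (ModuleCat.of A K) k := by
      refine (shortExact_of_exact hf hg hfg).hasProjectiveDimensionLT_X₁ (k + 1) ?_ hk
      have : Projective (ModuleCat.of A (Fin n → A)) :=
        (IsProjective.iff_projective (Fin n → A)).1 inferInstance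
      have := projective_iff_hasProjectiveDimensionLT_one.1 this
      exact hasProjectiveDimensionLT_of_ge _ 1 _ (by omega)
    refine ⟨ModuleCat.of B ((Fin n → A) →ₗ[A] M), ModuleCat.of B (K →ₗ[A] M), precomp B M g,
      precomp B M f, inAdd_hom_of_inAdd_self M (InAdd.fin_fun n), precomp_injective hg,
      precomp_surjective hext, precomp_exact hg hfg, fun Ψ => ?_, ih K hK₁ hK₂ hK₃ hKR hKk⟩
    -- A `B`-map Hom_A(N, M) → M is evaluation at a point of `N`. Evaluation at a preimage in A^n
    -- extends it.
    obtain ⟨y, hy⟩ := hR.2 Ψ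
    obtain ⟨z, rfl⟩ := hg y
    exact ⟨{ toFun := fun b => b z, map_add' := fun _ _ => rfl, map_smul' := fun _ _ => rfl },
      LinearMap.ext fun a => (hy a).symm⟩

end Presentation

/-! ### Duals of right modules and the functor D Hom_B(M, -) -/

section DualMap

variable {R : Type u} [CommRing R] {B : Type u} [Ring B] [Algebra R B]
variable {U V W : Type u} [AddCommGroup U] [AddCommGroup V] [AddCommGroup W]
  [Module R U] [Module R V] [Module R W] [Module Bᵐᵒᵖ U] [Module Bᵐᵒᵖ V] [Module Bᵐᵒᵖ W]
  [IsScalarTower R Bᵐᵒᵖ U] [IsScalarTower R Bᵐᵒᵖ V] [IsScalarTower R Bᵐᵒᵖ W]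

variable (R) in
/-- The dual of a map of right `B`-modules, as a map of left `B`-modules. -/
def StdDual.dualMap (h : U →ₗ[Bᵐᵒᵖ] V) : StdDual R V →ₗ[B] StdDual R U where
  toFun φ := LinearMap.comp (show V →ₗ[R] R from φ) (h.restrictScalars R)
  map_add' _ _ := rfl
  map_smul' b φ := StdDual.ext fun x => congrArg φ (h.map_smul (MulOpposite.op b) x).symm

theorem StdDual.dualMap_apply (h : U →ₗ[Bᵐᵒᵖ] V) (φ : StdDual R V) (x : U) :
    StdDual.dualMap R h φ x = φ (h x) := rfl

theorem StdDual.dualMap_injective {h : U →ₗ[Bᵐᵒᵖ] V} (hh : Function.Surjective h) :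
    Function.Injective (StdDual.dualMap R h) := fun φ ψ e => StdDual.ext fun y => by
  obtain ⟨x, rfl⟩ := hh y
  rw [← dualMap_apply, e, dualMap_apply]

theorem StdDual.dualMap_surjective {h : U →ₗ[Bᵐᵒᵖ] V} (r : V →ₗ[R] U) (hr : ∀ x, r (h x) = x) :
    Function.Surjective (StdDual.dualMap R h) := fun φ =>
  ⟨LinearMap.comp (show U →ₗ[R] R from φ) r, StdDual.ext fun x => congrArg φ (hr x)⟩

theorem StdDual.dualMap_exact {f : U →ₗ[Bᵐᵒᵖ] V} {g : V →ₗ[Bᵐᵒᵖ] W} (hg : Function.Surjective g)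
    (hfg : Function.Exact f g) :
    Function.Exact (StdDual.dualMap R g) (StdDual.dualMap R f) := fun φ => by
  constructor
  · intro h
    obtain ⟨ψ, hψ⟩ := exists_factor_of_exact (f := f.restrictScalars R)
      (g := g.restrictScalars R) hg hfg (show V →ₗ[R] R from φ) (fun x => LinearMap.congr_fun h x)
    exact ⟨ψ, hψ⟩
  · rintro ⟨ψ, rfl⟩
    refine StdDual.ext fun x => ?_
    rw [dualMap_apply, dualMap_apply, hfg.apply_apply_eq_zero, StdDual.map_zero]; rfl

end DualMap

section HomFrom

/-- `Hom_B(M, X)` with the right `A`-module structure given by precomposition. -/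
def HomFrom (_A B : Type u) [Ring B] (M X : Type u) [AddCommGroup M] [Module B M]
    [AddCommGroup X] [Module B X] : Type u := M →ₗ[B] X

variable {R : Type u} [CommRing R] {A B : Type u} [Ring A] [Ring B] [Algebra R A] [Algebra R B]
variable {M : Type u} [AddCommGroup M] [Module R M] [Module A M] [Module B M]
  [IsScalarTower R A M] [IsScalarTower R B M] [SMulCommClass A B M] [SMulCommClass B A M]
variable {X Y Z : Type u} [AddCommGroup X] [AddCommGroup Y] [AddCommGroup Z] [Module R X]
  [Module R Y] [Module R Z] [Module B X] [Module B Y] [Module B Z] [IsScalarTower R B X]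
  [IsScalarTower R B Y] [IsScalarTower R B Z]

instance HomFrom.instAddCommGroup : AddCommGroup (HomFrom A B M X) :=
  inferInstanceAs (AddCommGroup (M →ₗ[B] X))

instance HomFrom.instModuleBase : Module R (HomFrom A B M X) :=
  inferInstanceAs (Module R (M →ₗ[B] X))

/-- The action of `a : A` on `M` as a `B`-linear map. -/
def actionMap (B M : Type u) [Ring B] [AddCommGroup M] [Module B M] {A : Type u} [Ring A]
    [Module A M] [SMulCommClass A B M] [SMulCommClass B A M] (a : A) : M →ₗ[B] M where
  toFun x := a • x
  map_add' := smul_add a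
  map_smul' b x := smul_comm a b x

instance HomFrom.instModule : Module Aᵐᵒᵖ (HomFrom A B M X) where
  smul a f := LinearMap.comp (show M →ₗ[B] X from f) (actionMap B M a.unop)
  one_smul f := LinearMap.ext fun x => congrArg (show M →ₗ[B] X from f) (one_smul A x)
  mul_smul a b f := LinearMap.ext fun x =>
    congrArg (show M →ₗ[B] X from f) (mul_smul b.unop a.unop x)
  smul_zero _ := LinearMap.ext fun _ => rfl
  smul_add _ _ _ := LinearMap.ext fun _ => rfl
  add_smul a b f := LinearMap.ext fun x =>
    (congrArg (show M →ₗ[B] X from f) (add_smul a.unop b.unop x)).trans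
      (map_add (show M →ₗ[B] X from f) _ _)
  zero_smul f := LinearMap.ext fun x =>
    (congrArg (show M →ₗ[B] X from f) (zero_smul A x)).trans
      (map_zero (show M →ₗ[B] X from f))

instance HomFrom.instTower : IsScalarTower R Aᵐᵒᵖ (HomFrom A B M X) where
  smul_assoc r a f := LinearMap.ext fun x =>
    (congrArg (show M →ₗ[B] X from f) (smul_assoc r a.unop x)).trans
      (LinearMap.map_smul_of_tower (show M →ₗ[B] X from f) r _)

variable (A) in
/-- A `B`-linear map `M → X` as an element of `HomFrom`. -/
def HomFrom.mk (f : M →ₗ[B] X) : HomFrom A B M X := f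

/-- The `B`-linear map underlying an element of `HomFrom`. -/
def HomFrom.hom (f : HomFrom A B M X) : M →ₗ[B] X := f

theorem HomFrom.ext {f g : HomFrom A B M X} (h : ∀ x, f.hom x = g.hom x) : f = g :=
  LinearMap.ext h

variable (A M) in
/-- Postcomposition as a map of right `A`-modules. -/
def HomFrom.map (g : X →ₗ[B] Y) : HomFrom A B M X →ₗ[Aᵐᵒᵖ] HomFrom A B M Y where
  toFun f := HomFrom.mk A (g ∘ₗ f.hom)
  map_add' f f' := HomFrom.ext fun x => map_add g (f.hom x) (f'.hom x)
  map_smul' _ _ := rfl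

theorem HomFrom.map_injective {g : X →ₗ[B] Y} (hg : Function.Injective g) :
    Function.Injective (HomFrom.map A M g) := fun _ _ h =>
  HomFrom.ext fun x => hg (LinearMap.congr_fun h x)

theorem HomFrom.map_surjective {g : X →ₗ[B] Y}
    (h : ∀ a : M →ₗ[B] Y, ∃ b : M →ₗ[B] X, g ∘ₗ b = a) :
    Function.Surjective (HomFrom.map A M g) := h

theorem HomFrom.map_exact {f : X →ₗ[B] Y} {g : Y →ₗ[B] Z} (hf : Function.Injective f)
    (hfg : Function.Exact f g) : Function.Exact (HomFrom.map A M f) (HomFrom.map A M g) := fun a =>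
  ⟨fun h => exists_corestrict_of_exact hf hfg a.hom (LinearMap.congr_fun h), by
    rintro ⟨b, rfl⟩
    exact HomFrom.ext fun x => hfg.apply_apply_eq_zero (b.hom x)⟩

/-! ### Duals of `Hom_B(M, X)` for `X` in `add M` -/

section AddM

variable (hA : EndSurjective A B M) (hA' : ∀ a : A, (∀ x : M, a • x = 0) → a = 0)
include hA hA'

theorem exists_endInverse : ∃ e : (M →ₗ[B] M) → A, (∀ f x, e f • x = f x) ∧
    ∀ f a, (∀ x, a • x = f x) → e f = a := by
  choose e he using hA
  exact ⟨e, fun f x => (he f x).symm, fun f a h =>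
    sub_eq_zero.1 (hA' _ fun x => by rw [sub_smul, ← he, h, sub_self])⟩

/-- Hom_B(M, M) = A as a right module as well, so Hom_B(M, -) sends add M to add of the regular
right `A`-module. -/
theorem exists_retract_homFrom (h : InAdd B M X) :
    ∃ (k : ℕ) (i : Fin k → HomFrom A B M X →ₗ[Aᵐᵒᵖ] A) (p : Fin k → A →ₗ[Aᵐᵒᵖ] HomFrom A B M X),
      ∀ f, ∑ l, p l (i l f) = f := by
  obtain ⟨k, i, p, hpi⟩ := h.exists_components
  obtain ⟨e, he, he'⟩ := exists_endInverse hA hA'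
  refine ⟨k, fun l =>
    { toFun := fun f => e (i l ∘ₗ f.hom)
      map_add' := fun f g => he' _ _ fun x => by
        rw [add_smul, he, he]
        exact (map_add (i l) (f.hom x) (g.hom x)).symm
      map_smul' := fun a f => he' _ _ fun x => by
        change (e (i l ∘ₗ f.hom) * a.unop) • x = _
        rw [mul_smul, he]; rfl },
    fun l =>
    { toFun := fun a => HomFrom.mk A (p l ∘ₗ actionMap B M a)
      map_add' := fun a a' => HomFrom.ext fun x =>
        (congrArg (p l) (add_smul a a' x)).trans (map_add (p l) _ _)
      map_smul' := fun a a' => HomFrom.ext fun x => congrArg (p l) (mul_smul a' a.unop x) },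
    fun f => ?_⟩
  refine HomFrom.ext fun x => ?_
  refine (LinearMap.sum_apply _ (fun l => p l ∘ₗ actionMap B M (e (i l ∘ₗ f.hom))) x).trans ?_
  rw [← hpi (f.hom x)]
  exact Finset.sum_congr rfl fun l _ => congrArg (p l) (he _ x)

theorem isFGProj_homFrom_of_inAdd (hAR : IsFGProj R A) (h : InAdd B M X) :
    IsFGProj R (HomFrom A B M X) := by
  obtain ⟨k, i, p, hpi⟩ := exists_retract_homFrom hA hA' h
  have := hAR.1
  have := hAR.2
  have hk : IsFGProj R (Fin k → A) := ⟨inferInstance, projective_fin_fun k⟩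
  refine hk.of_retract (LinearMap.pi fun l => (i l).restrictScalars R)
    (∑ l, (p l).restrictScalars R ∘ₗ LinearMap.proj l) fun f => ?_
  simpa [LinearMap.sum_apply] using hpi f

theorem relInjective_dual_homFrom (h : InAdd B M X) :
    RelInjective R A (StdDual R (HomFrom A B M X)) := by
  obtain ⟨k, i, p, hpi⟩ := exists_retract_homFrom hA hA' h
  refine ((relInjective_stdDual (R := R) (A := A)).pi k).of_retract
    (LinearMap.pi fun l => StdDual.dualMap R (p l))
    (∑ l, StdDual.dualMap R (i l) ∘ₗ LinearMap.proj l) (LinearMap.ext fun φ => ?_)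
  refine StdDual.ext fun f => ?_
  rw [LinearMap.comp_apply, LinearMap.sum_apply, StdDual.sum_apply]
  conv_rhs => rw [← hpi f, StdDual.map_sum]
  rfl

/-- D Hom_B(M, -) makes 0 → Y → M₀ → X → 0 into a short exact sequence in the reverse order with
relatively injective middle term. Dualizing stays exact because Hom_B(M, X) is `R`-projective, so
the Hom sequence splits over `R`. -/
theorem AddRes.relIDimLE [IsNoetherianRing R] (hAR : IsFGProj R A) {k : ℕ} :
    ∀ {X : ModuleCat.{u} B} [Module R X] [IsScalarTower R B X],
      AddRes B M k X → Module.Projective R (HomFrom A B M X) →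
      RelIDimLE R A (StdDual R (HomFrom A B M X)) k := by
  induction k with
  | zero =>
    intro X _ _ h _
    exact (relInjective_dual_homFrom hA hA' h).relIDimLE hAR 0
  | succ k ih =>
    rintro X _ _ ⟨Y, M₀, f, g, hM, hf, hg, hfg, hh, hY⟩ hX
    let _ := restrictModule R B M₀
    have := restrictModule_tower R (S := B) M₀
    let _ := restrictModule R B Y
    have := restrictModule_tower R (S := B) Y
    have hf' := HomFrom.map_injective (A := A) (M := M) hf
    have hg' := HomFrom.map_surjective (A := A) hh
    have hfg' := HomFrom.map_exact (A := A) (M := M) hf hfg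
    have := (isFGProj_homFrom_of_inAdd (R := R) hA hA' hAR hM).2
    obtain ⟨r, hr⟩ := exists_retraction_of_projective (R := R) hf' hg' hfg'
    exact RelIDimLE.succ hAR (relInjective_dual_homFrom hA hA' hM)
      (StdDual.dualMap_injective hg') (StdDual.dualMap_surjective r hr)
      (StdDual.dualMap_exact hg' hfg')
      (ih hY (projective_left_of_exact (R := R) hf' hg' hfg'))

end AddM

end HomFrom

/-! ### Copresentations by copies of DA and the functor D Hom_A(M, -) -/

section Coinduced

variable {R : Type u} [CommRing R] {A B : Type u} [Ring A] [Ring B] [Algebra R A] [Algebra R B]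
variable {M : Type u} [AddCommGroup M] [Module R M] [Module A M] [Module B M]
  [IsScalarTower R A M] [IsScalarTower R B M] [SMulCommClass A B M] [SMulCommClass B A M]
variable {I E J : Type u} [AddCommGroup I] [Module R I] [Module A I] [IsScalarTower R A I]
  [AddCommGroup E] [Module R E] [Module A E] [IsScalarTower R A E]
  [AddCommGroup J] [Module R J] [Module A J] [IsScalarTower R A J]

variable (A) in
/-- A functional on `M` as an `A`-linear map `M → DA`. -/
def coev (φ : StdDual R M) : M →ₗ[A] StdDual R A where
  toFun x := LinearMap.comp (show M →ₗ[R] R from φ)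
    ((LinearMap.toSpanSingleton A M x).restrictScalars R)
  map_add' x y := StdDual.ext fun a => (congrArg φ (smul_add a x y)).trans (φ.map_add _ _)
  map_smul' c x := StdDual.ext fun a => congrArg φ (mul_smul a c x).symm

/-- An `A`-linear map `M → DA` as a functional on `M`. -/
def evalOne (f : M →ₗ[A] StdDual R A) : StdDual R M where
  toFun x := f x 1
  map_add' x y := by rw [map_add]; rfl
  map_smul' r x := by rw [LinearMap.map_smul_of_tower]; rfl

theorem evalOne_apply (f : M →ₗ[A] StdDual R A) (x : M) : evalOne f x = f x 1 := rfl

theorem evalOne_smul (f : M →ₗ[A] StdDual R A) (a : A) (x : M) : evalOne f (a • x) = f x a := by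
  rw [evalOne_apply, map_smul, StdDual.smul_apply]
  exact congrArg (f x) (one_mul a)

theorem coev_evalOne (f : M →ₗ[A] StdDual R A) : coev A (evalOne f) = f :=
  LinearMap.ext fun x => StdDual.ext fun a => evalOne_smul f a x

variable (B) in
/-- A functional on `I` as a `B`-linear map `M → D Hom_A(M, I)`. -/
def evalDual (ψ : StdDual R I) : M →ₗ[B] StdDual R (HomFrom B A M I) where
  toFun x := show HomFrom B A M I →ₗ[R] R from
    { toFun := fun f => ψ (f.hom x)
      map_add' := fun f g => ψ.map_add (f.hom x) (g.hom x)
      map_smul' := fun r f => ψ.map_smul r (f.hom x) }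
  map_add' x y := StdDual.ext fun f =>
    (congrArg ψ (map_add f.hom x y)).trans (ψ.map_add _ _)
  map_smul' _ _ := rfl

variable (R A B M I) in
/-- The natural map `DI → Hom_B(M, D Hom_A(M, I))` is bijective. -/
def DualReflexive : Prop :=
  (∀ ψ : StdDual R I, (∀ (x : M) (f : M →ₗ[A] I), ψ (f x) = 0) → ψ = 0) ∧
    ∀ h : M →ₗ[B] StdDual R (HomFrom B A M I), ∃ ψ : StdDual R I, h = evalDual B ψ

/-- Coinduction: Hom_A(M, DA) is DM, by evaluation at 1. -/
theorem isFGProj_homFrom_of_inAdd_dual (hM : IsFGProj R M) (h : InAdd A (StdDual R A) I) :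
    IsFGProj R (HomFrom B A M I) := by
  obtain ⟨k, i, p, hpi⟩ := h.exists_components
  have := hM.stdDual.1
  have := hM.stdDual.2
  have hk : IsFGProj R (Fin k → StdDual R M) := ⟨inferInstance, projective_fin_fun k⟩
  refine hk.of_retract
    { toFun := fun f l => evalOne (i l ∘ₗ f.hom)
      map_add' := fun f g => funext fun l => StdDual.ext fun x => by
        change i l (f.hom x + g.hom x) 1 = _
        rw [map_add]; rfl
      map_smul' := fun r f => funext fun l => StdDual.ext fun x => by
        change i l (r • f.hom x) 1 = _
        rw [LinearMap.map_smul_of_tower]; rfl }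
    { toFun := fun φ => HomFrom.mk B (∑ l, p l ∘ₗ coev A (φ l))
      map_add' := fun φ ψ => HomFrom.ext fun x => by
        change (∑ l, p l ∘ₗ coev A (φ l + ψ l)) x =
          (∑ l, p l ∘ₗ coev A (φ l)) x + (∑ l, p l ∘ₗ coev A (ψ l)) x
        rw [LinearMap.sum_apply, LinearMap.sum_apply, LinearMap.sum_apply,
          ← Finset.sum_add_distrib]
        exact Finset.sum_congr rfl fun l _ => map_add (p l) (coev A (φ l) x) (coev A (ψ l) x)
      map_smul' := fun r φ => HomFrom.ext fun x => by
        change (∑ l, p l ∘ₗ coev A (r • φ l)) x = r • (∑ l, p l ∘ₗ coev A (φ l)) x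
        rw [LinearMap.sum_apply, LinearMap.sum_apply, Finset.smul_sum]
        exact Finset.sum_congr rfl fun l _ =>
          LinearMap.map_smul_of_tower (p l) r (coev A (φ l) x) } fun f => HomFrom.ext fun x => ?_
  change (∑ l, p l ∘ₗ coev A (evalOne (i l ∘ₗ f.hom))) x = f.hom x
  rw [LinearMap.sum_apply]
  conv_rhs => rw [← hpi (f.hom x)]
  exact Finset.sum_congr rfl fun l _ => by rw [coev_evalOne]; rfl

/-- For I = DA the module D Hom_A(M, DA) is the double dual of `M`, hence `M`. In general, the
component `q l χ` is the point of `M` at which evaluation is φ ↦ χ (p l ∘ coev φ). -/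
theorem inAdd_dual_homFrom (hM : IsFGProj R M) (h : InAdd A (StdDual R A) I) :
    InAdd B M (StdDual R (HomFrom B A M I)) := by
  obtain ⟨k, i, p, hpi⟩ := h.exists_components
  have := hM.1
  have := hM.2
  have hq : ∀ (l : Fin k) (χ : StdDual R (HomFrom B A M I)), ∃ m : M, ∀ φ : StdDual R M,
      φ m = χ (HomFrom.mk B (p l ∘ₗ coev A φ)) := fun l χ =>
    exists_eval_eq (R := R) (M := M)
      { toFun := fun φ => χ (HomFrom.mk B (p l ∘ₗ coev A φ))
        map_add' := fun φ φ' => by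
          rw [← StdDual.map_add]
          exact congrArg χ (HomFrom.ext fun x => map_add (p l) (coev A φ x) (coev A φ' x))
        map_smul' := fun r φ => by
          refine Eq.trans ?_ (StdDual.map_smul χ r _)
          exact congrArg χ (HomFrom.ext fun x =>
            LinearMap.map_smul_of_tower (p l) r (coev A φ x)) }
  choose q hq using hq
  refine InAdd.of_components (k := k)
    (fun l =>
      { toFun := q l
        map_add' := fun χ χ' => eq_of_forall_dual (R := R) fun φ => by
          rw [StdDual.map_add, hq, hq, hq]; rfl
        map_smul' := fun b χ => eq_of_forall_dual (R := R) fun φ => by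
          have h₁ : φ (b • q l χ) = (MulOpposite.op b • φ : StdDual R M) (q l χ) := rfl
          rw [RingHom.id_apply, h₁, hq, hq, StdDual.smul_apply]
          refine congrArg χ (HomFrom.ext fun x => ?_)
          refine congrArg (p l) (StdDual.ext fun a => ?_)
          exact congrArg φ (smul_comm a b x) })
    (fun l => evalDual B (evalOne (i l))) fun χ => StdDual.ext fun f => ?_
  rw [StdDual.sum_apply]
  have h₁ : ∀ l, evalDual B (evalOne (i l)) (q l χ) f =
      χ (HomFrom.mk B (p l ∘ₗ i l ∘ₗ f.hom)) := fun l => by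
    have h₂ := hq l χ (evalOne (i l ∘ₗ f.hom))
    rw [coev_evalOne] at h₂
    exact h₂
  refine (Finset.sum_congr rfl fun l _ => h₁ l).trans ?_
  rw [← StdDual.map_sum]
  refine congrArg χ (HomFrom.ext fun x => ?_)
  refine (LinearMap.sum_apply _ (fun l => p l ∘ₗ i l ∘ₗ f.hom) x).trans ?_
  exact hpi (f.hom x)

/-- For I = DA, both DI and Hom_B(M, D Hom_A(M, I)) are `A`: the first by reflexivity of `A` over
`R`, the second because D Hom_A(M, DA) ≅ M and `A` acts on `M` by exactly the `B`-endomorphisms. -/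
theorem dualReflexive_of_inAdd (hAR : IsFGProj R A) (hM : IsFGProj R M)
    (hA : EndSurjective A B M) (hA' : ∀ a : A, (∀ x : M, a • x = 0) → a = 0)
    (h : InAdd A (StdDual R A) I) : DualReflexive R A B M I := by
  obtain ⟨k, i, p, hpi⟩ := h.exists_components
  have := hM.1
  have := hM.2
  have := hAR.1
  have := hAR.2
  constructor
  · intro ψ hψ
    have ha : ∀ l, ∃ a : A, ∀ θ : StdDual R A, θ a = ψ (p l θ) := fun l =>
      exists_eval_eq (R := R) (M := A)
        { toFun := fun θ => ψ (p l θ)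
          map_add' := fun θ θ' => by rw [map_add, StdDual.map_add]
          map_smul' := fun r θ => by
            rw [LinearMap.map_smul_of_tower, StdDual.map_smul]; rfl }
    choose a ha using ha
    have ha₀ : ∀ l, a l = 0 := fun l => hA' _ fun x => eq_zero_of_forall_dual (R := R) fun φ =>
      (ha l (coev A φ x)).trans (hψ x (p l ∘ₗ coev A φ))
    refine StdDual.ext fun y => ?_
    rw [← hpi y, StdDual.map_sum]
    refine Finset.sum_eq_zero fun l _ => ?_
    rw [← ha, ha₀, StdDual.map_zero]
  · intro h
    have hF : ∀ (l : Fin k) (x : M), ∃ m : M, ∀ φ : StdDual R M,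
        φ m = h x (HomFrom.mk B (p l ∘ₗ coev A φ)) := fun l x =>
      exists_eval_eq (R := R) (M := M)
        { toFun := fun φ => h x (HomFrom.mk B (p l ∘ₗ coev A φ))
          map_add' := fun φ φ' => by
            rw [← StdDual.map_add]
            exact congrArg (h x)
              (HomFrom.ext fun y => map_add (p l) (coev A φ y) (coev A φ' y))
          map_smul' := fun r φ => by
            refine Eq.trans ?_ (StdDual.map_smul (h x) r _)
            exact congrArg (h x) (HomFrom.ext fun y =>
              LinearMap.map_smul_of_tower (p l) r (coev A φ y)) }
    choose F hF using hF
    -- The l-th component of `h` is a `B`-endomorphism of `M`, hence the action of some a l. The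
    -- functional sought evaluates the l-th coordinate at a l.
    have ha : ∀ l, ∃ a : A, ∀ x, F l x = a • x := fun l => hA
      { toFun := F l
        map_add' := fun x y => eq_of_forall_dual (R := R) fun φ => by
          rw [StdDual.map_add, hF, hF, hF, map_add]; rfl
        map_smul' := fun b x => eq_of_forall_dual (R := R) fun φ => by
          have h₁ : φ (b • F l x) = (MulOpposite.op b • φ : StdDual R M) (F l x) := rfl
          rw [RingHom.id_apply, h₁, hF, hF, map_smul, StdDual.smul_apply]
          refine congrArg (h x) (HomFrom.ext fun y => ?_)
          refine congrArg (p l) (StdDual.ext fun a => ?_)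
          exact congrArg φ (smul_comm a b y) }
    choose a ha using ha
    let ψ : StdDual R I :=
      { toFun := fun y => ∑ l, i l y (a l)
        map_add' := fun y y' => by
          rw [← Finset.sum_add_distrib]
          exact Finset.sum_congr rfl fun l _ => by rw [map_add]; rfl
        map_smul' := fun r y => by
          rw [RingHom.id_apply, Finset.smul_sum]
          exact Finset.sum_congr rfl fun l _ => by rw [LinearMap.map_smul_of_tower]; rfl }
    refine ⟨ψ, LinearMap.ext fun x => StdDual.ext fun f => ?_⟩
    have h₁ : ∀ l, i l (f.hom x) (a l) = h x (HomFrom.mk B (p l ∘ₗ i l ∘ₗ f.hom)) := fun l => by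
      have h₂ := hF l x (evalOne (i l ∘ₗ f.hom))
      rw [coev_evalOne, ha, evalOne_smul] at h₂
      exact h₂
    change h x f = ∑ l, i l (f.hom x) (a l)
    rw [Finset.sum_congr rfl fun l _ => h₁ l, ← StdDual.map_sum]
    refine congrArg (h x) (HomFrom.ext fun y => ?_)
    refine Eq.trans ?_ (LinearMap.sum_apply _ (fun l => p l ∘ₗ i l ∘ₗ f.hom) y).symm
    exact (hpi (f.hom y)).symm

/-- The mirror image of `HomReflexive.left`. Transported to `E`, `h` comes from a functional `ψ`; it
vanishes on the values of all maps f ∘ a, since g ∘ f = 0, so `hI` makes it vanish on `I` and it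
descends to `J`. -/
theorem DualReflexive.right {f : I →ₗ[A] E} {g : E →ₗ[A] J}
    (hg : Function.Surjective g) (hfg : Function.Exact f g)
    (hh : ∀ a : M →ₗ[A] J, ∃ b : M →ₗ[A] E, g ∘ₗ b = a)
    (hE : DualReflexive R A B M E) (hI : ∀ ψ : StdDual R I,
      (∀ (x : M) (a : M →ₗ[A] I), ψ (a x) = 0) → ψ = 0) : DualReflexive R A B M J := by
  constructor
  · intro ψ hψ
    let ψ' : StdDual R E := LinearMap.comp (show J →ₗ[R] R from ψ) (g.restrictScalars R)
    have h₀ : ψ' = 0 := hE.1 ψ' fun x a => hψ x (g ∘ₗ a)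
    refine StdDual.ext fun z => ?_
    obtain ⟨y, rfl⟩ := hg z
    exact LinearMap.congr_fun h₀ y
  · intro h
    obtain ⟨ψ, hψ⟩ := hE.2 (StdDual.dualMap R (HomFrom.map B M g) ∘ₗ h)
    have hψ' : ∀ x (a : M →ₗ[A] E), h x (HomFrom.mk B (g ∘ₗ a)) = ψ (a x) := fun x a =>
      LinearMap.congr_fun (LinearMap.congr_fun hψ x) (HomFrom.mk B a)
    let ψ₀ : StdDual R I := LinearMap.comp (show E →ₗ[R] R from ψ) (f.restrictScalars R)
    have h₀ : ψ₀ = 0 := hI ψ₀ fun x a => by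
      refine (hψ' x (f ∘ₗ a)).symm.trans ?_
      have : HomFrom.mk B (g ∘ₗ f ∘ₗ a) = 0 :=
        HomFrom.ext fun y => hfg.apply_apply_eq_zero (a y)
      rw [this, StdDual.map_zero]
    obtain ⟨ψ₁, hψ₁⟩ := exists_factor_of_exact (f := f.restrictScalars R)
      (g := g.restrictScalars R) hg hfg (show E →ₗ[R] R from ψ) (LinearMap.congr_fun h₀)
    refine ⟨ψ₁, LinearMap.ext fun x => StdDual.ext fun a => ?_⟩
    obtain ⟨b, hb⟩ := hh a.hom
    have : a = HomFrom.mk B (g ∘ₗ b) := hb.symm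
    rw [this, hψ']
    exact (LinearMap.congr_fun hψ₁ (b x)).symm

/-- The functionals of an `R`-dual basis of `I` coinduce to `A`-maps I → DA. Evaluating at 1 and
recombining with the basis vectors is an `R`-retraction, so the cokernel is `R`-projective. -/
theorem exists_copresentation (hAR : IsFGProj R A) (hI : IsFGProj R I) :
    ∃ (n : ℕ) (J : Type u) (_ : AddCommGroup J) (_ : Module R J) (_ : Module A J)
      (_ : IsScalarTower R A J) (f : I →ₗ[A] (Fin n → StdDual R A))
      (g : (Fin n → StdDual R A) →ₗ[A] J) (r : (Fin n → StdDual R A) →ₗ[R] I),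
      Function.Injective f ∧ Function.Surjective g ∧ Function.Exact f g ∧ (∀ x, r (f x) = x) ∧
      IsFGProj R J := by
  have := hI.1
  have := hI.2
  obtain ⟨n, x, φ, hx⟩ := exists_dualBasis (R := R) (M := I)
  let f : I →ₗ[A] (Fin n → StdDual R A) := LinearMap.pi fun l => coev A (φ l)
  let r : (Fin n → StdDual R A) →ₗ[R] I :=
    { toFun := fun θ => ∑ l, θ l 1 • x l
      map_add' := fun θ θ' => by
        rw [← Finset.sum_add_distrib]
        exact Finset.sum_congr rfl fun l _ => by rw [← add_smul]; rfl
      map_smul' := fun c θ => by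
        rw [RingHom.id_apply, Finset.smul_sum]
        exact Finset.sum_congr rfl fun l _ => by rw [smul_smul]; rfl }
  have hr : ∀ y, r (f y) = y := fun y => by
    refine Eq.trans ?_ (hx y)
    change ∑ l, coev A (φ l) y 1 • x l = _
    refine Finset.sum_congr rfl fun l _ => ?_
    change φ l ((1 : A) • y) • x l = _
    rw [one_smul]
  have hfg : Function.Exact f (LinearMap.range f).mkQ := LinearMap.exact_map_mkQ_range f
  have hg := Submodule.mkQ_surjective (LinearMap.range f)
  have := hAR.stdDual.1
  have := hAR.stdDual.2
  have := projective_fin_fun (R := R) (P := StdDual R A) n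
  refine ⟨n, (Fin n → StdDual R A) ⧸ LinearMap.range f, inferInstance, inferInstance,
    inferInstance, inferInstance, f, (LinearMap.range f).mkQ, r,
    Function.LeftInverse.injective hr, hg, hfg, hr,
    Module.Finite.of_surjective ((LinearMap.range f).mkQ.restrictScalars R) hg,
    projective_right_of_retraction hg hfg hr⟩

/-- At k = 0, Ext¹(J, I) = 0 extends the identity of `I`, so `I` is a summand of copies of DA. In
the step, Ext¹(M, I) = 0 keeps Hom_A(M, -) exact on the copresentation, and the cokernel inherits
all hypotheses with the dimension lowered by one. -/
theorem addRes_of_relIDimLE [IsNoetherianRing R] (hAR : IsFGProj R A) (hM : IsFGProj R M)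
    (hA : EndSurjective A B M) (hA' : ∀ a : A, (∀ x : M, a • x = 0) → a = 0) (k : ℕ) :
    ∀ (I : Type u) [AddCommGroup I] [Module R I] [Module A I] [IsScalarTower R A I],
      IsFGProj R I → RelIDimLE R A I k → (∀ i, ExtVanishes A M I (i + 1)) →
      DualReflexive R A B M I →
      IsFGProj R (HomFrom B A M I) ∧
        AddRes B M k (ModuleCat.of B (StdDual R (HomFrom B A M I))) := by
  induction k with
  | zero =>
    intro I _ _ _ _ hI hk hE hR
    obtain ⟨n, J, _, _, _, _, f, g, r, hf, hg, hfg, hr, hJ⟩ := exists_copresentation hAR hI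
    have := hJ.1
    obtain ⟨s, hs⟩ := extends_of_extVanishes_one hf hg hfg
      (hk J (Module.Finite.of_restrictScalars_finite R A J) hJ.2) LinearMap.id
    have : InAdd A (StdDual R A) I := ⟨n, f, s, hs⟩
    exact ⟨isFGProj_homFrom_of_inAdd_dual hM this, inAdd_dual_homFrom hM this⟩
  | succ k ih =>
    intro I _ _ _ _ hI hk hE hR
    obtain ⟨n, J, _, _, _, _, f, g, r, hf, hg, hfg, hr, hJ⟩ := exists_copresentation hAR hI
    have hadd : InAdd A (StdDual R A) (Fin n → StdDual R A) := InAdd.pi n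
    have hinj : RelInjective R A (Fin n → StdDual R A) := relInjective_stdDual.pi n
    have hh := lifts_of_extVanishes_one (M := M) hf hg hfg (hE 0)
    have := hM.1
    have hMA : Module.Finite A M := Module.Finite.of_restrictScalars_finite R A M
    have hEr := dualReflexive_of_inAdd hAR hM hA hA' hadd
    obtain ⟨h₁, h₂⟩ := ih J hJ (hk.of_succ hAR hinj hf hg hfg)
      (fun i => extVanishes_right_of_succ hf hg hfg (i + 1) (hE (i + 1))
        (extVanishes_of_relInjective hAR hinj i M hMA hM.2))
      (hEr.right hg hfg hh hR.1)
    have hf' := HomFrom.map_injective (A := B) (M := M) hf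
    have hg' := HomFrom.map_surjective (A := B) hh
    have hfg' := HomFrom.map_exact (A := B) (M := M) hf hfg
    have := h₁.2
    obtain ⟨r', hr'⟩ := exists_retraction_of_projective (R := R) hf' hg' hfg'
    refine ⟨(isFGProj_homFrom_of_inAdd_dual hM hadd).of_retract
        ((HomFrom.map B M f).restrictScalars R) r' hr',
      ModuleCat.of B (StdDual R (HomFrom B A M J)),
      ModuleCat.of B (StdDual R (HomFrom B A M (Fin n → StdDual R A))),
      StdDual.dualMap R (HomFrom.map B M g), StdDual.dualMap R (HomFrom.map B M f),
      inAdd_dual_homFrom hM hadd, StdDual.dualMap_injective hg',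
      StdDual.dualMap_surjective r' hr', StdDual.dualMap_exact hg' hfg', fun h => ?_, h₂⟩
    -- By reflexivity the map to be lifted comes from a functional on `I`, which extends to the
    -- copies of DA along the `R`-retraction `r`.
    obtain ⟨ψ, rfl⟩ := hR.2 h
    refine ⟨evalDual B (show StdDual R (Fin n → StdDual R A) from
      LinearMap.comp (show I →ₗ[R] R from ψ) r), LinearMap.ext fun x => StdDual.ext fun a => ?_⟩
    exact congrArg ψ (hr (a.hom x))

end Coinduced

/-! ### Exchanging the factors of a balanced tensor product -/

section Swap

variable {R : Type u} [CommRing R] {A : Type u} [Ring A] [Algebra R A]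

theorem BalTensor.tmul_smul {X Y : Type u} [AddCommGroup X] [Module R X] [Module Aᵐᵒᵖ X]
    [IsScalarTower R Aᵐᵒᵖ X] [AddCommGroup Y] [Module R Y] [Module A Y] [IsScalarTower R A Y]
    (r : R) (x : X) (y : Y) :
    BalTensor.tmul R A x (r • y) = r • BalTensor.tmul R A x y := by
  rw [← algebraMap_smul A r y, ← BalTensor.op_smul_tmul, ← BalTensor.smul_tmul]
  congr 1
  exact algebraMap_smul Aᵐᵒᵖ r x

/-- Functoriality of `X ⊗_A -` for isomorphisms. -/
noncomputable def BalTensor.congr {X Y Z : Type u} [AddCommGroup X] [Module R X] [Module Aᵐᵒᵖ X]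
    [AddCommGroup Y] [Module A Y] [AddCommGroup Z] [Module A Z] (e : Y ≃ₗ[A] Z) :
    BalTensor R A X Y ≃ₗ[R] BalTensor R A X Z :=
  LinearEquiv.ofLinearMap (BalTensor.map R A X e.toLinearMap) (BalTensor.map R A X e.symm.toLinearMap)
    (by rw [← BalTensor.map_comp, e.comp_symm, BalTensor.map_id])
    (by rw [← BalTensor.map_comp, e.symm_comp, BalTensor.map_id])

variable {B : Type u} [Ring B] [Algebra R B] {M : Type u} [AddCommGroup M] [Module R M]
  [Module Bᵐᵒᵖ M] [IsScalarTower R Bᵐᵒᵖ M]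

variable (R B M) in
/-- `M ⊗_B DM` is isomorphic to `DM ⊗ M` over the opposite algebra. -/
noncomputable def balTensorSwap :
    BalTensor R B M (StdDual R M) ≃ₗ[R] BalTensor R Bᵐᵒᵖ (StdDual R M) M :=
  LinearEquiv.ofLinearMap
    (BalTensor.lift (fun x φ => BalTensor.tmul R Bᵐᵒᵖ φ x) (fun _ _ _ => BalTensor.tmul_add _ _ _)
      (fun _ _ _ => BalTensor.tmul_smul _ _ _) (fun _ _ _ => BalTensor.add_tmul _ _ _)
      (fun x b φ => (BalTensor.op_smul_tmul (MulOpposite.op b) φ x).symm))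
    (BalTensor.lift (fun φ x => BalTensor.tmul R B x φ) (fun _ _ _ => BalTensor.tmul_add _ _ _)
      (fun _ _ _ => BalTensor.tmul_smul _ _ _) (fun _ _ _ => BalTensor.add_tmul _ _ _)
      (fun φ b x => (BalTensor.op_smul_tmul b.unop x φ).symm))
    (BalTensor.hom_ext _ _ _ fun _ _ => rfl) (BalTensor.hom_ext _ _ _ fun _ _ => rfl)

end Swap

/-! ### Dominant dimension and the double centralizer property -/

section DominantDimension

variable {R : Type u} [CommRing R] {A B : Type u} [Ring A] [Ring B] [Algebra R A] [Algebra R B]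
variable {M : Type u} [AddCommGroup M] [Module R M] [Module A M] [Module B M]
  [IsScalarTower R A M] [IsScalarTower R B M] [SMulCommClass A B M] [SMulCommClass B A M]

variable (A B M) in
/-- `A` acts faithfully on `M` by all the `B`-endomorphisms. -/
def EndBijective : Prop := EndSurjective A B M ∧ ∀ a : A, (∀ x : M, a • x = 0) → a = 0

/-- The isomorphism `A ≅ End_B(M)`. -/
noncomputable def EndBijective.equiv (h : EndBijective A B M) : A ≃ₗ[A] (M →ₗ[B] M) :=
  LinearEquiv.ofBijective (LinearMap.toSpanSingleton A (M →ₗ[B] M) LinearMap.id)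
    ⟨(injective_iff_map_eq_zero _).2 fun a ha => h.2 a fun x => LinearMap.congr_fun ha x,
      fun f => by
        obtain ⟨a, ha⟩ := h.1 f
        exact ⟨a, LinearMap.ext fun x => (ha x).symm⟩⟩

/-- A `B`-endomorphism `f` commutes with all `A`-endomorphisms of `M`, so it induces a map `F` on C
1 compatible with every map C 1 → M. Every x in `M` is b (d 0 1) for some b, because Hom_A(C 1, M) →
Hom_A(A, M) = M is onto. If F (d 0 1) = d 0 a, then f x = b (F (d 0 1)) = a x. -/
theorem endBijective_of_relDomDimGE (hB : EndSurjective B A M) (h : RelDomDimGE R A M A 2) :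
    EndBijective A B M := by
  obtain ⟨C, _, _, _, _, d, ⟨e⟩, hadd, ⟨hinj, hex, -⟩, ⟨hsurj, -⟩⟩ := h
  replace hinj := hinj (by omega)
  replace hex := hex 0 (by omega)
  replace hsurj := hsurj (by omega)
  obtain ⟨k, i, p, hpi⟩ := (hadd 1 (by omega) (by omega)).exists_components
  obtain ⟨k', i', p', hpi'⟩ := (hadd 2 (by omega) (by omega)).exists_components
  have hx : ∀ x : M, ∃ b : C 1 →ₗ[A] M, b (d 0 (e 1)) = x := fun x => by
    obtain ⟨b, hb⟩ := hsurj ((LinearMap.toSpanSingleton A M x) ∘ₗ e.symm.toLinearMap)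
    refine ⟨b, ?_⟩
    have := LinearMap.congr_fun hb (e 1)
    simpa using this
  constructor
  · intro f
    choose c hc using hB
    have hf : ∀ (u : M →ₗ[A] M) x, f (u x) = u (f x) := fun u x => by
      rw [hc, hc, map_smul]
    let F : C 1 → C 1 := fun y => ∑ l, p l (f (i l y))
    have hF : ∀ (b : C 1 →ₗ[A] M) y, b (F y) = f (b y) := fun b y => by
      conv_rhs => rw [← hpi y, map_sum, map_sum]
      rw [map_sum]
      exact Finset.sum_congr rfl fun l _ => (hf (b ∘ₗ p l) (i l y)).symm
    -- C 2 lies in add M, so vanishing can be tested on maps C 2 → M; on these, `F` turns into `f`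
    -- applied to zero.
    have hd : d 1 (F (d 0 (e 1))) = 0 := by
      rw [← hpi' (d 1 _)]
      refine Finset.sum_eq_zero fun l _ => ?_
      have h₁ := hF (i' l ∘ₗ d 1) (d 0 (e 1))
      rw [LinearMap.comp_apply, LinearMap.comp_apply, hex.apply_apply_eq_zero, map_zero,
        map_zero] at h₁
      rw [h₁, map_zero]
    obtain ⟨y, hy⟩ := (hex _).1 hd
    obtain ⟨a, rfl⟩ := e.surjective y
    refine ⟨a, fun x => ?_⟩
    obtain ⟨b, rfl⟩ := hx x
    rw [← hF, ← hy, ← map_smul, ← map_smul, ← map_smul, smul_eq_mul, mul_one]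
  · intro a ha
    refine e.injective (hinj ?_)
    rw [map_zero, map_zero, ← mul_one a, ← smul_eq_mul, map_smul, map_smul,
      ← hpi (d 0 (e 1)), Finset.smul_sum]
    exact Finset.sum_eq_zero fun l _ => by rw [← map_smul, ha, map_zero]

/-- The evaluation map, with the roles of the two algebras exchanged and X = A, gives DM ⊗_B M ≅ DA.
A functional on C 1 vanishing on `A` factors through `d 1` thanks to the `R`-splitting, and
membership of C 2 in add M then supplies the span condition. -/
theorem isFGProj_tensor_of_relDomDimGE (hA : IsFGProj R A) (hB : EndSurjective B A M)
    (h : RelDomDimGE R A M A 2) : IsFGProj R (BalTensor R B (StdDual R M) M) := by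
  obtain ⟨C, _, _, _, _, d, ⟨e⟩, hadd, ⟨hinj, hex, hsplit⟩, ⟨hsurj, -⟩⟩ := h
  replace hinj := hinj (by omega)
  replace hex := hex 0 (by omega)
  replace hsurj := hsurj (by omega)
  obtain ⟨s, hs⟩ := hsplit 0 (by omega)
  obtain ⟨t, ht⟩ := hsplit 1 (by omega)
  obtain ⟨k, i, p, hpi⟩ := (hadd 2 (by omega) (by omega)).exists_components
  have key : Function.Bijective (tensorHomToDual R B A M A) := by
    refine tensorHomToDual_bijective hB (hadd 1 (by omega) (by omega)) (d 0 ∘ₗ e.toLinearMap)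
      ((e.symm.toLinearMap.restrictScalars R) ∘ₗ s) (fun x => ?_) (fun a => ?_) fun ψ hψ => ?_
    · have : s (d 0 (e x)) = e x := hinj (hs _)
      change e.symm (s (d 0 (e x))) = x
      rw [this, e.symm_apply_apply]
    · obtain ⟨b, hb⟩ := hsurj (a ∘ₗ e.symm.toLinearMap)
      refine ⟨b, LinearMap.ext fun x => ?_⟩
      have := LinearMap.congr_fun hb (e x)
      simpa using this
    · have h₁ : ∀ y, ψ y = ψ (t (d 1 y)) := fun y => by
        obtain ⟨x, hx⟩ := (hex (y - t (d 1 y))).1 (by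
          have := ht y
          rw [map_sub]
          exact sub_eq_zero.2 this.symm)
        obtain ⟨x, rfl⟩ := e.surjective x
        rw [← sub_eq_zero, ← StdDual.map_sub, ← hx]
        exact hψ x
      let χ : Fin k → StdDual R M := fun l =>
        LinearMap.comp (LinearMap.comp (show C 1 →ₗ[R] R from ψ) t) ((p l).restrictScalars R)
      have h₂ : ψ = ∑ l, (χ l).comp (i l ∘ₗ d 1) := StdDual.ext fun y => by
        rw [StdDual.sum_apply, h₁ y]
        conv_lhs => rw [← hpi (d 1 y), map_sum, StdDual.map_sum]
        rfl
      rw [h₂]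
      refine Submodule.sum_mem _ fun l _ => Submodule.subset_span ⟨χ l, i l ∘ₗ d 1, ?_, rfl⟩
      refine LinearMap.ext fun x => ?_
      change i l (d 1 (d 0 (e x))) = 0
      rw [hex.apply_apply_eq_zero, map_zero]
  exact (hA.stdDual.congr (LinearEquiv.ofBijective _ key).symm).congr
    (BalTensor.congr (LinearMap.ringLmapEquivSelf A B M))

/-- The range of `f` is the kernel of a split surjection, hence a projective summand of `V`. A
section onto the range composed with a projection to it splits `f`. -/
theorem exists_regular_of_exact {U V W : Type u} [AddCommGroup U] [AddCommGroup V]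
    [AddCommGroup W] [Module R U] [Module R V] [Module R W] [Module.Projective R V]
    [Module.Projective R W] {f : U →ₗ[R] V} {g : V →ₗ[R] W} (hg : Function.Surjective g)
    (hfg : Function.Exact f g) : ∃ t : V →ₗ[R] U, ∀ x, f (t (f x)) = f x := by
  have hf' := Submodule.injective_subtype (LinearMap.range f)
  have hfg' : Function.Exact (LinearMap.range f).subtype g := fun y =>
    (hfg y).trans ⟨fun h => ⟨⟨y, h⟩, rfl⟩, by rintro ⟨y, rfl⟩; exact y.2⟩
  obtain ⟨r, hr⟩ := exists_retraction_of_projective (R := R) (A := R) hf' hg hfg'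
  have := projective_left_of_exact (R := R) (A := R) hf' hg hfg'
  obtain ⟨s, hs⟩ := exists_section_of_projective (R := R) (A := R)
    (LinearMap.surjective_rangeRestrict f)
  refine ⟨s ∘ₗ r, fun x => ?_⟩
  have h₁ : r (f x) = f.rangeRestrict x := hr (f.rangeRestrict x)
  change f (s (r (f x))) = f x
  rw [h₁]
  exact congrArg Subtype.val (hs (f.rangeRestrict x))

/-- Under Hom_B(-, M) ≅ D(DM ⊗_B -), precomposition with `f` is the dual of DM ⊗ f, so dualizing `t`
splits it. -/
theorem exists_precomp_regular (hM : IsFGProj R M) {F F' : Type u} [AddCommGroup F] [Module B F]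
    [AddCommGroup F'] [Module B F'] (f : F →ₗ[B] F')
    (t : BalTensor R B (StdDual R M) F' →ₗ[R] BalTensor R B (StdDual R M) F)
    (ht : ∀ x, BalTensor.map R B (StdDual R M) f (t (BalTensor.map R B (StdDual R M) f x)) =
      BalTensor.map R B (StdDual R M) f x) :
    ∃ s : (F →ₗ[B] M) →ₗ[R] (F' →ₗ[B] M), ∀ a : F' →ₗ[B] M, s (a ∘ₗ f) ∘ₗ f = a ∘ₗ f := by
  have := hM.1
  have := hM.2
  let D : StdDual R (BalTensor R B (StdDual R M) F) →ₗ[R] StdDual R (BalTensor R B (StdDual R M) F') :=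
    { toFun := fun ψ => LinearMap.comp (show BalTensor R B (StdDual R M) F →ₗ[R] R from ψ) t
      map_add' := fun _ _ => rfl
      map_smul' := fun _ _ => rfl }
  let s := (homEquivDual (R := R) (A := B) (M := M) (N := F')).symm.toLinearMap ∘ₗ D ∘ₗ
    (homEquivDual (R := R) (A := B) (M := M) (N := F)).toLinearMap
  have hs : ∀ (a : F →ₗ[B] M) x, homToDual (R := R) (s a) x = homToDual a (t x) := fun a x =>
    LinearMap.congr_fun ((homEquivDual (R := R) (A := B) (M := M) (N := F')).apply_symm_apply
      (D (homEquivDual a))) x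
  have hmap : ∀ (a : F' →ₗ[B] M) x, homToDual (R := R) (a ∘ₗ f) x =
      homToDual a (BalTensor.map R B (StdDual R M) f x) := fun a x =>
    LinearMap.congr_fun (BalTensor.hom_ext R B (StdDual R M) (f := homToDual (a ∘ₗ f))
      (g := homToDual a ∘ₗ BalTensor.map R B (StdDual R M) f) fun _ _ => rfl) x
  refine ⟨s, fun a => LinearMap.ext fun x => eq_of_forall_dual (R := R) fun φ => ?_⟩
  refine (hs (a ∘ₗ f) (BalTensor.tmul R B φ (f x))).trans ?_
  rw [hmap, ← BalTensor.map_tmul, ht, ← hmap]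
  rfl

/-- The sequence is Hom_B(-, M) applied to B^n' → B^n → M → 0. Applying Hom_A(-, M) recovers this
presentation by reflexivity of B^n and `M`, which gives Hom-exactness. Projectivity of DM ⊗_B M
gives the `R`-splitting. -/
theorem relDomDimGE_two [IsNoetherianRing R] (hB : IsFGProj R B) (hM : IsFGProj R M)
    (hAB : EndBijective A B M) (hBA : EndBijective B A M)
    (hT : Module.Projective R (BalTensor R B (StdDual R M) M)) : RelDomDimGE R A M A 2 := by
  have := hB.1
  have := hM.1
  have := hM.2
  have : IsNoetherianRing B := IsNoetherianRing.of_finite R B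
  have : Module.Finite B M := Module.Finite.of_restrictScalars_finite R B M
  obtain ⟨n, g, hg⟩ := Module.Finite.exists_fin' B M
  obtain ⟨n', g', hg'⟩ := Module.Finite.exists_fin' B (LinearMap.ker g)
  let f : (Fin n' → B) →ₗ[B] (Fin n → B) := (LinearMap.ker g).subtype ∘ₗ g'
  have hfg : Function.Exact f g := fun y =>
    ⟨fun hy => by
      obtain ⟨x, hx⟩ := hg' ⟨y, hy⟩
      exact ⟨x, congrArg Subtype.val hx⟩, by
      rintro ⟨x, rfl⟩
      exact (g' x).2⟩
  have := (balTensor_isFGProj_of_inAdd hM.stdDual (InAdd.fin_fun (A := B) n)).2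
  obtain ⟨t, ht⟩ := exists_regular_of_exact (BalTensor.map_surjective (R := R)
    (X := StdDual R M) hg) (BalTensor.map_exact (R := R) (X := StdDual R M) hfg hg)
  obtain ⟨s, hs⟩ := exists_precomp_regular hM f t ht
  have hF := (homReflexive_self hBA.1 hBA.2).of_inAdd (InAdd.fin_fun (A := B) n)
  have hMr : HomReflexive A B M M := InAdd.homReflexive hAB.1 InAdd.self
  let X := ModuleCat.of A (M →ₗ[B] M)
  let M₁ := ModuleCat.of A ((Fin n → B) →ₗ[B] M)
  let M₂ := ModuleCat.of A ((Fin n' → B) →ₗ[B] M)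
  let d₀ : X →ₗ[A] M₁ := precomp A M g
  let d₁ : M₁ →ₗ[A] M₂ := precomp A M f
  have hinj : Function.Injective d₀ := precomp_injective hg
  have hex : Function.Exact d₀ d₁ := precomp_exact hg hfg
  have hsplit₁ : IsSplitOver R d₁ := by
    refine ⟨s.toAddMonoidHom, fun r y => ?_, fun x => hs x⟩
    have h₁ : ∀ (F : Type u) [AddCommGroup F] [Module B F] (y : F →ₗ[B] M),
        algebraMap R A r • y = r • y := fun F _ _ y =>
      LinearMap.ext fun x => algebraMap_smul A r (y x)
    exact (congrArg s (h₁ _ y)).trans ((map_smul s r y).trans (h₁ _ (s y)).symm)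
  -- The splitting s' of `d₁` suffices: y - s' (d₁ y) lies in the range of `d₀`, and its unique
  -- preimage is the retraction.
  have hsplit₀ : IsSplitOver R d₀ := by
    obtain ⟨s', hs', hd'⟩ := hsplit₁
    have h₁ : ∀ y, ∃ x, d₀ x = y - s' (d₁ y) := fun y =>
      (hex _).1 (by rw [map_sub, hd', sub_self])
    choose r hr using h₁
    refine ⟨AddMonoidHom.mk' r fun y z => hinj ?_, fun c y => hinj ?_, fun x => ?_⟩
    · rw [map_add, hr, hr, hr, map_add, map_add]; abel
    · refine ((hr _).trans ?_).trans (d₀.map_smul _ (r y)).symm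
      rw [hr, map_smul, hs', smul_sub]
    · refine congrArg d₀ (hinj ((hr (d₀ x)).trans ?_) : r (d₀ x) = x)
      rw [hex.apply_apply_eq_zero, map_zero, sub_zero]
  have hsurj : ∀ Ψ : X →ₗ[A] M, ∃ b : M₁ →ₗ[A] M, b ∘ₗ d₀ = Ψ := fun Ψ => by
    obtain ⟨x, hx⟩ := hMr.2 Ψ
    obtain ⟨z, rfl⟩ := hg x
    exact ⟨{ toFun := fun b => b z, map_add' := fun _ _ => rfl, map_smul' := fun _ _ => rfl },
      LinearMap.ext fun a => (hx a).symm⟩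
  have hhom : ∀ Ψ : M₁ →ₗ[A] M, Ψ ∘ₗ d₀ = 0 → ∃ b : M₂ →ₗ[A] M, b ∘ₗ d₁ = Ψ := fun Ψ h => by
    obtain ⟨z, hz⟩ := hF.2 Ψ
    have h₁ : g z = 0 := (hz g).symm.trans (LinearMap.congr_fun h LinearMap.id)
    obtain ⟨w, rfl⟩ := (hfg z).1 h₁
    exact ⟨{ toFun := fun b => b w, map_add' := fun _ _ => rfl, map_smul' := fun _ _ => rfl },
      LinearMap.ext fun a => (hz a).symm⟩
  -- Only the terms up to degree 2 matter; beyond them `M₂` is repeated with zero differentials.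
  let C := consObj X M₁ fun _ => M₂
  let d : ∀ i, C i →ₗ[A] C (i + 1) := consMap d₀ d₁ fun _ => 0
  let _ := fun i => restrictModule R A (C i)
  have := fun i => restrictModule_tower R (S := A) (C i)
  refine ⟨fun i => C i, inferInstance, inferInstance, inferInstance, inferInstance, d,
    ⟨hAB.equiv⟩, fun i h₁ h₂ => ?_, ⟨fun _ => hinj, fun i hi => ?_, fun i hi => ?_⟩,
    fun _ => hsurj, fun i hi => ?_⟩
  · match i, h₁, h₂ with
    | 1, _, _ => exact inAdd_hom_of_inAdd_self M (InAdd.fin_fun n)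
    | 2, _, _ => exact inAdd_hom_of_inAdd_self M (InAdd.fin_fun n')
  · obtain rfl : i = 0 := by omega
    exact hex
  · match i, hi with
    | 0, _ => exact IsSplitOver.exists_linear (f := d 0) hsplit₀
    | 1, _ => exact IsSplitOver.exists_linear (f := d 1) hsplit₁
  · obtain rfl : i = 0 := by omega
    refine fun Ψ => ⟨hhom Ψ, ?_⟩
    rintro ⟨b, rfl⟩
    exact LinearMap.ext fun x => (congrArg b (hex.apply_apply_eq_zero x)).trans (map_zero b)

end DominantDimension

/-! ### Transfer of the invariants -/

section Correspondence

variable {R : Type u} [CommRing R] {A B : Type u} [Ring A] [Ring B] [Algebra R A] [Algebra R B]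
variable {M : Type u} [AddCommGroup M] [Module R M] [Module A M] [Module B M]
  [IsScalarTower R A M] [IsScalarTower R B M] [SMulCommClass A B M] [SMulCommClass B A M]

theorem RelIDimLE.congr {I J : Type u} [AddCommGroup I] [Module A I] [AddCommGroup J] [Module A J]
    (e : I ≃ₗ[A] J) {k : ℕ} (h : RelIDimLE R A I k) : RelIDimLE R A J k := by
  intro N _ _ _ _ h₁ h₂
  have : Subsingleton ((Abelian.extFunctorObj (ModuleCat.of A N) (k + 1)).obj
    (ModuleCat.of A I)) := h N h₁ h₂
  exact (((Abelian.extFunctorObj (ModuleCat.of A N) (k + 1)).mapIso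
    e.toModuleIso).addCommGroupIsoToAddEquiv).symm.toEquiv.subsingleton

theorem AddCores.hasProjectiveDimensionLE_of_self (hAB : EndBijective A B M) {k : ℕ}
    (h : AddCores B M k (ModuleCat.of B B)) : HasProjectiveDimensionLE (ModuleCat.of A M) k := by
  have := AddCores.hasProjectiveDimensionLE hAB.1 hAB.2 h
  exact hasProjectiveDimensionLT_of_iso (X := ModuleCat.of A (ModuleCat.of B B →ₗ[B] M))
    (LinearMap.ringLmapEquivSelf B A M).toModuleIso (k + 1)

/-- A coresolution makes `B` reflexive. An `A`-endomorphism of M ≅ Hom_B(B, M) is then evaluation at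
an element of `B`, which is the action of that element. -/
theorem AddCores.endBijective (hAB : EndSurjective A B M) {k : ℕ}
    (h : AddCores B M k (ModuleCat.of B B)) : EndBijective B A M := by
  have hR : HomReflexive A B M B := AddCores.homReflexive hAB h
  refine ⟨fun f => ?_, fun b hb => hR.1 b fun a => ?_⟩
  · obtain ⟨b, hb⟩ := hR.2 (f ∘ₗ (LinearMap.ringLmapEquivSelf B A M).toLinearMap)
    refine ⟨b, fun x => ?_⟩
    have := hb (LinearMap.toSpanSingleton B M x)
    simpa using this
  · rw [← mul_one b, ← smul_eq_mul, map_smul, hb]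

/-- The evaluation isomorphism at X = B reads DM ⊗_A M ≅ DB. -/
theorem AddCores.isFGProj_tensor_and_torVanishes (hB : IsFGProj R B) (hM : IsFGProj R M)
    (hAB : EndBijective A B M) {k : ℕ} (h : AddCores B M k (ModuleCat.of B B)) :
    IsFGProj R (BalTensor R A (StdDual R M) M) ∧ TorVanishes R A (StdDual R M) M := by
  have := hM.2
  let _ : Module R (ModuleCat.of B B) := inferInstanceAs (Module R B)
  have : IsScalarTower R B (ModuleCat.of B B) := inferInstanceAs (IsScalarTower R B B)
  obtain ⟨h₁, h₂⟩ := AddCores.tensorHomToDual_bijective (R := R) hAB.1 hAB.2 h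
  let e : (ModuleCat.of B B →ₗ[B] M) ≃ₗ[A] M := LinearMap.ringLmapEquivSelf B A M
  exact ⟨(hB.stdDual.congr (LinearEquiv.ofBijective _ h₁).symm).congr (BalTensor.congr e),
    h₂.congr e⟩

theorem addCores_self_iff [IsNoetherianRing R] (hA : IsFGProj R A) (hM : IsFGProj R M)
    (hAB : EndBijective A B M) (hBA : EndBijective B A M)
    (hT : Module.Projective R (BalTensor R A (StdDual R M) M))
    (hTor : TorVanishes R A (StdDual R M) M) (k : ℕ) :
    AddCores B M k (ModuleCat.of B B) ↔ HasProjectiveDimensionLE (ModuleCat.of A M) k := by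
  refine ⟨fun h => h.hasProjectiveDimensionLE_of_self hAB, fun h => ?_⟩
  have := hM.1
  exact AddCores.congr hBA.equiv.symm (addCores_of_hasProjectiveDimensionLE hA hM hAB.1 hAB.2 k M
    (Module.Finite.of_restrictScalars_finite R A M) hTor hT
    (InAdd.homReflexive hBA.1 InAdd.self) h)

/-- `Hom_B(M, DB)` is isomorphic to `DM`. -/
def homFromDualEquiv : HomFrom A B M (StdDual R B) ≃ₗ[Aᵐᵒᵖ] StdDual R M where
  toFun f := evalOne f.hom
  map_add' _ _ := rfl
  map_smul' _ _ := rfl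
  invFun φ := HomFrom.mk A (coev B φ)
  left_inv f := coev_evalOne f.hom
  right_inv φ := StdDual.ext fun x => congrArg φ (one_smul B x)

variable (R A B M) in
/-- The evaluation map `M → D Hom_B(M, DB)`. -/
def dualHomFromDual : M →ₗ[A] StdDual R (HomFrom A B M (StdDual R B)) where
  toFun x := show HomFrom A B M (StdDual R B) →ₗ[R] R from
    { toFun := fun f => homFromDualEquiv f x
      map_add' := fun _ _ => rfl
      map_smul' := fun _ _ => rfl }
  map_add' x y := StdDual.ext fun f => StdDual.map_add (homFromDualEquiv f) x y
  map_smul' _ _ := rfl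

theorem dualHomFromDual_apply (x : M) (f : HomFrom A B M (StdDual R B)) :
    dualHomFromDual R A B M x f = homFromDualEquiv f x := rfl

theorem dualHomFromDual_bijective (hM : IsFGProj R M) :
    Function.Bijective (dualHomFromDual R A B M) := by
  have := hM.1
  have := hM.2
  refine ⟨fun x y h => eq_of_forall_dual (R := R) fun φ => ?_, fun χ => ?_⟩
  · have := dualHomFromDual_apply (A := A) (B := B) x (homFromDualEquiv.symm φ)
    rw [h] at this
    rwa [dualHomFromDual_apply, LinearEquiv.apply_symm_apply, eq_comm] at this
  · obtain ⟨x, hx⟩ := exists_eval_eq (R := R) (M := M)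
      (LinearMap.comp (show HomFrom A B M (StdDual R B) →ₗ[R] R from χ)
        ((homFromDualEquiv (R := R) (A := A) (B := B) (M := M)).symm.toLinearMap.restrictScalars R))
    refine ⟨x, StdDual.ext fun f => (hx (homFromDualEquiv f)).trans ?_⟩
    exact congrArg χ (homFromDualEquiv.symm_apply_apply f)

theorem AddRes.relIDimLE_of_dual [IsNoetherianRing R] (hA : IsFGProj R A) (hM : IsFGProj R M)
    (hAB : EndBijective A B M) {k : ℕ} (h : AddRes B M k (ModuleCat.of B (StdDual R B))) :
    RelIDimLE R A M k := by
  have := hM.1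
  have := hM.2
  have hP : Module.Projective R (HomFrom A B M (StdDual R B)) :=
    (hM.stdDual.congr
      ((homFromDualEquiv (R := R) (A := A) (B := B) (M := M)).symm.restrictScalars R)).2
  let _ : Module R (ModuleCat.of B (StdDual R B)) := inferInstanceAs (Module R (StdDual R B))
  have : IsScalarTower R B (ModuleCat.of B (StdDual R B)) :=
    inferInstanceAs (IsScalarTower R B (StdDual R B))
  exact (AddRes.relIDimLE hAB.1 hAB.2 hA h hP).congr 
    (LinearEquiv.ofBijective _ (dualHomFromDual_bijective hM)).symm

/-- Every `A`-endomorphism of `M` is the action of some b, so `B`-linearity of `h` reduces it to its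
values at the identity map, which form the functional. -/
theorem dualReflexive_self (hBA : EndSurjective B A M) : DualReflexive R A B M M := by
  refine ⟨fun ψ hψ => StdDual.ext fun x => hψ x LinearMap.id, fun h => ?_⟩
  refine ⟨show M →ₗ[R] R from
    { toFun := fun x => h x (HomFrom.mk B LinearMap.id)
      map_add' := fun x y => by rw [map_add]; rfl
      map_smul' := fun r x => by rw [LinearMap.map_smul_of_tower]; rfl },
    LinearMap.ext fun x => StdDual.ext fun f => ?_⟩
  obtain ⟨b, hb⟩ := hBA f.hom
  have hf : f = MulOpposite.op b • HomFrom.mk B LinearMap.id := HomFrom.ext hb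
  change h x f = h (f.hom x) (HomFrom.mk B LinearMap.id)
  rw [hb, map_smul, StdDual.smul_apply, ← hf]

/-- The isomorphism `B ≅ End_A(M)` as right `B`-modules. -/
noncomputable def EndBijective.homFromEquiv (h : EndBijective B A M) :
    B ≃ₗ[Bᵐᵒᵖ] HomFrom B A M M :=
  LinearEquiv.ofBijective
    { toFun := fun b => HomFrom.mk B (actionMap A M b)
      map_add' := fun b b' => HomFrom.ext fun x => add_smul b b' x
      map_smul' := fun b b' => HomFrom.ext fun x => mul_smul b' b.unop x }
    ⟨(injective_iff_map_eq_zero _).2 fun b hb => h.2 b fun x => LinearMap.congr_fun hb x,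
      fun f => by
        obtain ⟨b, hb⟩ := h.1 f.hom
        exact ⟨b, HomFrom.ext fun x => (hb x).symm⟩⟩

/-- The dual of an isomorphism of right modules. -/
def StdDual.dualEquiv {U V : Type u} [AddCommGroup U] [AddCommGroup V] [Module R U] [Module R V]
    [Module Bᵐᵒᵖ U] [Module Bᵐᵒᵖ V] [IsScalarTower R Bᵐᵒᵖ U] [IsScalarTower R Bᵐᵒᵖ V]
    (e : U ≃ₗ[Bᵐᵒᵖ] V) : StdDual R V ≃ₗ[B] StdDual R U :=
  LinearEquiv.ofLinearMap (StdDual.dualMap R e.toLinearMap) (StdDual.dualMap R e.symm.toLinearMap)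
    (LinearMap.ext fun φ => StdDual.ext fun x => congrArg φ (e.symm_apply_apply x))
    (LinearMap.ext fun φ => StdDual.ext fun x => congrArg φ (e.apply_symm_apply x))

/-- For the reverse direction, `addRes_of_relIDimLE` is applied to I = M, where D Hom_A(M, M) ≅ DB.
The required vanishing of Ext_A^i(M, M) comes from the Tor hypothesis. -/
theorem addRes_dual_iff [IsNoetherianRing R] (hA : IsFGProj R A) (hM : IsFGProj R M)
    (hAB : EndBijective A B M) (hBA : EndBijective B A M)
    (hT : Module.Projective R (BalTensor R A (StdDual R M) M))
    (hTor : TorVanishes R A (StdDual R M) M) (k : ℕ) :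
    AddRes B M k (ModuleCat.of B (StdDual R B)) ↔ RelIDimLE R A M k := by
  refine ⟨fun h => h.relIDimLE_of_dual hA hM hAB, fun h => ?_⟩
  have := hM.1
  exact AddRes.congr (StdDual.dualEquiv hBA.homFromEquiv)
    (addRes_of_relIDimLE hA hM hAB.1 hAB.2 k M hM h
      (fun i => extVanishes_of_torVanishes hA hM i M
        (Module.Finite.of_restrictScalars_finite R A M) hTor hT) (dualReflexive_self hBA.1)).2

end Correspondence

/-! ### Right modules as left modules over the opposite algebra -/

section OppositeTranslation

variable (R : Type u) [CommRing R] (B : Type u) [Ring B] [Algebra R B]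

/-- The dual of an algebra and of its opposite agree. -/
def stdDualOpEquiv : StdDual R B ≃ₗ[Bᵐᵒᵖ] StdDual R Bᵐᵒᵖ where
  toFun f := LinearMap.comp (show B →ₗ[R] R from f)
    (MulOpposite.opLinearEquiv R : B ≃ₗ[R] Bᵐᵒᵖ).symm.toLinearMap
  invFun f := LinearMap.comp (show Bᵐᵒᵖ →ₗ[R] R from f)
    (MulOpposite.opLinearEquiv R : B ≃ₗ[R] Bᵐᵒᵖ).toLinearMap
  map_add' _ _ := rfl
  map_smul' _ _ := rfl
  left_inv _ := rfl
  right_inv _ := rfl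

/-- The regular right module of an algebra is the regular left module of its opposite. -/
def opRegularEquiv : B ≃ₗ[Bᵐᵒᵖ] Bᵐᵒᵖ where
  __ := MulOpposite.opAddEquiv
  map_smul' _ _ := rfl

variable {R B}

theorem IsFGProj.mulOpposite (h : IsFGProj R B) : IsFGProj R Bᵐᵒᵖ :=
  h.congr (MulOpposite.opLinearEquiv R)

end OppositeTranslation

/-! ### The two classes under the double centralizer property -/

section Pairs

variable {R : Type u} [CommRing R] [IsNoetherianRing R] {A B M : Type u} [Ring A] [Ring B]
  [Algebra R A] [Algebra R B] [AddCommGroup M] [Module R M] [Module A M] [Module Bᵐᵒᵖ M]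
  [IsScalarTower R A M] [IsScalarTower R Bᵐᵒᵖ M] [SMulCommClass A Bᵐᵒᵖ M] [SMulCommClass Bᵐᵒᵖ A M]

theorem hasAddCoresolution_iff_hasProjectiveDimensionLE (hA : IsFGProj R A) (hM : IsFGProj R M)
    (hAB : EndBijective A Bᵐᵒᵖ M) (hBA : EndBijective Bᵐᵒᵖ A M)
    (hT : Module.Projective R (BalTensor R A (StdDual R M) M))
    (hTor : TorVanishes R A (StdDual R M) M) (k : ℕ) :
    HasAddCoresolution R B M k ↔ HasProjectiveDimensionLE (ModuleCat.of A M) k := by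
  have := hM.2
  rw [hasAddCoresolution_iff, ← addCores_self_iff hA hM hAB hBA hT hTor]
  exact ⟨AddCores.congr (opRegularEquiv B), AddCores.congr (opRegularEquiv B).symm⟩

theorem hasAddResolution_iff_relIDimLE (hA : IsFGProj R A) (hB : IsFGProj R B) (hM : IsFGProj R M)
    (hAB : EndBijective A Bᵐᵒᵖ M) (hBA : EndBijective Bᵐᵒᵖ A M)
    (hT : Module.Projective R (BalTensor R A (StdDual R M) M))
    (hTor : TorVanishes R A (StdDual R M) M) (k : ℕ) :
    HasAddResolution R B M k ↔ RelIDimLE R A M k := by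
  have := hM.2
  have := hB.stdDual.2
  rw [hasAddResolution_iff, ← addRes_dual_iff hA hM hAB hBA hT hTor]
  exact ⟨AddRes.congr (stdDualOpEquiv R B), AddRes.congr (stdDualOpEquiv R B).symm⟩

theorem inLambda_of_inGamma (hAB : EndBijective A Bᵐᵒᵖ M) {n m : ℕ}
    (h : (RightPair.mk (R := R) B M).InGamma n m) : (LeftPair.mk (R := R) A M).InLambda n m := by
  obtain ⟨hB, ⟨hfin, hproj, hten, hgen⟩, -, -, -, hcogen⟩ := h
  change IsFGProj R B at hB
  change Module.Finite Bᵐᵒᵖ M at hfin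
  change Module.Projective R M at hproj
  change IsFGProj R (BalTensor R B M (StdDual R M)) at hten
  change IsLeast {k | HasAddCoresolution R B M k} n at hgen
  change IsLeast {k | HasAddResolution R B M k} m at hcogen
  have hB' := hB.mulOpposite
  have := hB'.1
  have hM : IsFGProj R M := ⟨Module.Finite.trans Bᵐᵒᵖ M, hproj⟩
  have := hM.1
  have hten' := hten.congr (balTensorSwap R B M)
  -- `A` is End_B(M), the `R`-dual of the tensor product assumed to be projective.
  have hA : IsFGProj R A := (isFGProj_hom hten').congr (hAB.equiv.restrictScalars R).symm
  have hcor : AddCores Bᵐᵒᵖ M n (ModuleCat.of Bᵐᵒᵖ Bᵐᵒᵖ) :=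
    AddCores.congr (opRegularEquiv B) ((hasAddCoresolution_iff R B M n).1 hgen.1)
  have hBA := hcor.endBijective hAB.1
  obtain ⟨hT, hTor⟩ := hcor.isFGProj_tensor_and_torVanishes hB' hM hAB
  refine ⟨hA, Module.Finite.of_restrictScalars_finite R A M, hproj,
    relDomDimGE_two hB' hM hAB hBA hten'.2, ?_, ?_, hT, hTor⟩
  -- The two sets of admissible lengths coincide, so their least elements do.
  · exact (congrArg (IsLeast · n) (Set.ext fun k =>
      hasAddCoresolution_iff_hasProjectiveDimensionLE hA hM hAB hBA hT.2 hTor k)).mp hgen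
  · exact (congrArg (IsLeast · m) (Set.ext fun k =>
      hasAddResolution_iff_relIDimLE hA hB hM hAB hBA hT.2 hTor k)).mp hcogen

theorem inGamma_of_inLambda (hBA : EndBijective Bᵐᵒᵖ A M) {n m : ℕ}
    (h : (LeftPair.mk (R := R) A M).InLambda n m) : (RightPair.mk (R := R) B M).InGamma n m := by
  obtain ⟨hA, hfin, hproj, hdom, hpd, hid, hT, hTor⟩ := h
  change IsFGProj R A at hA
  change Module.Finite A M at hfin
  change Module.Projective R M at hproj
  change RelDomDimGE R A M A 2 at hdom
  change IsLeast {k | HasProjectiveDimensionLE (ModuleCat.of A M) k} n at hpd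
  change IsLeast {k | RelIDimLE R A M k} m at hid
  change IsFGProj R (BalTensor R A (StdDual R M) M) at hT
  change TorVanishes R A (StdDual R M) M at hTor
  have := hA.1
  have hM : IsFGProj R M := ⟨Module.Finite.trans A M, hproj⟩
  have := hM.1
  have hAB := endBijective_of_relDomDimGE hBA.1 hdom
  have hB' : IsFGProj R Bᵐᵒᵖ := (isFGProj_hom hT).congr (hBA.equiv.restrictScalars R).symm
  have hB : IsFGProj R B := hB'.congr (MulOpposite.opLinearEquiv R).symm
  have := hB'.1
  have hten := (isFGProj_tensor_of_relDomDimGE hA hBA.1 hdom).congr (balTensorSwap R B M).symm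
  have hfin' : Module.Finite Bᵐᵒᵖ M := Module.Finite.of_restrictScalars_finite R Bᵐᵒᵖ M
  refine ⟨hB, ⟨hfin', hproj, hten, ?_⟩, hfin', hproj, hten, ?_⟩
  · exact (congrArg (IsLeast · n) (Set.ext fun k =>
      hasAddCoresolution_iff_hasProjectiveDimensionLE hA hM hAB hBA hT.2 hTor k)).mpr hpd
  · exact (congrArg (IsLeast · m) (Set.ext fun k =>
      hasAddResolution_iff_relIDimLE hA hB hM hAB hBA hT.2 hTor k)).mpr hid

end Pairs

/-! ### Endomorphism algebras and double centralizers -/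

section EndomorphismAlgebras

variable {R : Type u} [CommRing R] {A B M : Type u} [Ring A] [Ring B]
  [Algebra R A] [Algebra R B] [AddCommGroup M] [Module R M] [Module A M] [Module B M]
  [IsScalarTower R A M] [IsScalarTower R B M] [SMulCommClass A B M] [SMulCommClass B A M]

/-- The isomorphism of algebras `A ≅ End_B(M)`. -/
noncomputable def EndBijective.algEquiv (h : EndBijective A B M) : A ≃ₐ[R] Module.End B M :=
  AlgEquiv.ofBijective
    { toFun := fun a => actionMap B M a
      map_one' := LinearMap.ext fun x => one_smul A x
      map_mul' := fun a a' => LinearMap.ext fun x => mul_smul a a' x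
      map_zero' := LinearMap.ext fun x => zero_smul A x
      map_add' := fun a a' => LinearMap.ext fun x => add_smul a a' x
      commutes' := fun r => LinearMap.ext fun x => algebraMap_smul A r x }
    ⟨(injective_iff_map_eq_zero _).2 fun a ha => h.2 a fun x => LinearMap.congr_fun ha x,
      fun f => by
        obtain ⟨a, ha⟩ := h.1 f
        exact ⟨a, LinearMap.ext fun x => (ha x).symm⟩⟩

/-- Conjugation by a semilinear isomorphism, as an isomorphism of endomorphism algebras. -/
def endConjEquiv {A' M' : Type u} [Ring A'] [Algebra R A'] [AddCommGroup M'] [Module R M']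
    [Module A' M'] [IsScalarTower R A' M'] (φ : A ≃ₐ[R] A') (ψ : M ≃+ M')
    (h : ∀ (a : A) (x : M), ψ (a • x) = φ a • ψ x) : Module.End A M ≃ₐ[R] Module.End A' M' :=
  have h' : ∀ (a : A') (x : M'), ψ.symm (a • x) = φ.symm a • ψ.symm x := fun a x => by
    rw [AddEquiv.symm_apply_eq, h, AlgEquiv.apply_symm_apply, AddEquiv.apply_symm_apply]
  { toFun := fun f =>
      { toFun := fun x => ψ (f (ψ.symm x))
        map_add' := fun x y => by simp
        map_smul' := fun a x => by simp [h, h'] }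
    invFun := fun f =>
      { toFun := fun x => ψ.symm (f (ψ x))
        map_add' := fun x y => by simp
        map_smul' := fun a x => by simp [h, h'] }
    left_inv := fun f => LinearMap.ext fun x => by simp
    right_inv := fun f => LinearMap.ext fun x => by simp
    map_mul' := fun f g => LinearMap.ext fun x => by simp
    map_add' := fun f g => LinearMap.ext fun x => by simp
    commutes' := fun r => LinearMap.ext fun x => by
      change ψ (r • ψ.symm x) = r • x
      rw [← algebraMap_smul A r, h, AddEquiv.apply_symm_apply, AlgEquiv.commutes,
        algebraMap_smul] }

end EndomorphismAlgebras

section DoubleCentralizer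

variable {R : Type u} [CommRing R] {S M : Type u} [Ring S] [Algebra R S] [AddCommGroup M]
  [Module R M] [Module S M] [IsScalarTower R S M]

instance Module.End.instSMulCommClassSelf : SMulCommClass (Module.End S M) S M :=
  ⟨fun f s x => f.map_smul s x⟩

instance Module.End.instSMulCommClassSelf' : SMulCommClass S (Module.End S M) M :=
  SMulCommClass.symm _ _ _

instance Module.End.instIsScalarTowerSelf : IsScalarTower R (Module.End S M) M :=
  ⟨fun _ _ _ => rfl⟩

theorem endBijective_end : EndBijective (Module.End S M) S M :=
  ⟨fun f => ⟨f, fun _ => rfl⟩, fun _ h => LinearMap.ext h⟩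

/-- The same term as the local instance inside `LeftPair.toEndOp`, so results proved with it apply
to that pair definitionally. -/
instance Module.End.instModuleOpOp : Module (Module.End S M)ᵐᵒᵖᵐᵒᵖ M :=
  Module.compHom M (RingEquiv.opOp (Module.End S M)).symm.toRingHom

instance Module.End.instIsScalarTowerOpOp : IsScalarTower R (Module.End S M)ᵐᵒᵖᵐᵒᵖ M :=
  ⟨fun _ _ _ => rfl⟩

instance Module.End.instSMulCommClassOpOp : SMulCommClass (Module.End S M)ᵐᵒᵖᵐᵒᵖ S M :=
  ⟨fun f s x => f.unop.unop.map_smul s x⟩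

instance Module.End.instSMulCommClassOpOp' : SMulCommClass S (Module.End S M)ᵐᵒᵖᵐᵒᵖ M :=
  SMulCommClass.symm _ _ _

theorem endBijective_end_opOp : EndBijective (Module.End S M)ᵐᵒᵖᵐᵒᵖ S M :=
  ⟨fun f => ⟨MulOpposite.op (MulOpposite.op f), fun _ => rfl⟩, fun _ h =>
    MulOpposite.unop_injective (MulOpposite.unop_injective (LinearMap.ext h))⟩

end DoubleCentralizer

/-! ### The bijection on isomorphism classes -/

section PairIsomorphisms

variable {R : Type u} [CommRing R]

theorem RightPair.InGamma.toEnd [IsNoetherianRing R] {P : RightPair R} {n m : ℕ}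
    (h : P.InGamma n m) : P.toEnd.InLambda n m :=
  inLambda_of_inGamma (A := Module.End P.Bᵐᵒᵖ P.M) (B := P.B) (M := P.M) endBijective_end h

theorem LeftPair.InLambda.toEndOp [IsNoetherianRing R] {Q : LeftPair R} {n m : ℕ}
    (h : Q.InLambda n m) : Q.toEndOp.InGamma n m :=
  inGamma_of_inLambda (A := Q.A) (B := (Module.End Q.A Q.M)ᵐᵒᵖ) (M := Q.M)
    endBijective_end_opOp h

theorem RightPair.Iso.toEnd {P Q : RightPair R} (h : P.Iso Q) : P.toEnd.Iso Q.toEnd := by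
  obtain ⟨φ, ψ, h⟩ := h
  have h' : ∀ (b : P.Bᵐᵒᵖ) (x : P.M), ψ (b • x) = AlgEquiv.op φ b • ψ x := fun b x => h b.unop x
  exact ⟨endConjEquiv (AlgEquiv.op φ) ψ h', ψ, fun f x =>
    congrArg (fun y => ψ ((show Module.End P.Bᵐᵒᵖ P.M from f) y)) (ψ.symm_apply_apply x).symm⟩

theorem LeftPair.Iso.toEndOp {P Q : LeftPair R} (h : P.Iso Q) : P.toEndOp.Iso Q.toEndOp := by
  obtain ⟨φ, ψ, h⟩ := h
  exact ⟨AlgEquiv.op (endConjEquiv φ ψ h), ψ, fun f x =>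
    congrArg (fun y => ψ (f.unop y)) (ψ.symm_apply_apply x).symm⟩

/-- The coresolution of `P.B` makes the opposite of `P.B` the full commutant of its endomorphism
algebra on `P.M`; passing to opposites recovers `P.B`, with the identity on `P.M`. -/
theorem RightPair.InGamma.iso_toEnd_toEndOp {P : RightPair R} {n m : ℕ}
    (h : P.InGamma n m) : P.toEnd.toEndOp.Iso P := by
  have hproj : Module.Projective R P.M := h.2.1.2.1
  have hcor : AddCores P.Bᵐᵒᵖ P.M n (ModuleCat.of P.Bᵐᵒᵖ P.Bᵐᵒᵖ) :=
    AddCores.congr (opRegularEquiv P.B) ((hasAddCoresolution_iff R P.B P.M n).1 h.2.1.2.2.2.1)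
  have hBA : EndBijective P.Bᵐᵒᵖ (Module.End P.Bᵐᵒᵖ P.M) P.M :=
    hcor.endBijective endBijective_end.1
  let e : P.Bᵐᵒᵖ ≃ₐ[R] Module.End (Module.End P.Bᵐᵒᵖ P.M) P.M := hBA.algEquiv
  exact RightPair.iso_equivalence.symm
    ⟨(AlgEquiv.opOp R P.B).trans (AlgEquiv.op e), AddEquiv.refl _, fun _ _ => rfl⟩

/-- Dominant dimension at least two identifies `Q.A` with its double centralizer on `Q.M`. -/
theorem LeftPair.InLambda.iso_toEndOp_toEnd {Q : LeftPair R} {n m : ℕ}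
    (h : Q.InLambda n m) : Q.toEndOp.toEnd.Iso Q := by
  have hdom : RelDomDimGE R Q.A Q.M Q.A 2 := h.2.2.2.1
  have hAB : EndBijective Q.A (Module.End Q.A Q.M)ᵐᵒᵖᵐᵒᵖ Q.M :=
    endBijective_of_relDomDimGE endBijective_end_opOp.1 hdom
  let e : Q.A ≃ₐ[R] Module.End (Module.End Q.A Q.M)ᵐᵒᵖᵐᵒᵖ Q.M := hAB.algEquiv
  exact LeftPair.iso_equivalence.symm ⟨e, AddEquiv.refl _, fun _ _ => rfl⟩

end PairIsomorphisms

theorem theorem3p5 (R : Type u) [CommRing R] [IsNoetherianRing R] (n m : ℕ) :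
    ∃ (hΦ : ∀ P : RightPair R, P.InGamma n m → P.toEnd.InLambda n m)
      (hΨ : ∀ Q : LeftPair R, Q.InLambda n m → Q.toEndOp.InGamma n m)
      (e : Quotient (gammaSetoid R n m) ≃ Quotient (lambdaSetoid R n m)),
      (∀ P : {P : RightPair R // P.InGamma n m},
        e (Quotient.mk (gammaSetoid R n m) P) =
          Quotient.mk (lambdaSetoid R n m) ⟨P.1.toEnd, hΦ P.1 P.2⟩) ∧
      (∀ Q : {Q : LeftPair R // Q.InLambda n m},
        e.symm (Quotient.mk (lambdaSetoid R n m) Q) =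
          Quotient.mk (gammaSetoid R n m) ⟨Q.1.toEndOp, hΨ Q.1 Q.2⟩) := by
  refine ⟨fun _ h => h.toEnd, fun _ h => h.toEndOp,
    { toFun := Quotient.map' (fun P => ⟨P.1.toEnd, P.2.toEnd⟩) fun _ _ h =>
        RightPair.Iso.toEnd h
      invFun := Quotient.map' (fun Q => ⟨Q.1.toEndOp, Q.2.toEndOp⟩) fun _ _ h =>
        LeftPair.Iso.toEndOp h
      left_inv := ?_
      right_inv := ?_ }, fun _ => rfl, fun _ => rfl⟩
  · rintro ⟨P⟩
    exact Quotient.sound P.2.iso_toEnd_toEndOp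
  · rintro ⟨Q⟩
    exact Quotient.sound Q.2.iso_toEndOp_toEnd
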